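/- **Notation.** Let $q\in\mathbb{C}$ with $0<|q|<1$. For $x\neq 0$ put $(x;q)_\infty=\prod_{i\ge 0}(1-q^ix)$, $j(x;q)=(x;q)_\infty(q/x;q)_\infty(q;q)_\infty$, $J_m=\prod_{i\ge1}(1-q^{mi})$, $$m(x,q,z)=\frac{1}{j(z;q)}\sum_{r\in\mathbb{Z}}\frac{(-1)^rq^{\binom r2}z^r}{1-q^{r-1}xz},$$ and $\mathrm{sg}(r)=1$ for $r\ge 0$, $\mathrm{sg}(r)=-1$ for $r<0$ ($r\in\mathbb{Z}$). Let $$\begin{aligned}G(x,y,z;q)={}&z\,\frac{J_4^3\,j(q^2y^2z^2;q^4)}{j(q^2y^2;q^4)\,j(z^2;q^4)}\,m\Big(-\frac{qx}{yz},q^2,-qyz\Big)+z\,\frac{J_4^3\,j(q^2x^2z^2;q^4)}{j(q^2x^2;q^4)\,j(z^2;q^4)}\,m\Big(-\frac{qy}{xz},q^2,-qxz\Big)\\&-z\,\frac{J_1^3J_2^3}{j(x;q)j(y;q)j(z;q)}\cdot\frac{j(xy;q^2)\,j(qxz;q^2)\,j(qyz;q^2)}{j(-xq;q^2)\,j(-yq;q^2)\,j(-z;q^2)}\\&-\frac{q}{xy}\,\frac{J_4^3\,j(x^2y^2;q^4)}{j(q^2x^2;q^4)\,j(q^2y^2;q^4)}\,m\Big(-\frac{qz}{xy},q^2,-xy\Big)\end{aligned}$$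 and $$F(x,y,z;q)=z\sum_{\mathrm{sg}(s)=\mathrm{sg}(t)}\mathrm{sg}(s)\frac{q^{4st+2s}y^{2s}z^{2t}}{1-x^2q^{4s+4t+2}}+xyq\sum_{\mathrm{sg}(s)=\mathrm{sg}(t)}\mathrm{sg}(s)\frac{q^{4st+2s+4t}y^{2s}z^{2t}}{1-x^2q^{4s+4t+2}}.$$ Call $(x,y,z)$ *regular* if for all $n\in\mathbb{Z}$: $x\ne q^{2n}$, $yz\neq -q^{2n+1}$, $xz\ne -q^{2n+1}$, $xy\neq -q^{2n}$. (Regular triples are dense.) **Theorem 3.** Let $y,z\in\mathbb{C}$ with $|q|<|y|<1$ and $|q|<|z|<1$. (a) If $|q|<|x|<1$, then the following triple series converges absolutely, and $$\sum_{\substack{\mathrm{sg}(r)=\mathrm{sg}(s)=\mathrm{sg}(t)\\ r\equiv s\not\equiv t\ (\mathrm{mod}\ 2)}}q^{rs+rt+st}x^ry^sz^t=G(x,y,z;q)$$ whenever $yz\ne -q$ and $xz\neq -q$. If $yz=-q$ or $xz=-q$, the identity holds with the right-hand side replaced by the limit of $G(x',y',z';q)$ as $(x',y',z')\to(x,y,z)$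 through regular triples. (b) More strongly, if $x\ne0$ and $x\neq\pm q^{2n+1}$ for all $n\in\mathbb{Z}$, then both double series in $F(x,y,z;q)$ converge absolutely, and $F(x,y,z;q)=G(x,y,z;q)$ whenever $(x,y,z)$ is regular. If $(x,y,z)$ is not regular, this holds with the right-hand side replaced by the limit of $G$ at $(x,y,z)$ through regular triples. -/

import Mathlib

open Filter Topology

noncomputable section

namespace KroneckerTriple

/-- The infinite `q`-shifted factorial `(x; q)_∞ = ∏_{i ≥ 0} (1 - q^i x)`. -/
def qPoch (x q : ℂ) : ℂ := ∏' i : ℕ, (1 - q ^ i * x)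

/-- The theta function `j(x; q) = (x; q)_∞ (q/x; q)_∞ (q; q)_∞`. -/
def theta (x q : ℂ) : ℂ := qPoch x q * qPoch (q / x) q * qPoch q q

/-- `J_m = ∏_{i ≥ 1} (1 - q^{m i}) = (q^m; q^m)_∞`. -/
def J (q : ℂ) (m : ℕ) : ℂ := qPoch (q ^ m) (q ^ m)

/-- The Appell–Lerch function
`m(x, q, z) = (1 / j(z; q)) ∑_{r ∈ ℤ} (-1)^r q^{r(r-1)/2} z^r / (1 - q^{r-1} x z)`.
The integer division by `2` is exact. -/
def appellLerch (x q z : ℂ) : ℂ :=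
  1 / theta z q *
    ∑' r : ℤ, (-1) ^ r * q ^ (r * (r - 1) / 2) * z ^ r / (1 - q ^ (r - 1) * x * z)

/-- `sg(r) = 1` for `r ≥ 0` and `sg(r) = -1` for `r < 0`. -/
def sg (r : ℤ) : ℤ := if 0 ≤ r then 1 else -1

/-- The triples `(r, s, t)` with `sg(r) = sg(s) = sg(t)` and `r ≡ s ≢ t (mod 2)`. -/
def tripleIndex : Set (ℤ × ℤ × ℤ) :=
  {p | sg p.1 = sg p.2.1 ∧ sg p.2.1 = sg p.2.2 ∧
    p.1 ≡ p.2.1 [ZMOD 2] ∧ ¬ p.2.1 ≡ p.2.2 [ZMOD 2]}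

/-- The summand `q^{rs+rt+st} x^r y^s z^t`. -/
def tripleTerm (q x y z : ℂ) (p : ℤ × ℤ × ℤ) : ℂ :=
  q ^ (p.1 * p.2.1 + p.1 * p.2.2 + p.2.1 * p.2.2) * x ^ p.1 * y ^ p.2.1 * z ^ p.2.2

/-- The triple sum over `tripleIndex`. -/
def tripleSum (q x y z : ℂ) : ℂ := ∑' p : tripleIndex, tripleTerm q x y z p

/-- The pairs `(s, t)` with `sg(s) = sg(t)`. -/
def pairIndex : Set (ℤ × ℤ) := {p | sg p.1 = sg p.2}

/-- The summand `sg(s) q^{4st+2s} y^{2s} z^{2t} / (1 - x² q^{4s+4t+2})`. -/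
def pairTerm₁ (q x y z : ℂ) (p : ℤ × ℤ) : ℂ :=
  (sg p.1 : ℂ) * (q ^ (4 * p.1 * p.2 + 2 * p.1) * y ^ (2 * p.1) * z ^ (2 * p.2) /
    (1 - x ^ 2 * q ^ (4 * p.1 + 4 * p.2 + 2)))

/-- The summand `sg(s) q^{4st+2s+4t} y^{2s} z^{2t} / (1 - x² q^{4s+4t+2})`. -/
def pairTerm₂ (q x y z : ℂ) (p : ℤ × ℤ) : ℂ :=
  (sg p.1 : ℂ) * (q ^ (4 * p.1 * p.2 + 2 * p.1 + 4 * p.2) * y ^ (2 * p.1) * z ^ (2 * p.2) /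
    (1 - x ^ 2 * q ^ (4 * p.1 + 4 * p.2 + 2)))

/-- The double-sum function `F(x, y, z; q)`. -/
def F (q x y z : ℂ) : ℂ :=
  z * ∑' p : pairIndex, pairTerm₁ q x y z p + x * y * q * ∑' p : pairIndex, pairTerm₂ q x y z p

/-- The combination `G(x, y, z; q)` of three Appell–Lerch terms and a theta quotient. -/
def G (q x y z : ℂ) : ℂ :=
  z * (J q 4 ^ 3 * theta (q ^ 2 * y ^ 2 * z ^ 2) (q ^ 4) /
      (theta (q ^ 2 * y ^ 2) (q ^ 4) * theta (z ^ 2) (q ^ 4))) *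
      appellLerch (-(q * x / (y * z))) (q ^ 2) (-(q * y * z))
  + z * (J q 4 ^ 3 * theta (q ^ 2 * x ^ 2 * z ^ 2) (q ^ 4) /
      (theta (q ^ 2 * x ^ 2) (q ^ 4) * theta (z ^ 2) (q ^ 4))) *
      appellLerch (-(q * y / (x * z))) (q ^ 2) (-(q * x * z))
  - z * (J q 1 ^ 3 * J q 2 ^ 3 / (theta x q * theta y q * theta z q)) *
      (theta (x * y) (q ^ 2) * theta (q * x * z) (q ^ 2) * theta (q * y * z) (q ^ 2) /
        (theta (-(x * q)) (q ^ 2) * theta (-(y * q)) (q ^ 2) * theta (-z) (q ^ 2)))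
  - q / (x * y) * (J q 4 ^ 3 * theta (x ^ 2 * y ^ 2) (q ^ 4) /
      (theta (q ^ 2 * x ^ 2) (q ^ 4) * theta (q ^ 2 * y ^ 2) (q ^ 4))) *
      appellLerch (-(q * z / (x * y))) (q ^ 2) (-(x * y))

/-- The triples `(x, y, z)` that avoid the removable singularities of the expression `G`:
`x = q^{2n}` (a zero of `j(x; q)` and a pole of the first Appell–Lerch series), and the zeros
`yz = -q^{2n+1}`, `xz = -q^{2n+1}`, `xy = -q^{2n}` of the theta functions by which the three
Appell–Lerch functions are divided. -/
def regularSet (q : ℂ) : Set (ℂ × ℂ × ℂ) :=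
  {p | ∀ n : ℤ, p.1 ≠ q ^ (2 * n) ∧ p.2.1 * p.2.2 ≠ -q ^ (2 * n + 1) ∧
    p.1 * p.2.2 ≠ -q ^ (2 * n + 1) ∧ p.1 * p.2.1 ≠ -q ^ (2 * n)}

/-- `regularSet q` is dense, so limits along it are meaningful at every point. -/
theorem dense_regularSet (q : ℂ) : Dense (regularSet q) := by
  have key : ∀ (S : Set ℂ), S.Countable → ∀ (a : ℂ) (ε : ℝ), 0 < ε → ∃ b, dist a b < ε ∧ b ∉ S := by
    intro S hS a ε hε
    obtain ⟨b, hb, h⟩ := (hS.dense_compl ℂ).exists_dist_lt a hε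
    exact ⟨b, h, hb⟩
  rw [Metric.dense_iff]
  rintro ⟨x, y, z⟩ ε hε
  obtain ⟨x', hx, hx'⟩ := key ({0} ∪ Set.range fun n : ℤ => q ^ (2 * n))
    ((Set.countable_singleton 0).union (Set.countable_range _)) x ε hε
  obtain ⟨y', hy, hy'⟩ := key ({0} ∪ Set.range fun n : ℤ => -q ^ (2 * n) / x')
    ((Set.countable_singleton 0).union (Set.countable_range _)) y ε hε
  obtain ⟨z', hz, hz'⟩ := key ((Set.range fun n : ℤ => -q ^ (2 * n + 1) / x') ∪
      Set.range fun n : ℤ => -q ^ (2 * n + 1) / y')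
    ((Set.countable_range _).union (Set.countable_range _)) z ε hε
  simp only [Set.mem_union, Set.mem_singleton_iff, Set.mem_range, not_or, not_exists] at hx' hy' hz'
  refine ⟨(x', y', z'), ?_, fun n => ⟨fun h => hx'.2 n h.symm, fun h => hz'.2 n ?_,
    fun h => hz'.1 n ?_, fun h => hy'.2 n ?_⟩⟩
  · simp only [Metric.mem_ball, Prod.dist_eq, max_lt_iff]
    exact ⟨by rwa [dist_comm], by rwa [dist_comm], by rwa [dist_comm]⟩
  · rw [← h]; exact mul_div_cancel_left₀ _ hy'.1
  · rw [← h]; exact mul_div_cancel_left₀ _ hx'.1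
  · rw [← h]; exact mul_div_cancel_left₀ _ hx'.1

end KroneckerTriple

end

/-! Fix `y`, `z` and regard both sides as functions of `x`. Put `Q = q⁴`, `X = x²q²`, `w = q²y²`, `a
= z²`. Then `F` is a combination of two values of the signed double sum `pairSum`, at `(X, w, a)`
and `(X, w, Qa)`. Replacing `x` by `q²x` replaces `X` by `QX`, and a shift of `s` or `t` turns each
double sum into a multiple of the other, up to boundary lines. These boundary lines are bilateral
series which Kronecker's identity (`fracSum_zpow_eq`) evaluates as theta quotients. Hence `F(q²x) =
(qx/(yz)) F(x) + (explicit theta quotients)`.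

The Appell–Lerch terms of `G` satisfy first-order `q²`-difference equations as well, and `G` obeys
the same inhomogeneous equation (`reducedF_mul`, `reducedG_mul`). So `D = F - G` satisfies the
homogeneous equation `D(q²x) = (qx/(yz)) D(x)`.

The only possible singularities of `D` in `x ≠ 0` lie at `x = q^{2n}` and `x = ±q^{2n+1}`. By the
functional equation it is enough to look at `x = 1` and `x = ±q`. At `x = 1` the residues of the
first Appell–Lerch term and of the theta quotient cancel. At `x = ±q` the function `F` is regular,
because a pole there would need `s + t = -1`, which is impossible for `sg(s) = sg(t)`; the numerator
of `G` vanishes there by the symmetric relation `lerch_add_lerch`. Therefore `D` is analytic for `x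
≠ 0`. Since the multiplier tends to `0` as `x → 0`, `D` stays bounded and extends to `0`; comparing
leading coefficients at `0` forces `D = 0` (`eq_zero_of_quasiperiodic`).

The same rigidity principle proves Kronecker's identity and `lerch_add_lerch`, there with a constant
multiplier that is not a power of the period. Its periodic version gives the Jacobi triple product
up to a constant, which the pentagonal number theorem fixes.

For `|q| < |x| < 1` the triple sum splits by parity, and summing the geometric series over `r` gives
`F`. The limit statements follow because `F` is jointly continuous and equals `G` at nearby regular
triples. -/

noncomputable section

namespace KroneckerTriple

/-! ### The infinite `q`-shifted factorial. -/

section Pochhammer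

variable {q : ℂ}

theorem summable_norm_pow_mul (hq : ‖q‖ < 1) (x : ℂ) : Summable fun i : ℕ => ‖-(q ^ i * x)‖ := by
  simp only [norm_neg, norm_mul, norm_pow]
  exact (summable_geometric_of_lt_one (norm_nonneg _) hq).mul_right _

theorem multipliable_qPoch (hq : ‖q‖ < 1) (x : ℂ) : Multipliable fun i : ℕ => 1 - q ^ i * x := by
  simpa only [sub_eq_add_neg] using multipliable_one_add_of_summable (summable_norm_pow_mul hq x)

theorem qPoch_eq_one_sub_mul (hq : ‖q‖ < 1) (x : ℂ) :
    qPoch x q = (1 - x) * qPoch (q * x) q := by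
  have h := tprod_eq_zero_mul' (f := fun i : ℕ => 1 - q ^ i * x)
    (by simpa only [pow_succ, mul_assoc] using multipliable_qPoch hq (q * x))
  simp only [qPoch, h, pow_succ, pow_zero, one_mul, mul_assoc]

theorem qPoch_ne_zero (hq : ‖q‖ < 1) {x : ℂ} (hx : ∀ i : ℕ, q ^ i * x ≠ 1) : qPoch x q ≠ 0 := by
  have := tprod_one_add_ne_zero_of_summable (f := fun i : ℕ => -(q ^ i * x))
    (fun i h => hx i (by linear_combination -h)) (summable_norm_pow_mul hq x)
  simpa only [qPoch, sub_eq_add_neg] using this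

theorem qPoch_self_ne_zero (hq : ‖q‖ < 1) : qPoch q q ≠ 0 := by
  refine qPoch_ne_zero hq fun i h => ?_
  have h2 : ‖q ^ (i + 1)‖ < 1 := by
    rw [norm_pow]; exact pow_lt_one₀ (norm_nonneg _) hq (by omega)
  rw [pow_succ, h] at h2
  simp at h2

theorem differentiable_qPoch (hq : ‖q‖ < 1) : Differentiable ℂ fun x => qPoch x q := by
  intro x₀
  have hU : IsOpen (Metric.ball (0 : ℂ) (‖x₀‖ + 1)) := Metric.isOpen_ball
  have hu : Summable fun i : ℕ => ‖q‖ ^ i * (‖x₀‖ + 1) :=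
    (summable_geometric_of_lt_one (norm_nonneg _) hq).mul_right _
  have h := Summable.hasProdLocallyUniformlyOn_one_add (f := fun (i : ℕ) (x : ℂ) => -(q ^ i * x)) hU hu
    (Eventually.of_forall fun i x hx => by
      rw [norm_neg, norm_mul, norm_pow]
      have : ‖x‖ ≤ ‖x₀‖ + 1 := (mem_ball_zero_iff.1 hx).le
      gcongr) (fun i => by fun_prop)
  have h2 : DifferentiableOn ℂ (fun x => ∏' i : ℕ, (1 + -(q ^ i * x)))
      (Metric.ball (0 : ℂ) (‖x₀‖ + 1)) := by
    rw [hasProdLocallyUniformlyOn_iff_tendstoLocallyUniformlyOn] at h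
    exact h.differentiableOn (Eventually.of_forall fun s => by fun_prop) hU
  simpa only [qPoch, sub_eq_add_neg] using
    h2.differentiableAt (hU.mem_nhds (by simp))

theorem qPoch_sq (hq : ‖q‖ < 1) (x : ℂ) :
    qPoch (x ^ 2) (q ^ 2) = qPoch x q * qPoch (-x) q := by
  rw [qPoch, qPoch, qPoch, ← (multipliable_qPoch hq x).tprod_mul (multipliable_qPoch hq (-x))]
  congr 1; ext i; ring

theorem norm_sq_lt_one (hq : ‖q‖ < 1) : ‖q ^ 2‖ < 1 := by
  rw [norm_pow]; exact pow_lt_one₀ (norm_nonneg _) hq two_ne_zero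

theorem qPoch_split (hq : ‖q‖ < 1) (x : ℂ) :
    qPoch x q = qPoch x (q ^ 2) * qPoch (q * x) (q ^ 2) := by
  have h1 := multipliable_qPoch (norm_sq_lt_one hq) x
  have h2 := multipliable_qPoch (norm_sq_lt_one hq) (q * x)
  rw [qPoch, ← tprod_even_mul_odd (f := fun i : ℕ => 1 - q ^ i * x)]
  · congr 1 <;> (rw [qPoch]; congr 1; ext i; ring)
  · convert h1 using 2; ring
  · convert h2 using 2; ring

end Pochhammer

/-! ### Theta functions: quasi-periodicity, zeros, and product formulas. -/

section Theta

variable {q : ℂ}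

theorem theta_mul_left (hq0 : q ≠ 0) (hq : ‖q‖ < 1) {x : ℂ} (hx : x ≠ 0) :
    theta (q * x) q = -x⁻¹ * theta x q := by
  rw [theta, theta, qPoch_eq_one_sub_mul hq x, qPoch_eq_one_sub_mul hq (q / (q * x)),
    show q / (q * x) = x⁻¹ by field_simp, show q * x⁻¹ = q / x from rfl]
  field_simp
  ring

theorem theta_ne_zero (hq0 : q ≠ 0) (hq : ‖q‖ < 1) {x : ℂ} (hx0 : x ≠ 0)
    (hx : ∀ n : ℤ, q ^ n * x ≠ 1) : theta x q ≠ 0 := by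
  refine mul_ne_zero (mul_ne_zero (qPoch_ne_zero hq fun i => by simpa using hx i)
    (qPoch_ne_zero hq fun i h => hx (-(i + 1)) ?_)) (qPoch_self_ne_zero hq)
  rw [zpow_neg, ← Nat.cast_one, ← Nat.cast_add, zpow_natCast, pow_succ]
  field_simp at h
  field_simp
  exact h.symm

/-- The theta function with its zero at `x = 1` removed. -/
def thetaReg (x q : ℂ) : ℂ := qPoch (q * x) q * qPoch (q / x) q * qPoch q q

theorem theta_eq_one_sub_mul (hq : ‖q‖ < 1) (x : ℂ) :
    theta x q = (1 - x) * thetaReg x q := by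
  rw [theta, thetaReg, qPoch_eq_one_sub_mul hq x]; ring

theorem thetaReg_one (q : ℂ) : thetaReg 1 q = qPoch q q ^ 3 := by
  rw [thetaReg, mul_one, div_one]; ring

theorem analyticAt_qPoch (hq : ‖q‖ < 1) (x : ℂ) : AnalyticAt ℂ (fun x => qPoch x q) x :=
  (differentiable_qPoch hq).analyticAt x

theorem analyticAt_theta (hq : ‖q‖ < 1) {x : ℂ} (hx : x ≠ 0) :
    AnalyticAt ℂ (fun x => theta x q) x := by
  unfold theta
  refine ((analyticAt_qPoch hq x).mul ?_).mul analyticAt_const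
  exact AnalyticAt.fun_comp (analyticAt_qPoch hq _) (analyticAt_const.div analyticAt_id hx)

theorem analyticAt_thetaReg (hq : ‖q‖ < 1) {x : ℂ} (hx : x ≠ 0) :
    AnalyticAt ℂ (fun x => thetaReg x q) x := by
  unfold thetaReg
  refine (AnalyticAt.mul ?_ ?_).mul analyticAt_const
  · exact AnalyticAt.fun_comp (analyticAt_qPoch hq _) (analyticAt_const.mul analyticAt_id)
  · exact AnalyticAt.fun_comp (analyticAt_qPoch hq _) (analyticAt_const.div analyticAt_id hx)

theorem theta_sq_mul (hq : ‖q‖ < 1) (x : ℂ) :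
    theta (x ^ 2) (q ^ 2) * qPoch q q ^ 2 =
      qPoch (q ^ 2) (q ^ 2) * (theta x q * theta (-x) q) := by
  rw [theta, theta, theta, ← div_pow, qPoch_sq hq x, qPoch_sq hq (q / x), div_neg]
  ring

theorem theta_split_mul (hq : ‖q‖ < 1) (hq0 : q ≠ 0) {x : ℂ} (hx : x ≠ 0) :
    theta x q * qPoch (q ^ 2) (q ^ 2) ^ 2 =
      theta x (q ^ 2) * theta (q * x) (q ^ 2) * qPoch q q := by
  rw [theta, theta, theta, qPoch_split hq x, qPoch_split hq (q / x),
    show q * (q / x) = q ^ 2 / x by ring, show q ^ 2 / (q * x) = q / x by field_simp]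
  ring

theorem theta_self_sq_mul (hq : ‖q‖ < 1) (hq0 : q ≠ 0) :
    theta q (q ^ 2) * qPoch (q ^ 2) (q ^ 2) = qPoch q q ^ 2 := by
  rw [theta, qPoch_split hq q, show q ^ 2 / q = q by field_simp, show q * q = q ^ 2 by ring]
  ring

end Theta

/-! ### Removable singularities on the punctured plane. -/

section Removable

/-- `f` agrees on a punctured neighbourhood of `p` with a function analytic at `p`. -/
def Removable (f : ℂ → ℂ) (p : ℂ) : Prop := ∃ g, AnalyticAt ℂ g p ∧ f =ᶠ[𝓝[≠] p] g

variable {f g : ℂ → ℂ} {p : ℂ}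

theorem _root_.AnalyticAt.removable (h : AnalyticAt ℂ f p) : Removable f p :=
  ⟨f, h, EventuallyEq.rfl⟩

theorem Removable.congr (h : Removable f p) (hfg : g =ᶠ[𝓝[≠] p] f) : Removable g p :=
  let ⟨k, hk, hfk⟩ := h; ⟨k, hk, hfg.trans hfk⟩

theorem Removable.add (hf : Removable f p) (hg : Removable g p) :
    Removable (fun x => f x + g x) p :=
  let ⟨k, hk, hfk⟩ := hf
  let ⟨l, hl, hgl⟩ := hg
  ⟨fun x => k x + l x, hk.add hl, hfk.add hgl⟩

theorem Removable.sub (hf : Removable f p) (hg : Removable g p) :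
    Removable (fun x => f x - g x) p :=
  let ⟨k, hk, hfk⟩ := hf
  let ⟨l, hl, hgl⟩ := hg
  ⟨fun x => k x - l x, hk.sub hl, hfk.sub hgl⟩

theorem Removable.mul (hf : Removable f p) (hg : Removable g p) :
    Removable (fun x => f x * g x) p :=
  let ⟨k, hk, hfk⟩ := hf
  let ⟨l, hl, hgl⟩ := hg
  ⟨fun x => k x * l x, hk.mul hl, hfk.mul hgl⟩

theorem removable_div_sub (hf : AnalyticAt ℂ f p) (h0 : f p = 0) :
    Removable (fun x => f x / (x - p)) p := by
  obtain ⟨P, hP⟩ := hf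
  refine ⟨dslope f p, hP.has_fpower_series_dslope_fslope.analyticAt, ?_⟩
  filter_upwards [self_mem_nhdsWithin] with x hx
  rw [dslope_of_ne _ hx, slope_def_field, h0, sub_zero]

/-- The punctured limit of `f` is used as the value at every point. It agrees with each local
analytic extension on a full neighbourhood, so a single function serves for all `p`. -/
theorem exists_analytic_extension (h : ∀ p ≠ 0, Removable f p) :
    ∃ g : ℂ → ℂ, (∀ p ≠ 0, AnalyticAt ℂ g p) ∧ ∀ p ≠ 0, f =ᶠ[𝓝[≠] p] g := by
  have key : ∀ p ≠ 0, ∃ g, AnalyticAt ℂ g p ∧ f =ᶠ[𝓝[≠] p] g ∧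
      (fun x => limUnder (𝓝[≠] x) f) =ᶠ[𝓝 p] g := by
    intro p hp
    obtain ⟨g, hg, hfg⟩ := h p hp
    refine ⟨g, hg, hfg, ?_⟩
    have h1 := (eventually_nhdsWithin_iff.1 hfg).eventually_nhds
    filter_upwards [h1, hg.eventually_analyticAt] with x hx hgx
    refine Tendsto.limUnder_eq ?_
    have h2 : g =ᶠ[𝓝[≠] x] f := by
      rcases eq_or_ne x p with rfl | hxp
      · exact hfg.symm
      · have h3 : ∀ᶠ y in 𝓝 x, y ≠ p := isOpen_ne.mem_nhds hxp
        refine Filter.Eventually.filter_mono nhdsWithin_le_nhds ?_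
        filter_upwards [h3, hx] with y hy hy2 using (hy2 hy).symm
    exact (hgx.continuousAt.tendsto.mono_left nhdsWithin_le_nhds).congr' h2
  refine ⟨fun x => limUnder (𝓝[≠] x) f, fun p hp => ?_, fun p hp => ?_⟩
  · obtain ⟨g, hg, -, h3⟩ := key p hp
    exact hg.congr h3.symm
  · obtain ⟨g, -, h2, h3⟩ := key p hp
    exact h2.trans (h3.filter_mono nhdsWithin_le_nhds).symm

theorem tendsto_mul_nhdsNE {Q : ℂ} (hQ : Q ≠ 0) (p : ℂ) :
    Tendsto (fun x => Q * x) (𝓝[≠] p) (𝓝[≠] (Q * p)) := by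
  refine tendsto_nhdsWithin_iff.2 ⟨?_, ?_⟩
  · exact ((continuous_const_mul Q).tendsto p).mono_left nhdsWithin_le_nhds
  · filter_upwards [self_mem_nhdsWithin] with x hx
    simpa [hQ] using hx

theorem removable_mul_iff {Q : ℂ} (hQ : Q ≠ 0) {μ : ℂ → ℂ} (hμ : AnalyticAt ℂ μ p) (hμ0 : μ p ≠ 0)
    (hfe : ∀ᶠ x in 𝓝[≠] p, f (Q * x) = μ x * f x) : Removable f (Q * p) ↔ Removable f p := by
  constructor
  · rintro ⟨g, hg, hfg⟩
    refine ⟨fun x => g (Q * x) / μ x, ?_, ?_⟩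
    · exact (AnalyticAt.fun_comp (g := g) (f := fun x => Q * x) hg
        (analyticAt_const.mul analyticAt_id)).div hμ hμ0
    · filter_upwards [(tendsto_mul_nhdsNE hQ p).eventually hfg, hfe,
        (hμ.continuousAt.eventually_ne hμ0).filter_mono nhdsWithin_le_nhds] with x h1 h2 h3
      rw [← h1, h2]; field_simp
  · rintro ⟨g, hg, hfg⟩
    have hp : Q⁻¹ * (Q * p) = p := by field_simp
    have ht : Tendsto (fun x => Q⁻¹ * x) (𝓝[≠] (Q * p)) (𝓝[≠] p) := by
      simpa only [hp] using tendsto_mul_nhdsNE (inv_ne_zero hQ) (Q * p)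
    refine ⟨fun x => μ (Q⁻¹ * x) * g (Q⁻¹ * x), ?_, ?_⟩
    · rw [← hp] at hg hμ
      exact (AnalyticAt.fun_comp (g := μ) (f := fun x => Q⁻¹ * x) hμ
        (analyticAt_const.mul analyticAt_id)).mul
        (AnalyticAt.fun_comp (g := g) (f := fun x => Q⁻¹ * x) hg
        (analyticAt_const.mul analyticAt_id))
    · filter_upwards [ht.eventually hfg, ht.eventually hfe] with x h1 h2
      rw [← h1, ← h2, mul_inv_cancel_left₀ hQ]

/-- A functional equation with nonvanishing analytic multiplier transports removability along the
orbit of `p`, so each orbit of candidate poles needs to be examined at one point only. -/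
theorem removable_zpow_mul_iff {Q : ℂ} (hQ : Q ≠ 0) {μ : ℂ → ℂ}
    (hμ : ∀ p ≠ 0, AnalyticAt ℂ μ p) (hμ0 : ∀ p ≠ 0, μ p ≠ 0)
    (hfe : ∀ p ≠ 0, ∀ᶠ x in 𝓝[≠] p, f (Q * x) = μ x * f x) (hp : p ≠ 0) (n : ℤ) :
    Removable f (Q ^ n * p) ↔ Removable f p := by
  have step (n : ℤ) : Removable f (Q ^ (n + 1) * p) ↔ Removable f (Q ^ n * p) := by
    have hne : Q ^ n * p ≠ 0 := mul_ne_zero (zpow_ne_zero _ hQ) hp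
    rw [zpow_add_one₀ hQ, show Q ^ n * Q * p = Q * (Q ^ n * p) by ring]
    exact removable_mul_iff hQ (hμ _ hne) (hμ0 _ hne) (hfe _ hne)
  induction n using Int.induction_on with
  | zero => simp
  | succ n ih => exact (step n).trans ih
  | pred n ih => exact (by simpa using step (-n - 1) : _ ↔ _).symm.trans ih

end Removable

/-! ### Rigidity of quasi-periodic analytic functions. -/

section Quasiperiodic

variable {Q : ℂ} {g μ : ℂ → ℂ}

/-- A bound on one closed annulus of radius ratio `‖Q‖` propagates inward, since each step `x ↦ Qx`
multiplies by `μ` of norm at most `1`. Riemann's theorem on bounded functions then removes the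
singularity. -/
theorem exists_extension_at_zero (hQ0 : Q ≠ 0) (hQ : ‖Q‖ < 1) (hg : ∀ x ≠ 0, AnalyticAt ℂ g x)
    (hμ : ∀ᶠ x in 𝓝 0, ‖μ x‖ ≤ 1) (hfe : ∀ x ≠ 0, g (Q * x) = μ x * g x) :
    ∃ G, AnalyticAt ℂ G 0 ∧ ∀ x ≠ 0, G x = g x := by
  obtain ⟨r, hr, hμr⟩ := Metric.eventually_nhds_iff.1 hμ
  -- Every small nonzero point is brought into this annulus by repeated division by `Q`; the radius
  -- `r / 2` keeps all points met on the way inside the disc where `‖μ‖ ≤ 1`.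
  set K : Set ℂ := Metric.closedBall 0 (r / 2) \ Metric.ball 0 (‖Q‖ * (r / 2)) with hK
  have hKc : IsCompact K := (isCompact_closedBall _ _).diff Metric.isOpen_ball
  have hQn : 0 < ‖Q‖ := norm_pos_iff.2 hQ0
  have hcont : ContinuousOn g K := fun x hx => by
    refine (hg x ?_).continuousAt.continuousWithinAt
    rintro rfl
    exact hx.2 (Metric.mem_ball_self (by positivity))
  obtain ⟨M, hM⟩ := hKc.exists_bound_of_continuousOn hcont
  have hbound : ∀ x ∈ Metric.ball (0 : ℂ) (r / 2) \ {0}, ‖g x‖ ≤ M := by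
    have key : ∀ n : ℕ, ∀ x : ℂ, ‖x‖ ≤ r / 2 → ‖Q‖ ^ n * (r / 2) ≤ ‖x‖ → x ≠ 0 → ‖g x‖ ≤ M := by
      intro n
      induction n with
      | zero =>
        intro x hx hx2 _
        refine hM x ⟨by simpa using hx, ?_⟩
        simp only [Metric.mem_ball, dist_zero_right, not_lt]
        rw [pow_zero, one_mul] at hx2
        nlinarith
      | succ n ih =>
        intro x hx hx2 hx0
        by_cases hxK : x ∈ K
        · exact hM x hxK
        · have hlt : ‖x‖ < ‖Q‖ * (r / 2) := by
            by_contra hcon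
            exact hxK ⟨by simpa using hx, by simpa using hcon⟩
          have hx' : ‖Q⁻¹ * x‖ ≤ r / 2 := by
            rw [norm_mul, norm_inv, inv_mul_le_iff₀ hQn]; exact hlt.le
          have h1 := ih (Q⁻¹ * x) hx' (by
            rw [norm_mul, norm_inv, le_inv_mul_iff₀ hQn]
            calc _ = ‖Q‖ ^ (n + 1) * (r / 2) := by ring
              _ ≤ _ := hx2) (mul_ne_zero (inv_ne_zero hQ0) hx0)
          have h2 := hfe (Q⁻¹ * x) (mul_ne_zero (inv_ne_zero hQ0) hx0)
          rw [mul_inv_cancel_left₀ hQ0] at h2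
          rw [h2, norm_mul]
          have h3 : ‖μ (Q⁻¹ * x)‖ ≤ 1 := hμr (by
            rw [dist_zero_right]; linarith)
          nlinarith [norm_nonneg (g (Q⁻¹ * x)), norm_nonneg (μ (Q⁻¹ * x))]
    intro x hx
    have hx0 : x ≠ 0 := hx.2
    have hxr : ‖x‖ < r / 2 := by simpa using hx.1
    obtain ⟨n, hn⟩ := exists_pow_lt_of_lt_one (show 0 < ‖x‖ / (r / 2) by positivity) hQ
    refine key n x hxr.le ?_ hx0
    rw [lt_div_iff₀ (by positivity)] at hn
    exact hn.le
  have hnhds : Metric.ball (0 : ℂ) (r / 2) ∈ 𝓝 0 := Metric.ball_mem_nhds _ (by positivity)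
  have hdiff := Complex.differentiableOn_update_limUnder_of_bddAbove (f := g) hnhds
    (fun x hx => (hg x hx.2).differentiableAt.differentiableWithinAt)
    ⟨M, by rintro _ ⟨x, hx, rfl⟩; exact hbound x hx⟩
  exact ⟨_, hdiff.analyticAt hnhds, fun x hx => Function.update_of_ne hx _ _⟩

/-- If the extension to `0` vanished there to finite order `k`, comparing leading coefficients in
the functional equation would give `Q^k = μ(0)`. Otherwise it vanishes near `0`, and the identity
theorem on the connected punctured plane applies. -/
theorem eq_zero_of_quasiperiodic (hQ0 : Q ≠ 0) (hQ : ‖Q‖ < 1) (hg : ∀ x ≠ 0, AnalyticAt ℂ g x)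
    (hμ : ContinuousAt μ 0) (hμ1 : ‖μ 0‖ < 1) (hμk : ∀ k : ℕ, μ 0 ≠ Q ^ k)
    (hfe : ∀ x ≠ 0, g (Q * x) = μ x * g x) : ∀ x ≠ 0, g x = 0 := by
  obtain ⟨G, hG, hGg⟩ := exists_extension_at_zero hQ0 hQ hg
    (hμ.norm.eventually_le_const hμ1 ) hfe
  have hpre : IsPreconnected ({0}ᶜ : Set ℂ) :=
    (isConnected_compl_singleton_of_one_lt_rank (by simp) 0).isPreconnected
  rcases hG.eventually_eq_zero_or_eventually_ne_zero with h0 | h0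
  · obtain ⟨r, hr, h0⟩ := Metric.eventually_nhds_iff.1 h0
    have hr2 : ((r / 2 : ℝ) : ℂ) ≠ 0 := by
      exact_mod_cast (by positivity : r / 2 ≠ 0)
    have hz : ∀ᶠ x in 𝓝 ((r / 2 : ℝ) : ℂ), g x = 0 := by
      have h1 : ∀ᶠ x in 𝓝 ((r / 2 : ℝ) : ℂ), dist x 0 < r := by
        refine (Metric.isOpen_ball (x := (0 : ℂ)) (ε := r)).mem_nhds ?_
        simp only [Metric.mem_ball, dist_zero_right, Complex.norm_real, Real.norm_eq_abs]
        rw [abs_of_pos (by positivity)]; linarith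
      filter_upwards [h1, isOpen_ne.mem_nhds hr2] with x hx hx0
      rw [← hGg x hx0]; exact h0 hx
    have han : AnalyticOnNhd ℂ g {0}ᶜ := fun x hx => hg x hx
    exact fun x hx => han.eqOn_zero_of_preconnected_of_eventuallyEq_zero hpre hr2 hz hx
  · exfalso
    obtain ⟨k, H, hH, hH0, hGH⟩ := (hG.exists_eventuallyEq_pow_smul_nonzero_iff).2 (by
      intro hcon
      exact (((hcon.filter_mono nhdsWithin_le_nhds).and h0).exists).elim fun x hx => hx.2 hx.1)
    have ht : Tendsto (fun x => Q * x) (𝓝[≠] 0) (𝓝[≠] 0) := by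
      simpa using tendsto_mul_nhdsNE hQ0 0
    -- With `G(x) = x^k H(x)` and `H(0) ≠ 0`, the factor `x^k` cancels from the functional equation;
    -- letting `x → 0` then compares `Q^k` with `μ(0)`.
    have hev : ∀ᶠ x in 𝓝[≠] (0 : ℂ), Q ^ k * H (Q * x) = μ x * H x := by
      have h1 := hGH.filter_mono (nhdsWithin_le_nhds (s := {0}ᶜ))
      filter_upwards [h1, ht.eventually h1, self_mem_nhdsWithin] with x hx hQx hx0
      have hx0 : x ≠ 0 := hx0
      have h2 := hfe x hx0
      rw [← hGg x hx0, ← hGg _ (mul_ne_zero hQ0 hx0), hx, hQx] at h2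
      simp only [sub_zero, smul_eq_mul, mul_pow] at h2
      have hxk : x ^ k ≠ 0 := pow_ne_zero _ hx0
      apply mul_left_cancel₀ hxk
      linear_combination h2
    have hL : Tendsto (fun x => Q ^ k * H (Q * x)) (𝓝[≠] 0) (𝓝 (Q ^ k * H 0)) :=
      ((hH.continuousAt.tendsto.mono_left nhdsWithin_le_nhds).comp ht).const_mul _
    have hR : Tendsto (fun x => μ x * H x) (𝓝[≠] 0) (𝓝 (μ 0 * H 0)) :=
      (hμ.tendsto.mono_left nhdsWithin_le_nhds).mul
        (hH.continuousAt.tendsto.mono_left nhdsWithin_le_nhds)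
    have := tendsto_nhds_unique hL (hR.congr' (hev.mono fun x hx => hx.symm))
    exact hμk k (mul_right_cancel₀ hH0 this).symm

theorem exists_quasiperiodic_extension {f : ℂ → ℂ} (hQ0 : Q ≠ 0)
    (hf : ∀ p ≠ 0, Removable f p) (hμ : Continuous μ)
    (hfe : ∀ p ≠ 0, ∀ᶠ x in 𝓝[≠] p, f (Q * x) = μ x * f x) :
    ∃ g : ℂ → ℂ, (∀ p ≠ 0, AnalyticAt ℂ g p) ∧ (∀ p ≠ 0, f =ᶠ[𝓝[≠] p] g) ∧
      ∀ x ≠ 0, g (Q * x) = μ x * g x := by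
  obtain ⟨g, hg, hfg⟩ := exists_analytic_extension hf
  refine ⟨g, hg, hfg, fun p hp => ?_⟩
  have hQp := mul_ne_zero hQ0 hp
  -- The functional equation of `f` is known only near, not at, each point; continuity of the
  -- extension makes it hold everywhere.
  have hev : ∀ᶠ x in 𝓝[≠] p, g (Q * x) = μ x * g x := by
    filter_upwards [hfe p hp, hfg p hp, (tendsto_mul_nhdsNE hQ0 p).eventually (hfg _ hQp)]
      with x h1 h2 h3
    rw [← h2, ← h3, h1]
  have hL : Tendsto (fun x => g (Q * x)) (𝓝[≠] p) (𝓝 (g (Q * p))) :=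
    ((hg _ hQp).continuousAt.tendsto.mono_left nhdsWithin_le_nhds).comp (tendsto_mul_nhdsNE hQ0 p)
  have hR : Tendsto (fun x => μ x * g x) (𝓝[≠] p) (𝓝 (μ p * g p)) :=
    ((hμ.tendsto p).mul (hg p hp).continuousAt.tendsto).mono_left nhdsWithin_le_nhds
  exact tendsto_nhds_unique hL (hR.congr' (hev.mono fun x hx => hx.symm))

theorem eventually_eq_zero_of_quasiperiodic {f : ℂ → ℂ} (hQ0 : Q ≠ 0) (hQ : ‖Q‖ < 1)
    (hf : ∀ p ≠ 0, Removable f p) (hμ : Continuous μ) (hμ1 : ‖μ 0‖ < 1)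
    (hμk : ∀ k : ℕ, μ 0 ≠ Q ^ k) (hfe : ∀ p ≠ 0, ∀ᶠ x in 𝓝[≠] p, f (Q * x) = μ x * f x) :
    ∀ p ≠ 0, ∀ᶠ x in 𝓝[≠] p, f x = 0 := by
  obtain ⟨g, hg, hfg, hgfe⟩ := exists_quasiperiodic_extension hQ0 hf hμ hfe
  have h0 := eq_zero_of_quasiperiodic hQ0 hQ hg hμ.continuousAt hμ1 hμk hgfe
  intro p hp
  filter_upwards [hfg p hp, mem_nhdsWithin_of_mem_nhds (isOpen_ne.mem_nhds hp : {0}ᶜ ∈ 𝓝 p)]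
    with x hx hx0
  rw [hx, h0 x hx0]

theorem eventually_eq_zero_of_multiplier {f : ℂ → ℂ} (hQ0 : Q ≠ 0) (hQ : ‖Q‖ < 1) {c : ℂ}
    (hc : ∀ n : ℤ, Q ^ n * c ≠ 1)
    (hf : ∀ p ≠ 0, Removable f p) (hfe : ∀ p ≠ 0, ∀ᶠ x in 𝓝[≠] p, f (Q * x) = c * f x) :
    ∀ p ≠ 0, ∀ᶠ x in 𝓝[≠] p, f x = 0 := by
  obtain ⟨n, hn⟩ : ∃ n : ℕ, ‖Q ^ n * c‖ < 1 := by
    obtain ⟨n, hn⟩ := exists_pow_lt_of_lt_one (show 0 < 1 / (‖c‖ + 1) by positivity) hQ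
    refine ⟨n, ?_⟩
    rw [lt_div_iff₀ (by positivity)] at hn
    rw [norm_mul, norm_pow]
    have : 0 ≤ ‖Q‖ ^ n := by positivity
    nlinarith
  -- The factor `x^n` changes the multiplier from `c` to `Q^n c`, which has norm below `1` and is
  -- still not a power of `Q`.
  have h := eventually_eq_zero_of_quasiperiodic (f := fun x => x ^ n * f x)
    (μ := fun _ => Q ^ n * c) hQ0 hQ
    (fun p hp => (analyticAt_id.pow n).removable.mul (hf p hp)) continuous_const hn
    (fun k hk => hc (n - k) (by
      rw [zpow_sub₀ hQ0, zpow_natCast, zpow_natCast, div_mul_eq_mul_div, hk]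
      exact div_self (pow_ne_zero _ hQ0)))
    (fun p hp => (hfe p hp).mono fun x hx => by rw [hx]; ring)
  intro p hp
  filter_upwards [h p hp, mem_nhdsWithin_of_mem_nhds (isOpen_ne.mem_nhds hp : {0}ᶜ ∈ 𝓝 p)]
    with x hx hx0
  exact (mul_eq_zero.1 hx).resolve_left (pow_ne_zero _ hx0)

theorem eq_zero_of_eventually_eq_zero {f : ℂ → ℂ} {p : ℂ} (hf : ContinuousAt f p)
    (h : ∀ᶠ x in 𝓝[≠] p, f x = 0) : f p = 0 :=
  tendsto_nhds_unique ((hf.tendsto.mono_left nhdsWithin_le_nhds).congr' h) tendsto_const_nhds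

/-- An analytic function on the punctured plane invariant under `x ↦ Q x` is constant. -/
theorem eq_of_periodic (hQ0 : Q ≠ 0) (hQ : ‖Q‖ < 1) (hg : ∀ x ≠ 0, AnalyticAt ℂ g x)
    (hfe : ∀ x ≠ 0, g (Q * x) = g x) {x y : ℂ} (hx : x ≠ 0) (hy : y ≠ 0) : g x = g y := by
  obtain ⟨G, hG, hGg⟩ := exists_extension_at_zero (μ := fun _ => 1) hQ0 hQ hg (by simp)
    (by simpa using hfe)
  have key : ∀ x ≠ 0, g x = G 0 := by
    -- The value at `x` is repeated at `Q^n x → 0`, so it equals the value of the extension at `0`.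
    intro x hx
    have h1 : ∀ n : ℕ, G (Q ^ n * x) = g x := by
      intro n
      rw [hGg _ (mul_ne_zero (pow_ne_zero _ hQ0) hx)]
      induction n with
      | zero => simp
      | succ n ih => rw [pow_succ', mul_assoc, hfe _ (mul_ne_zero (pow_ne_zero _ hQ0) hx), ih]
    have h2 : Tendsto (fun n : ℕ => Q ^ n * x) atTop (𝓝 0) := by
      simpa using (tendsto_pow_atTop_nhds_zero_of_norm_lt_one hQ).mul_const x
    have h3 := hG.continuousAt.tendsto.comp h2
    exact tendsto_nhds_unique ((tendsto_const_nhds (x := g x)).congr fun n => (h1 n).symm) h3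
  rw [key x hx, key y hy]

end Quasiperiodic

/-! ### Uniform bounds for the denominators `1 - Qⁿx`. -/

section Denominators

variable {Q : ℂ}

/-- For large `n` the number `Q^n x` has norm at most `1/2`, for very negative `n` at least `2`; the
finitely many exponents in between are handled by continuity. -/
theorem exists_sub_lower_bound (hQ0 : Q ≠ 0) (hQ : ‖Q‖ < 1) {x₀ : ℂ} (hx₀ : x₀ ≠ 0) :
    ∃ δ > 0, ∀ᶠ x in 𝓝 x₀, ∀ n : ℤ, Q ^ n * x₀ ≠ 1 → δ ≤ ‖1 - Q ^ n * x‖ := by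
  have hρ : 0 < ‖x₀‖ := norm_pos_iff.2 hx₀
  have hQn : 0 < ‖Q‖ := norm_pos_iff.2 hQ0
  obtain ⟨N₁, hN₁⟩ := exists_pow_lt_of_lt_one (show 0 < 1 / (4 * ‖x₀‖) by positivity) hQ
  obtain ⟨N₂, hN₂⟩ := exists_pow_lt_of_lt_one (show 0 < ‖x₀‖ / 4 by positivity) hQ
  rw [lt_div_iff₀ (by positivity)] at hN₁ hN₂
  have hfin : ∀ T : Set ℤ, T.Finite →
      ∃ δ > 0, ∀ᶠ x in 𝓝 x₀, ∀ n ∈ T, Q ^ n * x₀ ≠ 1 → δ ≤ ‖1 - Q ^ n * x‖ := by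
    intro T hT
    induction T, hT using Set.Finite.induction_on with
    | empty => exact ⟨1, one_pos, by simp⟩
    | @insert m T _ _ ih =>
      obtain ⟨δ, hδ, h⟩ := ih
      by_cases hm : Q ^ m * x₀ = 1
      · refine ⟨δ, hδ, h.mono fun x hx n hn hne => ?_⟩
        rcases Set.mem_insert_iff.1 hn with rfl | hn
        · exact absurd hm hne
        · exact hx n hn hne
      · have hpos : 0 < ‖1 - Q ^ m * x₀‖ := norm_pos_iff.2 (sub_ne_zero.2 (Ne.symm hm))
        have hc : ContinuousAt (fun x => ‖1 - Q ^ m * x‖) x₀ := by fun_prop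
        refine ⟨min δ (‖1 - Q ^ m * x₀‖ / 2), by positivity, ?_⟩
        filter_upwards [h, hc.eventually_const_le (show ‖1 - Q ^ m * x₀‖ / 2 < _ by linarith)]
          with x hx hxm n hn hne
        rcases Set.mem_insert_iff.1 hn with rfl | hn
        · exact (min_le_right _ _).trans hxm
        · exact (min_le_left _ _).trans (hx n hn hne)
  obtain ⟨δ, hδ, h⟩ := hfin (Set.Ioo (-N₂ : ℤ) N₁) (Set.finite_Ioo _ _)
  have hc : ContinuousAt (fun x : ℂ => ‖x‖) x₀ := by fun_prop
  refine ⟨min δ (1 / 2), by positivity, ?_⟩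
  filter_upwards [h, hc.eventually_const_lt (show ‖x₀‖ / 2 < ‖x₀‖ by linarith),
    hc.eventually_lt_const (show ‖x₀‖ < 2 * ‖x₀‖ by linarith)] with x hx hx1 hx2 n hne
  rcases le_or_gt (N₁ : ℤ) n with hn | hn
  · have h1 : ‖Q‖ ^ n ≤ ‖Q‖ ^ N₁ := by
      rw [← zpow_natCast]; exact zpow_le_zpow_right_of_le_one₀ hQn hQ.le hn
    have h2 : ‖Q ^ n * x‖ ≤ 1 / 2 := by
      rw [norm_mul, norm_zpow]
      have : 0 < ‖Q‖ ^ n := by positivity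
      nlinarith
    have h3 := norm_sub_norm_le 1 (Q ^ n * x)
    rw [norm_one] at h3
    exact (min_le_right _ _).trans (by linarith)
  · rcases le_or_gt n (-N₂ : ℤ) with hn' | hn'
    · have h1 : ‖Q‖ ^ (-n) ≤ ‖Q‖ ^ N₂ := by
        rw [← zpow_natCast]; exact zpow_le_zpow_right_of_le_one₀ hQn hQ.le (by omega)
      have h0 : 0 < ‖Q‖ ^ n := by positivity
      have h2 : 2 ≤ ‖Q ^ n * x‖ := by
        rw [norm_mul, norm_zpow]
        have h3 : ‖Q‖ ^ n * ‖Q‖ ^ (-n) = 1 := by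
          rw [← zpow_add₀ hQn.ne']; simp
        nlinarith
      have h3 := norm_sub_norm_le (Q ^ n * x) 1
      rw [norm_one, norm_sub_rev] at h3
      exact (min_le_right _ _).trans (by linarith)
    · exact (min_le_left _ _).trans (hx n ⟨hn', hn⟩ hne)

/-- The decay `‖Q‖^(-n)` for negative `n` comes from `u/(1-u) = 1/(1-u) - 1` with `u = Q^n x`: the
right side is bounded, so `1/(1-u)` is `O(1/‖u‖)`. Exponents with a pole at `x₀` itself are left
out, so that the estimate can also be used near a pole. -/
theorem exists_inv_bound (hQ0 : Q ≠ 0) (hQ : ‖Q‖ < 1) {x₀ : ℂ} (hx₀ : x₀ ≠ 0) :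
    ∃ C, 0 < C ∧ ∀ᶠ x in 𝓝 x₀, ∀ n : ℤ, Q ^ n * x₀ ≠ 1 →
      1 - Q ^ n * x ≠ 0 ∧ ‖(1 - Q ^ n * x)⁻¹‖ ≤ C * min 1 (‖Q‖ ^ (-n)) := by
  obtain ⟨δ, hδ, h⟩ := exists_sub_lower_bound hQ0 hQ hx₀
  have hρ : 0 < ‖x₀‖ := norm_pos_iff.2 hx₀
  have hQn : 0 < ‖Q‖ := norm_pos_iff.2 hQ0
  have hc : ContinuousAt (fun x : ℂ => ‖x‖) x₀ := by fun_prop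
  refine ⟨max δ⁻¹ ((1 + δ⁻¹) * (2 / ‖x₀‖)), by positivity, ?_⟩
  filter_upwards [h, hc.eventually_const_lt (show ‖x₀‖ / 2 < ‖x₀‖ by linarith)] with x hx hx1 n hn
  have hδn := hx n hn
  have hne : 1 - Q ^ n * x ≠ 0 := norm_pos_iff.1 (hδ.trans_le hδn)
  refine ⟨hne, ?_⟩
  have h1 : ‖(1 - Q ^ n * x)⁻¹‖ ≤ δ⁻¹ := by
    rw [norm_inv]; exact inv_anti₀ hδ hδn
  have hxpos : 0 < ‖x‖ := by linarith
  have hQp : 0 < ‖Q‖ ^ n := by positivity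
  have h2 : ‖(1 - Q ^ n * x)⁻¹‖ ≤ (1 + δ⁻¹) * (2 / ‖x₀‖) * ‖Q‖ ^ (-n) := by
    have h3 : ‖Q ^ n * x‖ * ‖(1 - Q ^ n * x)⁻¹‖ ≤ 1 + δ⁻¹ := by
      rw [← norm_mul, show Q ^ n * x * (1 - Q ^ n * x)⁻¹ = (1 - Q ^ n * x)⁻¹ - 1 by
        field_simp; ring]
      refine (norm_sub_le _ _).trans ?_
      rw [norm_one]; linarith
    rw [norm_mul, norm_zpow] at h3
    rw [zpow_neg]
    have h4 : ‖Q‖ ^ n * (‖x₀‖ / 2) * ‖(1 - Q ^ n * x)⁻¹‖ ≤ 1 + δ⁻¹ := by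
      refine le_trans ?_ h3
      gcongr
    calc ‖(1 - Q ^ n * x)⁻¹‖
        = (‖Q‖ ^ n * (‖x₀‖ / 2) * ‖(1 - Q ^ n * x)⁻¹‖) * (2 / ‖x₀‖) * (‖Q‖ ^ n)⁻¹ := by
          field_simp
      _ ≤ _ := by gcongr
  rw [mul_min_of_nonneg _ _ (by positivity), mul_one]
  refine le_min (h1.trans (le_max_left _ _)) (h2.trans ?_)
  gcongr
  exact le_max_right _ _

theorem eventually_zpow_mul_ne_one (hQ0 : Q ≠ 0) (hQ : ‖Q‖ < 1) {x₀ : ℂ} (hx₀ : x₀ ≠ 0) :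
    ∀ᶠ x in 𝓝[≠] x₀, ∀ n : ℤ, Q ^ n * x ≠ 1 := by
  obtain ⟨C, -, h⟩ := exists_inv_bound hQ0 hQ hx₀
  filter_upwards [h.filter_mono nhdsWithin_le_nhds, self_mem_nhdsWithin] with x hx hne n hn
  by_cases h0 : Q ^ n * x₀ = 1
  · exact hne (mul_left_cancel₀ (zpow_ne_zero n hQ0) (hn.trans h0.symm))
  · exact (hx n h0).1 (by rw [hn, sub_self])

theorem eventually_zpow_mul_ne_one_of_ne (hQ0 : Q ≠ 0) (hQ : ‖Q‖ < 1) {x₀ : ℂ} (hx₀ : x₀ ≠ 0)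
    (h : ∀ n : ℤ, Q ^ n * x₀ ≠ 1) : ∀ᶠ x in 𝓝 x₀, ∀ n : ℤ, Q ^ n * x ≠ 1 := by
  obtain ⟨C, -, hC⟩ := exists_inv_bound hQ0 hQ hx₀
  filter_upwards [hC] with x hx n hn
  exact (hx n (h n)).1 (by rw [hn, sub_self])

end Denominators

/-! ### Partial fraction series and their poles. -/

section PartialFractions

variable {Q : ℂ} {a : ℤ → ℂ}

/-- The partial fraction series `∑ a_n / (1 - Q^n x)`. -/
def fracSum (a : ℤ → ℂ) (Q x : ℂ) : ℂ := ∑' n : ℤ, a n / (1 - Q ^ n * x)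

theorem norm_frac_le {x C : ℂ} {B d : ℝ} (h : C ≠ 0 → ‖x⁻¹‖ ≤ B * d) :
    ‖C / x‖ ≤ B * (‖C‖ * d) := by
  by_cases hC : C = 0
  · simp [hC]
  · rw [div_eq_mul_inv, norm_mul]
    calc _ ≤ ‖C‖ * (B * d) := by gcongr; exact h hC
      _ = _ := by ring

theorem summable_frac (hQ0 : Q ≠ 0) (hQ : ‖Q‖ < 1)
    (ha : Summable fun n : ℤ => ‖a n‖ * min 1 (‖Q‖ ^ (-n))) {x : ℂ} (hx : x ≠ 0)
    (h : ∀ n, a n ≠ 0 → Q ^ n * x ≠ 1) : Summable fun n : ℤ => a n / (1 - Q ^ n * x) := by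
  obtain ⟨C, -, hC⟩ := exists_inv_bound hQ0 hQ hx
  exact (ha.mul_left C).of_norm_bounded fun n =>
    norm_frac_le fun hn => (hC.self_of_nhds n (h n hn)).2

/-- Poles are excluded only where the coefficient is nonzero. Setting one coefficient to `0`
therefore yields the regular part of the series at the corresponding pole. -/
theorem analyticAt_fracSum (hQ0 : Q ≠ 0) (hQ : ‖Q‖ < 1)
    (ha : Summable fun n : ℤ => ‖a n‖ * min 1 (‖Q‖ ^ (-n))) {x : ℂ} (hx : x ≠ 0)
    (h : ∀ n, a n ≠ 0 → Q ^ n * x ≠ 1) : AnalyticAt ℂ (fracSum a Q) x := by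
  obtain ⟨C, -, hC⟩ := exists_inv_bound hQ0 hQ hx
  obtain ⟨U, hU, hUo, hxU⟩ := eventually_nhds_iff.1 hC
  refine DifferentiableOn.analyticAt (s := U) ?_ (hUo.mem_nhds hxU)
  refine Complex.differentiableOn_tsum_of_summable_norm (ha.mul_left C) (fun n => ?_) hUo
    fun n w hw => norm_frac_le fun hn => (hU w hw n (h n hn)).2
  by_cases hn : a n = 0
  · simp only [hn, zero_div]; exact differentiableOn_const _
  · exact DifferentiableOn.div (by fun_prop) (by fun_prop) fun w hw => (hU w hw n (h n hn)).1

/-- Near `x = 1` the series is `a_0 / (1 - x)` plus an analytic function. -/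
theorem fracSum_near_one (hQ0 : Q ≠ 0) (hQ : ‖Q‖ < 1)
    (ha : Summable fun n : ℤ => ‖a n‖ * min 1 (‖Q‖ ^ (-n))) :
    ∃ g, AnalyticAt ℂ g 1 ∧ ∀ᶠ x in 𝓝[≠] 1, fracSum a Q x = a 0 / (1 - x) + g x := by
  have hne : ∀ n : ℤ, n ≠ 0 → Q ^ n ≠ 1 := by
    intro n hn h
    have h1 : ‖Q‖ ^ n = 1 := by rw [← norm_zpow, h, norm_one]
    rw [zpow_eq_one_iff_right₀ (norm_nonneg _) hQ.ne] at h1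
    exact hn h1
  have ha' : Summable fun n : ℤ => ‖Function.update a 0 0 n‖ * min 1 (‖Q‖ ^ (-n)) := by
    have hQn : 0 < ‖Q‖ := norm_pos_iff.2 hQ0
    refine ha.of_nonneg_of_le (fun n => by positivity) fun n => ?_
    gcongr
    rcases eq_or_ne n 0 with rfl | hn
    · simp
    · rw [Function.update_of_ne hn]
  refine ⟨fracSum (Function.update a 0 0) Q, analyticAt_fracSum hQ0 hQ ha' one_ne_zero ?_, ?_⟩
  · intro n hn
    rcases eq_or_ne n 0 with rfl | hn0
    · simp at hn
    · simpa using hne n hn0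
  · filter_upwards [eventually_zpow_mul_ne_one hQ0 hQ one_ne_zero,
      mem_nhdsWithin_of_mem_nhds (isOpen_ne.mem_nhds one_ne_zero : {0}ᶜ ∈ 𝓝 (1 : ℂ))] with x hx hx0
    rw [fracSum, (summable_frac hQ0 hQ ha hx0 fun n _ => hx n).tsum_eq_add_tsum_ite 0, fracSum]
    simp only [zpow_zero, one_mul]
    congr 2
    ext n
    rcases eq_or_ne n 0 with rfl | hn
    · simp
    · rw [if_neg hn, Function.update_of_ne hn]

end PartialFractions

/-! ### Gaussian-type series and the theta series. -/

section ThetaSeries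

variable {Q : ℂ}

theorem half_mul_succ (r : ℤ) : (r + 1) * (r + 1 - 1) / 2 = r * (r - 1) / 2 + r := by
  rw [← Int.add_mul_ediv_left _ _ two_ne_zero]; congr 1; ring

theorem two_mul_half (r : ℤ) : 2 * (r * (r - 1) / 2) = r * (r - 1) :=
  Int.mul_ediv_cancel' (by
    have := (Int.even_mul_pred_self r); exact this.two_dvd)

theorem summable_gauss_nat {ρ R : ℝ} (hρ0 : 0 < ρ) (hρ : ρ < 1) (hR : 0 < R) :
    Summable fun n : ℕ => ρ ^ ((n : ℤ) * (n - 1) / 2) * R ^ n := by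
  refine summable_of_ratio_test_tendsto_lt_one zero_lt_one
    (Eventually.of_forall fun n => by positivity) ?_
  have : Tendsto (fun n : ℕ => ρ ^ n * R) atTop (𝓝 0) := by
    simpa using (tendsto_pow_atTop_nhds_zero_of_lt_one hρ0.le hρ).mul_const R
  refine this.congr fun n => ?_
  rw [Nat.cast_add, Nat.cast_one, half_mul_succ, zpow_add₀ hρ0.ne', zpow_natCast, pow_succ,
    Real.norm_of_nonneg (by positivity), Real.norm_of_nonneg (by positivity)]
  have h1 : ρ ^ ((n : ℤ) * (n - 1) / 2) ≠ 0 := by positivity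
  field_simp

theorem summable_gauss {ρ R : ℝ} (hρ0 : 0 < ρ) (hρ : ρ < 1) (hR : 1 ≤ R) :
    Summable fun n : ℤ => ρ ^ (n * (n - 1) / 2) * R ^ n.natAbs := by
  have hR0 : 0 < R := by linarith
  refine Summable.of_nat_of_neg (by simpa using summable_gauss_nat hρ0 hρ hR0) ?_
  refine (summable_gauss_nat hρ0 hρ hR0).of_nonneg_of_le (fun n => by positivity) fun n => ?_
  simp only [Int.natAbs_neg, Int.natAbs_natCast]
  gcongr ?_ * _
  refine zpow_le_zpow_right_of_le_one₀ hρ0 hρ.le (Int.ediv_le_ediv (by norm_num) ?_)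
  nlinarith

theorem zpow_le_pow_natAbs {R t : ℝ} (ht0 : 0 < t) (ht : t ≤ R) (ht' : t⁻¹ ≤ R) (n : ℤ) :
    t ^ n ≤ R ^ n.natAbs := by
  obtain ⟨m, rfl | rfl⟩ := Int.eq_nat_or_neg n
  · simpa using pow_le_pow_left₀ ht0.le ht m
  · simpa using pow_le_pow_left₀ (inv_nonneg.2 ht0.le) ht' m

theorem one_le_of_le_of_inv_le {R t : ℝ} (ht0 : 0 < t) (ht : t ≤ R) (ht' : t⁻¹ ≤ R) : 1 ≤ R := by
  rcases le_or_gt 1 t with h | h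
  · exact h.trans ht
  · exact ((one_lt_inv₀ ht0).2 h).le.trans ht'

theorem summable_norm_gauss (hQ0 : Q ≠ 0) (hQ : ‖Q‖ < 1) {X : ℂ} (hX : X ≠ 0) :
    Summable fun r : ℤ => ‖Q ^ (r * (r - 1) / 2) * X ^ r‖ := by
  have hX' : 0 < ‖X‖ := norm_pos_iff.2 hX
  have h1 := le_max_left ‖X‖ ‖X‖⁻¹
  have h2 := le_max_right ‖X‖ ‖X‖⁻¹
  refine (summable_gauss (norm_pos_iff.2 hQ0) hQ (one_le_of_le_of_inv_le hX' h1 h2)).of_nonneg_of_le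
    (fun r => norm_nonneg _) fun r => ?_
  rw [norm_mul, norm_zpow, norm_zpow]
  gcongr
  exact zpow_le_pow_natAbs hX' h1 h2 r

/-- The series `∑ Q^{r(r-1)/2} c_r X^r` with bounded coefficients is analytic in `X ≠ 0`. -/
theorem analyticAt_gauss_series (hQ0 : Q ≠ 0) (hQ : ‖Q‖ < 1) {c : ℤ → ℂ} {C : ℝ}
    (hc : ∀ r, ‖c r‖ ≤ C) {X : ℂ} (hX : X ≠ 0) :
    AnalyticAt ℂ (fun X => ∑' r : ℤ, Q ^ (r * (r - 1) / 2) * X ^ r * c r) X := by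
  have hX' : 0 < ‖X‖ := norm_pos_iff.2 hX
  set R := max (2 * ‖X‖) (2 * ‖X‖⁻¹) with hR
  have hC : 0 ≤ C := (norm_nonneg _).trans (hc 0)
  set U : Set ℂ := {W | ‖X‖ / 2 < ‖W‖ ∧ ‖W‖ < 2 * ‖X‖} with hU
  have hUo : IsOpen U := (isOpen_lt continuous_const continuous_norm).inter
    (isOpen_lt continuous_norm continuous_const)
  have hXU : X ∈ U := ⟨by linarith, by linarith⟩
  have hW : ∀ W ∈ U, 0 < ‖W‖ ∧ ‖W‖ ≤ R ∧ ‖W‖⁻¹ ≤ R := by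
    rintro W ⟨h1, h2⟩
    have h0 : 0 < ‖W‖ := by linarith
    refine ⟨h0, h2.le.trans (le_max_left _ _), le_trans ?_ (le_max_right _ _)⟩
    have := inv_anti₀ (by positivity) h1.le
    rwa [inv_div, div_eq_mul_inv] at this
  have hR1 : 1 ≤ R := one_le_of_le_of_inv_le (hW X hXU).1 (hW X hXU).2.1 (hW X hXU).2.2
  refine DifferentiableOn.analyticAt (s := U) ?_ (hUo.mem_nhds hXU)
  refine Complex.differentiableOn_tsum_of_summable_norm
    ((summable_gauss (norm_pos_iff.2 hQ0) hQ hR1).mul_right C) (fun r => ?_) hUo fun r W hWU => ?_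
  · intro W hWU
    have : W ≠ 0 := norm_pos_iff.1 (hW W hWU).1
    exact (((differentiableAt_zpow.2 (Or.inl this)).const_mul _).mul_const _).differentiableWithinAt
  · obtain ⟨h0, h1, h2⟩ := hW W hWU
    rw [norm_mul, norm_mul, norm_zpow, norm_zpow]
    gcongr
    · exact zpow_le_pow_natAbs h0 h1 h2 r
    · exact hc r

/-- The theta series `∑ Q^{r(r-1)/2} X^r`. -/
def thetaSum (X Q : ℂ) : ℂ := ∑' r : ℤ, Q ^ (r * (r - 1) / 2) * X ^ r

theorem thetaSum_mul_left (hQ0 : Q ≠ 0) {X : ℂ} (hX : X ≠ 0) :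
    thetaSum (Q * X) Q = X⁻¹ * thetaSum X Q := by
  rw [thetaSum, thetaSum, ← (Equiv.addRight (1 : ℤ)).tsum_eq
    (fun r : ℤ => Q ^ (r * (r - 1) / 2) * X ^ r), ← tsum_mul_left]
  congr 1; ext r
  rw [Equiv.coe_addRight, half_mul_succ, zpow_add₀ hQ0, zpow_add_one₀ hX, mul_zpow]
  field_simp

theorem analyticAt_thetaSum (hQ0 : Q ≠ 0) (hQ : ‖Q‖ < 1) {X : ℂ} (hX : X ≠ 0) :
    AnalyticAt ℂ (fun X => thetaSum X Q) X := by
  simpa only [thetaSum, mul_one] using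
    analyticAt_gauss_series (c := fun _ => 1) (C := 1) hQ0 hQ (by simp) hX

/-- The reflection `r ↦ 1 - r` fixes the Gaussian exponent and reverses the sign of `(-1)^r`. -/
theorem thetaSum_neg_one (hQ0 : Q ≠ 0) : thetaSum (-1) Q = 0 := by
  have h := (Equiv.subLeft (1 : ℤ)).tsum_eq (fun r : ℤ => Q ^ (r * (r - 1) / 2) * (-1 : ℂ) ^ r)
  have h2 : ∀ r : ℤ, Q ^ ((Equiv.subLeft (1 : ℤ) r) * (Equiv.subLeft (1 : ℤ) r - 1) / 2) *
      (-1 : ℂ) ^ (Equiv.subLeft (1 : ℤ) r) = -(Q ^ (r * (r - 1) / 2) * (-1 : ℂ) ^ r) := by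
    intro r
    rw [Equiv.subLeft_apply, show (1 - r) * (1 - r - 1) = r * (r - 1) by ring,
      zpow_sub₀ (by norm_num : (-1 : ℂ) ≠ 0), zpow_one]
    have : (-1 : ℂ) ^ r * (-1) ^ r = 1 := by rw [← mul_zpow]; simp
    have h0 : (-1 : ℂ) ^ r ≠ 0 := zpow_ne_zero _ (by norm_num)
    field_simp
    linear_combination this
  simp only [h2, tsum_neg] at h
  rw [thetaSum]
  exact CharZero.neg_eq_self_iff.1 h

end ThetaSeries

/-! ### The pentagonal number theorem in the unit disc. -/

section Pentagonal

variable {q : ℂ}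

/-- The bound is uniform in `k` and `n`, by `1 + t ≤ exp t` and the geometric series. It controls
the summability and the remainder required by `Pentagonal.tprod_one_sub_pow`. -/
theorem norm_prod_one_sub_pow_le (hq : ‖q‖ < 1) (k n : ℕ) :
    ‖∏ i ∈ Finset.range n, (1 - q ^ (k + i + 1))‖ ≤ Real.exp (1 - ‖q‖)⁻¹ := by
  rw [norm_prod]
  calc ∏ i ∈ Finset.range n, ‖1 - q ^ (k + i + 1)‖
      ≤ ∏ i ∈ Finset.range n, Real.exp (‖q‖ ^ i) := by
        refine Finset.prod_le_prod (fun i _ => norm_nonneg _) fun i _ => ?_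
        have h1 : ‖q‖ ^ (k + i + 1) ≤ ‖q‖ ^ i :=
          pow_le_pow_of_le_one (norm_nonneg _) hq.le (by omega)
        have h2 := norm_sub_le (1 : ℂ) (q ^ (k + i + 1))
        rw [norm_one, norm_pow] at h2
        linarith [Real.add_one_le_exp (‖q‖ ^ i)]
    _ = Real.exp (∑ i ∈ Finset.range n, ‖q‖ ^ i) := (Real.exp_sum _ _).symm
    _ ≤ _ := by
        rw [Real.exp_le_exp, ← tsum_geometric_of_lt_one (norm_nonneg _) hq]
        exact (summable_geometric_of_lt_one (norm_nonneg _) hq).sum_le_tsum _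
          fun i _ => by positivity

theorem norm_pow_mul_prod_one_sub_pow_le (hq : ‖q‖ < 1) (k n : ℕ) :
    ‖q ^ ((k + 1) * n) * ∏ i ∈ Finset.range (n + 1), (1 - q ^ (k + i + 1))‖ ≤
      ‖q‖ ^ n * Real.exp (1 - ‖q‖)⁻¹ := by
  rw [norm_mul, norm_pow]
  gcongr ?_ * ?_
  · exact pow_le_pow_of_le_one (norm_nonneg _) hq.le (by nlinarith)
  · exact norm_prod_one_sub_pow_le hq k (n + 1)

theorem tendsto_pentagonal_remainder (hq : ‖q‖ < 1) :
    Tendsto (fun k => (-1) ^ (k + 1) * q ^ ((k + 1) * (3 * k + 4) / 2) *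
      ∑' n : ℕ, q ^ ((k + 1) * n) * ∏ i ∈ Finset.range (n + 1), (1 - q ^ (k + i + 1)))
      atTop (𝓝 0) := by
  have hgeo := summable_geometric_of_lt_one (norm_nonneg q) hq
  have hb : ∀ k : ℕ, ‖(-1) ^ (k + 1) * q ^ ((k + 1) * (3 * k + 4) / 2) *
      ∑' n : ℕ, q ^ ((k + 1) * n) * ∏ i ∈ Finset.range (n + 1), (1 - q ^ (k + i + 1))‖ ≤
      ‖q‖ ^ k * ((1 - ‖q‖)⁻¹ * Real.exp (1 - ‖q‖)⁻¹) := by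
    intro k
    rw [norm_mul, norm_mul, norm_pow, norm_neg, norm_one, one_pow, one_mul, norm_pow]
    refine mul_le_mul ?_ ?_ (norm_nonneg _) (by positivity)
    · refine pow_le_pow_of_le_one (norm_nonneg _) hq.le ?_
      rw [Nat.le_div_iff_mul_le two_pos]; nlinarith
    · have hs := (hgeo.mul_right (Real.exp (1 - ‖q‖)⁻¹)).hasSum
      rw [tsum_mul_right, tsum_geometric_of_lt_one (norm_nonneg _) hq] at hs
      exact tsum_of_norm_bounded hs (norm_pow_mul_prod_one_sub_pow_le hq k)
  refine squeeze_zero_norm hb ?_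
  simpa using (tendsto_pow_atTop_nhds_zero_of_lt_one (norm_nonneg _) hq).mul_const _

theorem summable_pentagonal (hq0 : q ≠ 0) (hq : ‖q‖ < 1) :
    Summable fun r : ℤ => (-1 : ℂ) ^ r * q ^ pentagonal r := by
  have h1 : ∀ r : ℤ, ‖(-1 : ℂ) ^ r * q ^ pentagonal r‖ ≤ ‖q ^ (r * (r - 1) / 2) * (1 : ℂ) ^ r‖ := by
    intro r
    rw [norm_mul, norm_zpow, norm_neg, norm_one, one_zpow, one_mul, one_zpow, mul_one, norm_pow,
      norm_zpow, ← zpow_natCast]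
    refine zpow_le_zpow_right_of_le_one₀ (norm_pos_iff.2 hq0) hq.le ?_
    have h2 := two_mul_natCast_pentagonal r
    have h3 := two_mul_half r
    nlinarith [sq_nonneg r]
  exact (summable_norm_gauss hq0 hq one_ne_zero).of_norm_bounded h1

/-- The pentagonal number theorem for complex numbers. -/
theorem tprod_one_sub_pow_eq_pentagonal (hq0 : q ≠ 0) (hq : ‖q‖ < 1) :
    ∏' n : ℕ, (1 - q ^ (n + 1)) = ∑' r : ℤ, (-1 : ℂ) ^ r * q ^ pentagonal r := by
  have hsumZ := summable_pentagonal hq0 hq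
  have hs1 : Summable fun k : ℕ => (-1 : ℂ) ^ (-(k : ℤ)) * q ^ pentagonal (-(k : ℤ)) :=
    hsumZ.comp_injective (i := fun k : ℕ => -(k : ℤ)) fun a b h => by simpa using h
  have hs2 : Summable fun k : ℕ => (-1 : ℂ) ^ ((k : ℤ) + 1) * q ^ pentagonal ((k : ℤ) + 1) :=
    hsumZ.comp_injective (i := fun k : ℕ => (k : ℤ) + 1) fun a b h => by simpa using h
  have hcomb : ∀ k : ℕ, (-1 : ℂ) ^ k * (q ^ pentagonal (-(k : ℤ)) - q ^ pentagonal ((k : ℤ) + 1)) =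
      (-1 : ℂ) ^ (-(k : ℤ)) * q ^ pentagonal (-(k : ℤ)) +
        (-1 : ℂ) ^ ((k : ℤ) + 1) * q ^ pentagonal ((k : ℤ) + 1) := by
    intro k
    rw [zpow_neg, zpow_add_one₀ (by norm_num), zpow_natCast, ← inv_pow, inv_neg, inv_one]; ring
  have hsplit := tsum_of_nat_of_neg_add_one (f := fun r : ℤ => (-1 : ℂ) ^ (-r) * q ^ pentagonal (-r))
    hs1 (by simpa only [neg_neg] using hs2)
  simp only [neg_neg] at hsplit
  have hmul : ∀ k : ℕ, Multipliable fun n : ℕ => 1 - q ^ (n + k + 1) := fun k => by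
    have := multipliable_qPoch hq (q ^ (k + 1))
    simpa only [← pow_add, add_assoc] using this
  rw [Pentagonal.tprod_one_sub_pow (tendsto_pow_atTop_nhds_zero_of_norm_lt_one hq)
    (fun k => ((summable_geometric_of_lt_one (norm_nonneg q) hq).mul_right _).of_norm_bounded
      (norm_pow_mul_prod_one_sub_pow_le hq k)) hmul ((hs1.add hs2).congr fun k => (hcomb k).symm)
    (tendsto_pentagonal_remainder hq), tsum_congr hcomb, hs1.tsum_add hs2, ← hsplit]
  exact (Equiv.neg ℤ).tsum_eq (fun r : ℤ => (-1 : ℂ) ^ r * q ^ pentagonal r)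

/-- Sorting the factors by exponent modulo `3` identifies `j(q; q³)` with `(q; q)_∞`, the value that
normalises the triple product. -/
theorem qPoch_split_three (hq : ‖q‖ < 1) (x : ℂ) :
    qPoch x q = qPoch x (q ^ 3) * qPoch (q * x) (q ^ 3) * qPoch (q ^ 2 * x) (q ^ 3) := by
  have hq3 : ‖q ^ 3‖ < 1 := by
    rw [norm_pow]; exact pow_lt_one₀ (norm_nonneg _) hq (by norm_num)
  have h := ((multipliable_qPoch hq x).tendsto_prod_tprod_nat).comp
    (tendsto_id.const_mul_atTop' (r := 3) (by norm_num))
  refine tendsto_nhds_unique h (Tendsto.congr (fun n => ?_)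
    (((multipliable_qPoch hq3 x).tendsto_prod_tprod_nat.mul
      (multipliable_qPoch hq3 (q * x)).tendsto_prod_tprod_nat).mul
      (multipliable_qPoch hq3 (q ^ 2 * x)).tendsto_prod_tprod_nat))
  induction n with
  | zero => simp
  | succ n ih =>
    simp only [Function.comp, id] at ih ⊢
    rw [Finset.prod_range_succ, Finset.prod_range_succ, Finset.prod_range_succ,
      show 3 * (n + 1) = 3 * n + 1 + 1 + 1 by ring, Finset.prod_range_succ, Finset.prod_range_succ,
      Finset.prod_range_succ, ← ih]
    ring

end Pentagonal

/-! ### The Jacobi triple product. -/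

section JacobiTripleProduct

variable {Q : ℂ}

theorem zpow_mul_eq_one_or_forall (Q x : ℂ) :
    (∃ n : ℤ, x = Q ^ n * 1) ∨ ∀ n : ℤ, Q ^ n * x ≠ 1 := by
  by_cases h : ∃ n : ℤ, Q ^ n * x = 1
  · obtain ⟨n, hn⟩ := h
    refine Or.inl ⟨-n, ?_⟩
    rw [mul_one, zpow_neg]; exact eq_inv_of_mul_eq_one_right hn
  · exact Or.inr fun n hn => h ⟨n, hn⟩

theorem analyticAt_comp_neg {f : ℂ → ℂ} (hf : ∀ x ≠ 0, AnalyticAt ℂ f x) {x : ℂ} (hx : x ≠ 0) :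
    AnalyticAt ℂ (fun x => f (-x)) x :=
  AnalyticAt.fun_comp (g := f) (f := fun x => -x) (hf _ (neg_ne_zero.2 hx)) analyticAt_id.neg

/-- Series and product have the same multiplier under `x ↦ Qx`, so their quotient is periodic. The
product has simple zeros on the orbit of `1`, where the series vanishes too; hence the quotient
extends analytically and is constant. -/
theorem exists_thetaSum_eq_const_mul (hQ0 : Q ≠ 0) (hQ : ‖Q‖ < 1) :
    ∃ c, ∀ x ≠ 0, thetaSum (-x) Q = c * theta x Q := by
  have han : ∀ x ≠ 0, AnalyticAt ℂ (fun x => thetaSum (-x) Q) x := fun x hx =>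
    analyticAt_comp_neg (fun x hx => analyticAt_thetaSum hQ0 hQ hx) hx
  have hfe : ∀ p ≠ 0, ∀ᶠ x in 𝓝[≠] p, thetaSum (-(Q * x)) Q / theta (Q * x) Q =
      1 * (thetaSum (-x) Q / theta x Q) := by
    intro p hp
    filter_upwards [mem_nhdsWithin_of_mem_nhds (isOpen_ne.mem_nhds hp : {0}ᶜ ∈ 𝓝 p)] with x hx
    have hx : x ≠ 0 := hx
    rw [theta_mul_left hQ0 hQ hx, ← mul_neg, thetaSum_mul_left hQ0 (neg_ne_zero.2 hx), inv_neg,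
      one_mul]
    exact mul_div_mul_left _ _ (neg_ne_zero.2 (inv_ne_zero hx))
  have hrem : ∀ p ≠ 0, Removable (fun x => thetaSum (-x) Q / theta x Q) p := by
    intro p hp
    rcases zpow_mul_eq_one_or_forall Q p with ⟨n, rfl⟩ | hp1
    · rw [removable_zpow_mul_iff (μ := fun _ => 1) hQ0 (fun _ _ => analyticAt_const)
        (fun _ _ => one_ne_zero) hfe one_ne_zero]
      have hreg : thetaReg 1 Q ≠ 0 := by
        rw [thetaReg_one]; exact pow_ne_zero _ (qPoch_self_ne_zero hQ)
      refine ((removable_div_sub (han 1 one_ne_zero) (thetaSum_neg_one hQ0)).mul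
        (((analyticAt_thetaReg hQ one_ne_zero).inv hreg).neg.removable)).congr
        (Eventually.of_forall fun x => ?_)
      simp only [Pi.neg_apply, Pi.inv_apply]
      rw [theta_eq_one_sub_mul hQ, div_mul_eq_div_div, ← neg_sub x 1, div_neg, neg_div, mul_neg,
        div_eq_mul_inv (_ / _)]
    · exact ((han p hp).div (analyticAt_theta hQ hp) (theta_ne_zero hQ0 hQ hp hp1)).removable
  obtain ⟨g, hg, hfg, hgfe⟩ := exists_quasiperiodic_extension (μ := fun _ => 1) hQ0 hrem
    continuous_const hfe
  refine ⟨g 1, fun p hp => sub_eq_zero.1 ?_⟩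
  refine eq_zero_of_eventually_eq_zero (f := fun x => thetaSum (-x) Q - g 1 * theta x Q)
    ((han p hp).sub (analyticAt_const.mul (analyticAt_theta hQ hp))).continuousAt ?_
  filter_upwards [hfg p hp, eventually_zpow_mul_ne_one hQ0 hQ hp,
    mem_nhdsWithin_of_mem_nhds (isOpen_ne.mem_nhds hp : {0}ᶜ ∈ 𝓝 p)] with x hx hx1 hx0
  rw [eq_of_periodic hQ0 hQ hg (by simpa using hgfe) one_ne_zero hx0, ← hx]
  have := theta_ne_zero hQ0 hQ hx0 hx1
  field_simp
  simp

/-- **Jacobi triple product identity**. -/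
theorem thetaSum_neg (hQ0 : Q ≠ 0) (hQ : ‖Q‖ < 1) {x : ℂ} (hx : x ≠ 0) :
    thetaSum (-x) Q = theta x Q := by
  obtain ⟨c, hc⟩ := exists_thetaSum_eq_const_mul hQ0 hQ
  -- With `Q = q³` and `x = q`, the product is `(q; q)_∞` and the series is the pentagonal number
  -- series, because `3r(r-1)/2 + r = r(3r-1)/2`. This fixes the constant.
  obtain ⟨q, rfl⟩ := IsAlgClosed.exists_pow_nat_eq Q (show 0 < 3 by norm_num)
  have hq0 : q ≠ 0 := fun h => hQ0 (by simp [h])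
  have hq : ‖q‖ < 1 := by
    rw [norm_pow] at hQ; exact lt_of_pow_lt_pow_left₀ 3 zero_le_one (by simpa using hQ)
  have h1 : theta q (q ^ 3) = qPoch q q := by
    rw [theta, qPoch_split_three hq q, show q ^ 3 / q = q * q by field_simp, ← pow_succ]
  have h2 : thetaSum (-q) (q ^ 3) = qPoch q q := by
    have h3 := tprod_one_sub_pow_eq_pentagonal hq0 hq
    simp only [pow_succ] at h3
    rw [qPoch, h3, thetaSum]
    congr 1; ext r
    have h4 := two_mul_natCast_pentagonal r
    have h5 := two_mul_half r
    rw [← zpow_natCast q (pentagonal r), show (pentagonal r : ℤ) = 3 * (r * (r - 1) / 2) + r by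
      linarith, zpow_add₀ hq0, zpow_mul, neg_eq_neg_one_mul q, mul_zpow]
    norm_cast
    ring
  have h3 := hc q hq0
  rw [h1, h2] at h3
  have hc1 : c = 1 := mul_right_cancel₀ (qPoch_self_ne_zero hq) (by rw [← h3, one_mul])
  rw [hc x hx, hc1, one_mul]

theorem thetaSum_eq (hQ0 : Q ≠ 0) (hQ : ‖Q‖ < 1) {x : ℂ} (hx : x ≠ 0) :
    thetaSum x Q = theta (-x) Q := by
  rw [← thetaSum_neg hQ0 hQ (neg_ne_zero.2 hx), neg_neg]

end JacobiTripleProduct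

/-! ### Auxiliary facts on annuli and simple poles. -/

variable {Q : ℂ}

theorem zpow_mul_ne_one_of_norm (hQ0 : Q ≠ 0) (hQ : ‖Q‖ < 1) {w : ℂ} (hw : ‖Q‖ < ‖w‖)
    (hw1 : ‖w‖ < 1) (n : ℤ) : Q ^ n * w ≠ 1 := by
  intro h
  have hQn : 0 < ‖Q‖ := norm_pos_iff.2 hQ0
  have hn : ‖Q‖ ^ n * ‖w‖ = 1 := by rw [← norm_zpow, ← norm_mul, h, norm_one]
  rcases le_or_gt 0 n with h0 | h0
  · have : ‖Q‖ ^ n ≤ 1 := zpow_le_one₀ hQn hQ.le h0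
    nlinarith [norm_nonneg w]
  · have : ‖Q‖ ^ (-1 : ℤ) ≤ ‖Q‖ ^ n := zpow_le_zpow_right_of_le_one₀ hQn hQ.le (by omega)
    rw [zpow_neg_one] at this
    have h2 : 1 < ‖Q‖⁻¹ * ‖w‖ := by rw [← div_eq_inv_mul]; exact (one_lt_div hQn).2 hw
    nlinarith [norm_nonneg w]

theorem zpow_mul_inv_ne_one {w : ℂ} (h : ∀ n : ℤ, Q ^ n * w ≠ 1) (n : ℤ) : Q ^ n * w⁻¹ ≠ 1 := by
  intro h1
  refine h (-n) ?_
  rw [zpow_neg, ← inv_inv w, ← mul_inv, h1, inv_one]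

theorem removable_div_one_sub {f : ℂ → ℂ} (hf : AnalyticAt ℂ f 1) (h0 : f 1 = 0) :
    Removable (fun x => f x / (1 - x)) 1 := by
  refine (removable_div_sub hf.neg (by simp [h0])).congr (Eventually.of_forall fun x => ?_)
  change f x / (1 - x) = -f x / (x - 1)
  rw [← neg_sub x 1, div_neg, neg_div]

theorem thetaReg_one_ne_zero (hQ : ‖Q‖ < 1) : thetaReg 1 Q ≠ 0 := by
  rw [thetaReg_one]; exact pow_ne_zero _ (qPoch_self_ne_zero hQ)

theorem analyticAt_theta_const_mul (hQ : ‖Q‖ < 1) {c x : ℂ} (hc : c ≠ 0) (hx : x ≠ 0) :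
    AnalyticAt ℂ (fun x => theta (c * x) Q) x :=
  AnalyticAt.fun_comp (g := fun x => theta x Q) (f := fun x => c * x)
    (analyticAt_theta hQ (mul_ne_zero hc hx)) (analyticAt_const.mul analyticAt_id)

theorem eventually_ne_zero {p : ℂ} (hp : p ≠ 0) : ∀ᶠ x in 𝓝[≠] p, x ≠ 0 :=
  mem_nhdsWithin_of_mem_nhds (isOpen_ne.mem_nhds hp)

/-! ### Kronecker's identity for the bilateral series. -/

section Kronecker

variable {w : ℂ}

theorem summable_kronecker_coeff (hQ0 : Q ≠ 0) (hw : ‖Q‖ < ‖w‖) (hw1 : ‖w‖ < 1) :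
    Summable fun n : ℤ => ‖w ^ n‖ * min 1 (‖Q‖ ^ (-n)) := by
  have hQn : 0 < ‖Q‖ := norm_pos_iff.2 hQ0
  have hwn : 0 < ‖w‖ := hQn.trans hw
  refine Summable.of_nat_of_neg ?_ ?_
  · refine (summable_geometric_of_lt_one hwn.le hw1).of_nonneg_of_le (fun n => by positivity)
      fun n => ?_
    rw [zpow_natCast, norm_pow]
    exact mul_le_of_le_one_right (by positivity) (min_le_left _ _)
  · refine (summable_geometric_of_lt_one (by positivity) ((div_lt_one hwn).2 hw)).of_nonneg_of_le
      (fun n => by positivity) fun n => ?_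
    rw [neg_neg, zpow_natCast, norm_zpow, zpow_neg, zpow_natCast, div_pow, div_eq_inv_mul]
    gcongr
    exact min_le_right _ _

theorem fracSum_zpow_mul_left (hQ0 : Q ≠ 0) (hw0 : w ≠ 0) (x : ℂ) :
    fracSum (fun n => w ^ n) Q (Q * x) = w⁻¹ * fracSum (fun n => w ^ n) Q x := by
  rw [fracSum, fracSum, ← (Equiv.addRight (1 : ℤ)).tsum_eq (fun n : ℤ => w ^ n / (1 - Q ^ n * x)),
    ← tsum_mul_left]
  congr 1; ext r
  rw [Equiv.coe_addRight, zpow_add_one₀ hw0, zpow_add_one₀ hQ0, mul_assoc (Q ^ r)]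
  field_simp

/-- Kronecker's identity for the single bilateral series. -/
theorem fracSum_zpow_eq (hQ0 : Q ≠ 0) (hQ : ‖Q‖ < 1) (hw : ‖Q‖ < ‖w‖) (hw1 : ‖w‖ < 1)
    {x : ℂ} (hx0 : x ≠ 0) (hx : ∀ n : ℤ, Q ^ n * x ≠ 1) :
    fracSum (fun n => w ^ n) Q x =
      qPoch Q Q ^ 3 * theta (w * x) Q / (theta x Q * theta w Q) := by
  have hw0 : w ≠ 0 := norm_pos_iff.1 ((norm_pos_iff.2 hQ0).trans hw)
  have hwQ := zpow_mul_ne_one_of_norm hQ0 hQ hw hw1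
  have hθw := theta_ne_zero hQ0 hQ hw0 hwQ
  have hs := summable_kronecker_coeff hQ0 hw hw1
  set f : ℂ → ℂ := fun x => fracSum (fun n => w ^ n) Q x -
    qPoch Q Q ^ 3 * theta (w * x) Q / (theta x Q * theta w Q) with hf
  have hfe : ∀ p ≠ 0, ∀ᶠ x in 𝓝[≠] p, f (Q * x) = w⁻¹ * f x := by
    intro p hp
    filter_upwards [eventually_ne_zero hp, eventually_zpow_mul_ne_one hQ0 hQ hp] with x hx0 hx
    have hθ := theta_ne_zero hQ0 hQ hx0 hx
    simp only [hf]
    rw [fracSum_zpow_mul_left hQ0 hw0, theta_mul_left hQ0 hQ hx0,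
      show w * (Q * x) = Q * (w * x) by ring, theta_mul_left hQ0 hQ (mul_ne_zero hw0 hx0)]
    field_simp
  have hgen : ∀ p ≠ 0, (∀ n : ℤ, Q ^ n * p ≠ 1) → AnalyticAt ℂ f p := by
    intro p hp hp1
    refine (analyticAt_fracSum hQ0 hQ hs hp fun n _ => hp1 n).sub ?_
    exact (analyticAt_const.mul (analyticAt_theta_const_mul hQ hw0 hp)).div
      ((analyticAt_theta hQ hp).mul analyticAt_const)
      (mul_ne_zero (theta_ne_zero hQ0 hQ hp hp1) hθw)
  have hrem : ∀ p ≠ 0, Removable f p := by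
    intro p hp
    rcases zpow_mul_eq_one_or_forall Q p with ⟨n, rfl⟩ | hp1
    · rw [removable_zpow_mul_iff (μ := fun _ => w⁻¹) hQ0 (fun _ _ => analyticAt_const)
        (fun _ _ => inv_ne_zero hw0) hfe one_ne_zero]
      obtain ⟨g, hg, hfg⟩ := fracSum_near_one hQ0 hQ hs
      -- This is the coefficient of `1/(1-x)` in the difference of the two sides. It vanishes at `x
      -- = 1` because the regular part of theta there equals `(Q; Q)_∞³`.
      have hk : AnalyticAt ℂ (fun x => 1 - qPoch Q Q ^ 3 * theta (w * x) Q /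
          (thetaReg x Q * theta w Q)) 1 :=
        analyticAt_const.sub ((analyticAt_const.mul
          (analyticAt_theta_const_mul hQ hw0 one_ne_zero)).div
          ((analyticAt_thetaReg hQ one_ne_zero).mul analyticAt_const)
          (mul_ne_zero (thetaReg_one_ne_zero hQ) hθw))
      refine ((removable_div_one_sub hk ?_).add hg.removable).congr ?_
      · have := qPoch_self_ne_zero hQ
        rw [thetaReg_one, mul_one]; field_simp; simp
      · filter_upwards [hfg] with x hx
        simp only [hf]
        rw [hx, theta_eq_one_sub_mul hQ x, zpow_zero, mul_assoc (1 - x), div_mul_eq_div_div_swap]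
        ring
    · exact (hgen p hp hp1).removable
  -- The constant multiplier `w⁻¹` is no power of `Q`, since `‖Q‖ < ‖w‖ < 1`.
  have h0 := eventually_eq_zero_of_multiplier hQ0 hQ (zpow_mul_inv_ne_one hwQ) hrem hfe
  have := eq_zero_of_eventually_eq_zero (hgen x hx0 hx).continuousAt (h0 x hx0)
  exact sub_eq_zero.1 this

end Kronecker

/-! ### Appell–Lerch series: difference equations and a symmetric relation. -/

section Lerch

/-- The series `∑ Q^{r(r-1)/2} X^r / (1 - Q^r b)`. -/
def lerch (X b Q : ℂ) : ℂ := fracSum (fun r => Q ^ (r * (r - 1) / 2) * X ^ r) Q b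

variable {X b : ℂ}

/-- In this form the two parameters are independent: `X` enters only the numerators and `b` only the
denominators, so analyticity and shifts in each can be treated separately. -/
theorem appellLerch_eq (hQ0 : Q ≠ 0) (x z : ℂ) :
    appellLerch x Q z = lerch (-z) (x * z / Q) Q / theta z Q := by
  rw [appellLerch, lerch, fracSum, one_div_mul_eq_div]
  congr 2; ext r
  rw [neg_eq_neg_one_mul z, mul_zpow, zpow_sub_one₀ hQ0]
  congr 1 <;> ring

theorem summable_lerch_coeff (hQ0 : Q ≠ 0) (hQ : ‖Q‖ < 1) (hX : X ≠ 0) :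
    Summable fun r : ℤ => ‖Q ^ (r * (r - 1) / 2) * X ^ r‖ * min 1 (‖Q‖ ^ (-r)) := by
  have hQn : 0 < ‖Q‖ := norm_pos_iff.2 hQ0
  exact (summable_norm_gauss hQ0 hQ hX).of_nonneg_of_le (fun n => by positivity)
    fun n => mul_le_of_le_one_right (norm_nonneg _) (min_le_left _ _)

/-- With `u = Q^(r+1) b`, write `1/(1-u) = 1 + u/(1-u)`: the constant part is the theta series, and
the rest is the original series with its index shifted by one. -/
theorem lerch_mul_right (hQ0 : Q ≠ 0) (hQ : ‖Q‖ < 1) (hX : X ≠ 0) (hb0 : b ≠ 0)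
    (hb : ∀ n : ℤ, Q ^ n * b ≠ 1) :
    lerch X (Q * b) Q = theta (-X) Q + Q * b / X * lerch X b Q := by
  have hs := summable_frac hQ0 hQ (summable_lerch_coeff hQ0 hQ hX) hb0 fun n _ => hb n
  have hs' : Summable fun r : ℤ => Q * b / X * (Q ^ ((r + 1) * (r + 1 - 1) / 2) * X ^ (r + 1) /
      (1 - Q ^ (r + 1) * b)) := ((Equiv.addRight (1 : ℤ)).summable_iff.2 hs).mul_left _
  rw [← thetaSum_eq hQ0 hQ hX, thetaSum, lerch, lerch, fracSum, fracSum,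
    ← (Equiv.addRight (1 : ℤ)).tsum_eq (fun r : ℤ => Q ^ (r * (r - 1) / 2) * X ^ r /
      (1 - Q ^ r * b)), ← tsum_mul_left]
  simp only [Equiv.coe_addRight]
  rw [← (summable_norm_gauss hQ0 hQ hX).of_norm.tsum_add hs']
  congr 1; ext r
  have hne := hb (r + 1)
  rw [zpow_add_one₀ hQ0] at hne
  have hne' : 1 - Q ^ r * Q * b ≠ 0 := sub_ne_zero.2 hne.symm
  rw [half_mul_succ, zpow_add₀ hQ0, zpow_add_one₀ hQ0, zpow_add_one₀ hX, ← mul_assoc (Q ^ r)]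
  field_simp
  ring

/-- The new factor `Q^r` is absorbed by `u/(1-u) = 1/(1-u) - 1` with `u = Q^r b`. -/
theorem lerch_mul_left (hQ0 : Q ≠ 0) (hQ : ‖Q‖ < 1) (hX : X ≠ 0) (hb0 : b ≠ 0)
    (hb : ∀ n : ℤ, Q ^ n * b ≠ 1) :
    lerch (Q * X) b Q = b⁻¹ * (lerch X b Q - theta (-X) Q) := by
  have hs := summable_frac hQ0 hQ (summable_lerch_coeff hQ0 hQ hX) hb0 fun n _ => hb n
  rw [← thetaSum_eq hQ0 hQ hX, thetaSum, lerch, lerch, fracSum, fracSum,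
    ← hs.tsum_sub (summable_norm_gauss hQ0 hQ hX).of_norm, ← tsum_mul_left]
  congr 1; ext r
  have hne' : 1 - Q ^ r * b ≠ 0 := sub_ne_zero.2 (hb r).symm
  rw [mul_zpow]
  field_simp
  ring

theorem analyticAt_lerch_right (hQ0 : Q ≠ 0) (hQ : ‖Q‖ < 1) (hX : X ≠ 0) (hb0 : b ≠ 0)
    (hb : ∀ n : ℤ, Q ^ n * b ≠ 1) : AnalyticAt ℂ (fun b => lerch X b Q) b :=
  analyticAt_fracSum hQ0 hQ (summable_lerch_coeff hQ0 hQ hX) hb0 fun n _ => hb n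

theorem lerch_near_one (hQ0 : Q ≠ 0) (hQ : ‖Q‖ < 1) (hX : X ≠ 0) :
    ∃ g, AnalyticAt ℂ g 1 ∧ ∀ᶠ b in 𝓝[≠] 1, lerch X b Q = 1 / (1 - b) + g b := by
  simpa [lerch] using fracSum_near_one hQ0 hQ (summable_lerch_coeff hQ0 hQ hX)

theorem analyticAt_lerch_left (hQ0 : Q ≠ 0) (hQ : ‖Q‖ < 1) (hX : X ≠ 0) (hb0 : b ≠ 0)
    (hb : ∀ n : ℤ, Q ^ n * b ≠ 1) : AnalyticAt ℂ (fun X => lerch X b Q) X := by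
  obtain ⟨C, hC0, hC⟩ := exists_inv_bound hQ0 hQ hb0
  simp only [lerch, fracSum, div_eq_mul_inv]
  refine analyticAt_gauss_series (C := C) hQ0 hQ (fun r => ?_) hX
  exact ((hC.self_of_nhds r (hb r)).2).trans (mul_le_of_le_one_right hC0.le (min_le_left _ _))

theorem analyticAt_lerch_const_mul_left (hQ0 : Q ≠ 0) (hQ : ‖Q‖ < 1) {c : ℂ} (hc : c ≠ 0)
    (hX : X ≠ 0) (hb0 : b ≠ 0) (hb : ∀ n : ℤ, Q ^ n * b ≠ 1) :
    AnalyticAt ℂ (fun X => lerch (c * X) b Q) X :=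
  AnalyticAt.fun_comp (g := fun X => lerch X b Q) (f := fun X => c * X)
    (analyticAt_lerch_left hQ0 hQ (mul_ne_zero hc hX) hb0 hb) (analyticAt_const.mul analyticAt_id)

/-- A symmetric two-term relation between the series `lerch`, for a square root `e` of `Q`. -/
theorem lerch_add_lerch (hQ0 : Q ≠ 0) (hQ : ‖Q‖ < 1) {e y : ℂ} (he : e ^ 2 = Q) (hb0 : b ≠ 0)
    (hb : ∀ n : ℤ, Q ^ n * b ≠ 1) (hy0 : y ≠ 0) (hy : ∀ n : ℤ, Q ^ n * y ≠ 1) :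
    theta (-(e * y)) Q * lerch (e * b) y Q + theta (-(e * b)) Q * lerch (e * y) b Q =
      theta (-(e * y)) Q * theta (-(e * b)) Q +
        qPoch Q Q ^ 3 * theta (-e) Q * theta (b * y) Q / (theta y Q * theta b Q) := by
  have he0 : e ≠ 0 := fun h => hQ0 (by simp [← he, h])
  have heb : e * b ≠ 0 := mul_ne_zero he0 hb0
  have hθb := theta_ne_zero hQ0 hQ hb0 hb
  set f : ℂ → ℂ := fun y => theta (-e * y) Q * lerch (e * b) y Q +
    theta (-(e * b)) Q * lerch (e * y) b Q - theta (-e * y) Q * theta (-(e * b)) Q -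
      qPoch Q Q ^ 3 * theta (-e) Q * theta (b * y) Q / (theta y Q * theta b Q) with hf
  -- Here `e² = Q` is essential: the first product acquires the factor `(ey)⁻¹ · Qy/(eb)`, which is
  -- then `b⁻¹`, the multiplier of the other terms. The inhomogeneous parts of the two series cancel
  -- against the product of thetas.
  have hfe : ∀ p ≠ 0, ∀ᶠ y in 𝓝[≠] p, f (Q * y) = b⁻¹ * f y := by
    intro p hp
    filter_upwards [eventually_ne_zero hp, eventually_zpow_mul_ne_one hQ0 hQ hp] with y hy0 hy
    have hθ := theta_ne_zero hQ0 hQ hy0 hy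
    simp only [hf]
    rw [show -e * (Q * y) = Q * (-e * y) by ring, show b * (Q * y) = Q * (b * y) by ring,
      show e * (Q * y) = Q * (e * y) by ring,
      theta_mul_left hQ0 hQ hy0, theta_mul_left hQ0 hQ (mul_ne_zero hb0 hy0),
      theta_mul_left hQ0 hQ (mul_ne_zero (neg_ne_zero.2 he0) hy0),
      lerch_mul_right hQ0 hQ heb hy0 hy, lerch_mul_left hQ0 hQ (mul_ne_zero he0 hy0) hb0 hb,
      ← neg_mul e y]
    field_simp
    rw [← he]
    ring
  have hne0 := neg_ne_zero.2 he0
  have hgen : ∀ p ≠ 0, (∀ n : ℤ, Q ^ n * p ≠ 1) → AnalyticAt ℂ f p := by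
    intro p hp hp1
    have h1 := analyticAt_theta_const_mul hQ hne0 hp
    refine (((h1.mul (analyticAt_lerch_right hQ0 hQ heb hp hp1)).add
      (analyticAt_const.mul (analyticAt_lerch_const_mul_left hQ0 hQ he0 hp hb0 hb))).sub
      (h1.mul analyticAt_const)).sub ?_
    exact (analyticAt_const.mul (analyticAt_theta_const_mul hQ hb0 hp)).div
      ((analyticAt_theta hQ hp).mul analyticAt_const)
      (mul_ne_zero (theta_ne_zero hQ0 hQ hp hp1) hθb)
  have hrem : ∀ p ≠ 0, Removable f p := by
    intro p hp
    rcases zpow_mul_eq_one_or_forall Q p with ⟨n, rfl⟩ | hp1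
    · rw [removable_zpow_mul_iff (μ := fun _ => b⁻¹) hQ0 (fun _ _ => analyticAt_const)
        (fun _ _ => inv_ne_zero hb0) hfe one_ne_zero]
      obtain ⟨g, hg, hfg⟩ := lerch_near_one hQ0 hQ heb
      have h1 := analyticAt_theta_const_mul hQ hne0 one_ne_zero
      -- Only `lerch (e * b) y` and `1 / theta y` have a pole at `y = 1`. This is the combined
      -- coefficient of `1/(1-y)`; both of its terms equal `j(-e; Q)` at `y = 1`.
      have hk : AnalyticAt ℂ (fun y => theta (-e * y) Q - qPoch Q Q ^ 3 * theta (-e) Q *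
          theta (b * y) Q / (thetaReg y Q * theta b Q)) 1 :=
        h1.sub ((analyticAt_const.mul
          (analyticAt_theta_const_mul hQ hb0 one_ne_zero)).div
          ((analyticAt_thetaReg hQ one_ne_zero).mul analyticAt_const)
          (mul_ne_zero (thetaReg_one_ne_zero hQ) hθb))
      have hl : AnalyticAt ℂ (fun y => theta (-e * y) Q * g y + (theta (-(e * b)) Q *
          lerch (e * y) b Q - theta (-e * y) Q * theta (-(e * b)) Q)) 1 :=
        (h1.mul hg).add ((analyticAt_const.mul
          (analyticAt_lerch_const_mul_left hQ0 hQ he0 one_ne_zero hb0 hb)).sub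
          (h1.mul analyticAt_const))
      refine ((removable_div_one_sub hk ?_).add hl.removable).congr ?_
      · have := qPoch_self_ne_zero hQ
        rw [thetaReg_one, mul_one, mul_one]; field_simp; simp
      · filter_upwards [hfg] with y hy
        simp only [hf]
        rw [hy, theta_eq_one_sub_mul hQ y, mul_assoc (1 - y),
          div_mul_eq_div_div_swap (qPoch Q Q ^ 3 * theta (-e) Q * theta (b * y) Q)]
        ring
    · exact (hgen p hp hp1).removable
  have h0 := eventually_eq_zero_of_multiplier hQ0 hQ (zpow_mul_inv_ne_one hb) hrem hfe
  have := eq_zero_of_eventually_eq_zero (hgen y hy0 hy).continuousAt (h0 y hy0)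
  simp only [hf, neg_mul] at this
  linear_combination this

end Lerch

/-! ### The sign function and one-sided geometric series. -/

section Sign

theorem sg_of_nonneg {r : ℤ} (h : 0 ≤ r) : sg r = 1 := if_pos h

theorem sg_of_neg {r : ℤ} (h : r < 0) : sg r = -1 := if_neg (not_le.2 h)

theorem sg_natCast (n : ℕ) : sg n = 1 := sg_of_nonneg (by positivity)

theorem sg_neg_succ (n : ℕ) : sg (-((n : ℤ) + 1)) = -1 := sg_of_neg (by omega)

theorem sg_eq_sg_iff {r s : ℤ} : sg r = sg s ↔ (0 ≤ r ↔ 0 ≤ s) := by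
  unfold sg; split_ifs with h1 h2 h2 <;> simp [h1, h2]

theorem sg_eq_sg_cases {s t : ℤ} (h : sg s = sg t) :
    (∃ m n : ℕ, s = m ∧ t = n) ∨ ∃ m n : ℕ, s = -((m : ℤ) + 1) ∧ t = -((n : ℤ) + 1) := by
  rw [sg_eq_sg_iff] at h
  rcases le_or_gt 0 s with hs | hs
  · exact Or.inl ⟨s.toNat, t.toNat, by omega, by omega⟩
  · exact Or.inr ⟨(-s - 1).toNat, (-t - 1).toNat, by omega, by omega⟩

/-- The two one-sided expansions of `1/(1-u)`, for `‖u‖ < 1` and for `‖u‖ > 1`, differ by a sign,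
which `sg` records. -/
theorem hasSum_geometric_sg {s : ℤ} {u : ℂ} (h0 : 0 ≤ s → ‖u‖ < 1) (h1 : s < 0 → 1 < ‖u‖) :
    HasSum (fun t : ℤ => if sg s = sg t then u ^ t else 0) ((sg s : ℂ) / (1 - u)) := by
  rcases le_or_gt 0 s with hs | hs
  · have hn : HasSum (fun n : ℕ => if sg s = sg n then u ^ (n : ℤ) else 0) (1 - u)⁻¹ := by
      simpa [sg_of_nonneg hs, sg_natCast] using hasSum_geometric_of_norm_lt_one (h0 hs)
    have hneg : HasSum (fun n : ℕ => if sg s = sg (-((n : ℤ) + 1)) then u ^ (-((n : ℤ) + 1)) else 0)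
        0 := by
      simp only [sg_of_nonneg hs, sg_neg_succ, show ¬ (1 : ℤ) = -1 by norm_num, if_false]
      exact hasSum_zero
    have := HasSum.of_nat_of_neg_add_one (f := fun t : ℤ => if sg s = sg t then u ^ t else 0)
      hn hneg
    rw [add_zero] at this
    have e : (sg s : ℂ) / (1 - u) = (1 - u)⁻¹ := by rw [sg_of_nonneg hs, Int.cast_one, one_div]
    rwa [e]
  · have hu : 1 < ‖u‖ := h1 hs
    have hu0 : u ≠ 0 := norm_pos_iff.1 (by linarith)
    have hu1 : 1 - u ≠ 0 := by
      rintro h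
      rw [← sub_eq_zero.1 h] at hu; simp at hu
    have hu2 : u - 1 ≠ 0 := by rw [← neg_sub]; exact neg_ne_zero.2 hu1
    have hn : HasSum (fun n : ℕ => if sg s = sg n then u ^ (n : ℤ) else 0) 0 := by
      simp only [sg_of_neg hs, sg_natCast, show ¬ (-1 : ℤ) = 1 by norm_num, if_false]
      exact hasSum_zero
    have hneg : HasSum (fun n : ℕ => if sg s = sg (-((n : ℤ) + 1)) then u ^ (-((n : ℤ) + 1)) else 0)
        (u⁻¹ * (1 - u⁻¹)⁻¹) := by
      have := (hasSum_geometric_of_norm_lt_one (ξ := u⁻¹) (by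
        rw [norm_inv]; exact inv_lt_one_of_one_lt₀ hu)).mul_left u⁻¹
      convert! this using 2 with n
      rw [sg_of_neg hs, sg_neg_succ, if_pos rfl, zpow_neg, ← inv_zpow, zpow_add_one₀
        (inv_ne_zero hu0), zpow_natCast, mul_comm]
    convert HasSum.of_nat_of_neg_add_one (f := fun t : ℤ => if sg s = sg t then u ^ t else 0)
      hn hneg using 1
    rw [sg_of_neg hs, Int.cast_neg, Int.cast_one]
    field_simp
    ring

end Sign

/-! ### The signed double sum: convergence, regularity and shifts. -/

section PairSum

variable {Q X w a : ℂ}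

/-- The weight `sg(s)` on the pairs with `sg(s) = sg(t)`, and `0` elsewhere. -/
def pairWeight (p : ℤ × ℤ) : ℂ := if sg p.1 = sg p.2 then (sg p.1 : ℂ) else 0

/-- The summand `Q^{st} w^s a^t / (1 - Q^{s+t} X)`. -/
def pairFrac (Q X w a : ℂ) (p : ℤ × ℤ) : ℂ :=
  Q ^ (p.1 * p.2) * w ^ p.1 * a ^ p.2 / (1 - Q ^ (p.1 + p.2) * X)

/-- The signed double sum of `pairFrac`. -/
def pairSum (Q X w a : ℂ) : ℂ := ∑' p : ℤ × ℤ, pairWeight p * pairFrac Q X w a p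

theorem norm_pairWeight_le (p : ℤ × ℤ) : ‖pairWeight p‖ ≤ 1 := by
  unfold pairWeight sg; split_ifs <;> simp

/-- The correction is `1` along the whole line `s = 0`, for `t` of either sign. This is why boundary
terms are bilateral series. -/
theorem pairWeight_sub_left (s t : ℤ) :
    pairWeight (s - 1, t) = pairWeight (s, t) - if s = 0 then 1 else 0 := by
  simp only [pairWeight, sg]
  split_ifs <;> first | contradiction | omega | simp

theorem pairWeight_sub_right (s t : ℤ) :
    pairWeight (s, t - 1) = pairWeight (s, t) - if t = 0 then 1 else 0 := by
  simp only [pairWeight, sg]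
  split_ifs <;> first | contradiction | omega | simp

theorem summable_pow_natAbs {ρ : ℝ} (h0 : 0 ≤ ρ) (h1 : ρ < 1) :
    Summable fun n : ℤ => ρ ^ n.natAbs := by
  refine Summable.of_nat_of_neg ?_ ?_ <;> simpa using summable_geometric_of_lt_one h0 h1

theorem summable_pow_natAbs_mul {ρ : ℝ} (h0 : 0 ≤ ρ) (h1 : ρ < 1) (C : ℝ) :
    Summable fun p : ℤ × ℤ => C * (ρ ^ p.1.natAbs * ρ ^ p.2.natAbs) :=
  ((summable_pow_natAbs h0 h1).mul_of_nonneg (summable_pow_natAbs h0 h1)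
    (fun _ => by positivity) (fun _ => by positivity)).mul_left C

/-- For negative `s = -(m+1)`, `t = -(n+1)` one has `st = mn - 1 + (m+1) + (n+1)`, which supplies
one factor `κ` for each of `W⁻¹` and `A⁻¹`. The minimum supplies `k` further factors: `k = 1`
describes fractions with a genuine denominator, `k = 0` those without. -/
theorem zpow_mul_zpow_mul_zpow_le {κ W A ρ : ℝ} (hκ0 : 0 < κ) (hκ : κ ≤ 1) (hW : 0 < W)
    (hA : 0 < A) (hWρ : W ≤ ρ) (hAρ : A ≤ ρ) {k : ℕ} (hWρ' : κ ^ (k + 1) / W ≤ ρ)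
    (hAρ' : κ ^ (k + 1) / A ≤ ρ) {s t : ℤ} (hst : sg s = sg t) :
    κ ^ (s * t) * W ^ s * A ^ t * min 1 (κ ^ (-(k * (s + t)))) ≤
      κ⁻¹ * (ρ ^ s.natAbs * ρ ^ t.natAbs) := by
  have hρ : 0 < ρ := hW.trans_le hWρ
  rcases sg_eq_sg_cases hst with ⟨m, n, rfl, rfl⟩ | ⟨m, n, rfl, rfl⟩
  · simp only [Int.natAbs_natCast, zpow_natCast]
    have h1 : κ ^ ((m : ℤ) * n) ≤ 1 := zpow_le_one₀ hκ0 hκ (by positivity)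
    calc _ ≤ 1 * ρ ^ m * ρ ^ n * 1 := by
          gcongr
          exact min_le_left _ _
      _ = 1 * (ρ ^ m * ρ ^ n) := by ring
      _ ≤ _ := by gcongr; exact (one_le_inv₀ hκ0).2 hκ
  · have hm : (-((m : ℤ) + 1)).natAbs = m + 1 := by omega
    have hn : (-((n : ℤ) + 1)).natAbs = n + 1 := by omega
    rw [hm, hn]
    calc _ ≤ κ ^ (-((m : ℤ) + 1) * -((n : ℤ) + 1)) * W ^ (-((m : ℤ) + 1)) * A ^ (-((n : ℤ) + 1)) *
          κ ^ (-(k * (-((m : ℤ) + 1) + -((n : ℤ) + 1)))) := by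
          gcongr
          exact min_le_right _ _
      _ = κ ^ ((m : ℤ) * n) * (κ⁻¹ * ((κ ^ (k + 1) / W) ^ (m + 1) * (κ ^ (k + 1) / A) ^ (n + 1))) := by
          have e1 : κ⁻¹ = κ ^ (-1 : ℤ) := by simp
          have e2 : κ ^ (k + 1) = κ ^ ((k : ℤ) + 1) := by norm_cast
          rw [div_pow, div_pow, e1, e2, ← zpow_natCast, ← zpow_natCast (κ ^ ((k : ℤ) + 1)),
            ← zpow_mul, ← zpow_mul, zpow_neg W, zpow_neg A, ← zpow_natCast W, ← zpow_natCast A]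
          push_cast
          have e3 : κ ^ (-((m : ℤ) + 1) * -((n : ℤ) + 1)) *
              κ ^ (-(k * (-((m : ℤ) + 1) + -((n : ℤ) + 1)))) = κ ^ ((m : ℤ) * n) * (κ ^ (-1 : ℤ) *
              (κ ^ (((k : ℤ) + 1) * (m + 1)) * κ ^ (((k : ℤ) + 1) * (n + 1)))) := by
            rw [← zpow_add₀ hκ0.ne', ← zpow_add₀ hκ0.ne', ← zpow_add₀ hκ0.ne', ← zpow_add₀ hκ0.ne']
            congr 1; ring
          linear_combination (W ^ ((m : ℤ) + 1))⁻¹ * (A ^ ((n : ℤ) + 1))⁻¹ * e3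
      _ ≤ 1 * (κ⁻¹ * (ρ ^ (m + 1) * ρ ^ (n + 1))) := by
          gcongr
          exact zpow_le_one₀ hκ0 hκ (by positivity)
      _ = _ := one_mul _

/-- The decay of the denominators widens the admissible annulus to `‖Q‖² < ‖w‖, ‖a‖ < 1`, so that
`a` may be replaced by `Qa`. The exponent `-1` is exempt from the pole condition because `s + t` is
nonnegative or at most `-2` when the signs agree. -/
theorem exists_pairFrac_bound (hQ0 : Q ≠ 0) (hQ : ‖Q‖ < 1) (hX0 : X ≠ 0)
    (hX : ∀ n : ℤ, n ≠ -1 → Q ^ n * X ≠ 1) (hw : ‖Q‖ ^ 2 < ‖w‖) (hw1 : ‖w‖ < 1)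
    (ha : ‖Q‖ ^ 2 < ‖a‖) (ha1 : ‖a‖ < 1) :
    ∃ C ρ : ℝ, 0 ≤ ρ ∧ ρ < 1 ∧ ∀ᶠ v : ℂ × ℂ × ℂ in 𝓝 (X, w, a), v.2.1 ≠ 0 ∧ v.2.2 ≠ 0 ∧
      ∀ p : ℤ × ℤ, sg p.1 = sg p.2 → 1 - Q ^ (p.1 + p.2) * v.1 ≠ 0 ∧
        ‖pairFrac Q v.1 v.2.1 v.2.2 p‖ ≤ C * (ρ ^ p.1.natAbs * ρ ^ p.2.natAbs) := by
  have hQn : 0 < ‖Q‖ := norm_pos_iff.2 hQ0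
  obtain ⟨C, hC0, hC⟩ := exists_inv_bound hQ0 hQ hX0
  have hwn : 0 < ‖w‖ := (by positivity : 0 ≤ ‖Q‖ ^ 2).trans_lt hw
  have han : 0 < ‖a‖ := (by positivity : 0 ≤ ‖Q‖ ^ 2).trans_lt ha
  obtain ⟨ρ, hρ, hρ1⟩ := exists_between (show max (max ‖w‖ ‖a‖) (max (‖Q‖ ^ 2 / ‖w‖)
    (‖Q‖ ^ 2 / ‖a‖)) < 1 by
      simp only [max_lt_iff, div_lt_one hwn, div_lt_one han]; exact ⟨⟨hw1, ha1⟩, hw, ha⟩)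
  simp only [max_lt_iff] at hρ
  obtain ⟨⟨h1, h2⟩, h3, h4⟩ := hρ
  have cw : ContinuousAt (fun v : ℂ × ℂ × ℂ => ‖v.2.1‖) (X, w, a) := by fun_prop
  have ca : ContinuousAt (fun v : ℂ × ℂ × ℂ => ‖v.2.2‖) (X, w, a) := by fun_prop
  have cw' : ContinuousAt (fun v : ℂ × ℂ × ℂ => ‖Q‖ ^ 2 / ‖v.2.1‖) (X, w, a) :=
    continuousAt_const.div cw hwn.ne'
  have ca' : ContinuousAt (fun v : ℂ × ℂ × ℂ => ‖Q‖ ^ 2 / ‖v.2.2‖) (X, w, a) :=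
    continuousAt_const.div ca han.ne'
  have cX : Tendsto (fun v : ℂ × ℂ × ℂ => v.1) (𝓝 (X, w, a)) (𝓝 X) := continuousAt_fst
  refine ⟨C * ‖Q‖⁻¹, ρ, (norm_nonneg _).trans h1.le, hρ1, ?_⟩
  filter_upwards [cX.eventually hC, cw.eventually_const_lt hwn, ca.eventually_const_lt han,
    cw.eventually_le_const h1, ca.eventually_le_const h2, cw'.eventually_le_const h3,
    ca'.eventually_le_const h4] with v hv hw0 ha0 hw2 ha2 hw3 ha3
  refine ⟨norm_pos_iff.1 hw0, norm_pos_iff.1 ha0, fun p hp => ?_⟩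
  have hne : p.1 + p.2 ≠ -1 := by
    rw [sg_eq_sg_iff] at hp; omega
  obtain ⟨h5, h6⟩ := hv _ (hX _ hne)
  refine ⟨h5, ?_⟩
  have h7 := zpow_mul_zpow_mul_zpow_le (k := 1) hQn hQ.le hw0 ha0 hw2 ha2 hw3 ha3 hp
  rw [Nat.cast_one, one_mul] at h7
  rw [pairFrac, div_eq_mul_inv, norm_mul, norm_mul, norm_mul, norm_zpow, norm_zpow, norm_zpow]
  calc _ ≤ ‖Q‖ ^ (p.1 * p.2) * ‖v.2.1‖ ^ p.1 * ‖v.2.2‖ ^ p.2 *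
        (C * min 1 (‖Q‖ ^ (-(p.1 + p.2)))) := by gcongr
    _ = C * (‖Q‖ ^ (p.1 * p.2) * ‖v.2.1‖ ^ p.1 * ‖v.2.2‖ ^ p.2 *
        min 1 (‖Q‖ ^ (-(p.1 + p.2)))) := by ring
    _ ≤ C * (‖Q‖⁻¹ * (ρ ^ p.1.natAbs * ρ ^ p.2.natAbs)) := by gcongr
    _ = _ := by ring

theorem norm_pairWeight_mul_le {p : ℤ × ℤ} {x : ℂ} {B : ℝ} (hB : 0 ≤ B)
    (h : sg p.1 = sg p.2 → ‖x‖ ≤ B) : ‖pairWeight p * x‖ ≤ B := by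
  by_cases hp : sg p.1 = sg p.2
  · rw [norm_mul]
    exact (mul_le_of_le_one_left (norm_nonneg _) (norm_pairWeight_le p)).trans (h hp)
  · simpa [pairWeight, hp] using hB

theorem summable_pairSum (hQ0 : Q ≠ 0) (hQ : ‖Q‖ < 1) (hX0 : X ≠ 0)
    (hX : ∀ n : ℤ, n ≠ -1 → Q ^ n * X ≠ 1) (hw : ‖Q‖ ^ 2 < ‖w‖) (hw1 : ‖w‖ < 1)
    (ha : ‖Q‖ ^ 2 < ‖a‖) (ha1 : ‖a‖ < 1) :
    Summable fun p : ℤ × ℤ => pairWeight p * pairFrac Q X w a p := by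
  obtain ⟨C, ρ, h0, h1, h⟩ := exists_pairFrac_bound hQ0 hQ hX0 hX hw hw1 ha ha1
  have hv := h.self_of_nhds
  refine (summable_pow_natAbs_mul h0 h1 C).of_norm_bounded fun p => ?_
  have hC : 0 ≤ C := by
    simpa using (norm_nonneg _).trans (hv.2.2 (0, 0) rfl).2
  exact norm_pairWeight_mul_le (by positivity) fun hp => (hv.2.2 p hp).2

/-- Joint continuity in all three parameters serves the limits through regular triples; analyticity
in `X` alone serves the uniqueness argument. -/
theorem continuousAt_pairSum (hQ0 : Q ≠ 0) (hQ : ‖Q‖ < 1) (hX0 : X ≠ 0)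
    (hX : ∀ n : ℤ, n ≠ -1 → Q ^ n * X ≠ 1) (hw : ‖Q‖ ^ 2 < ‖w‖) (hw1 : ‖w‖ < 1)
    (ha : ‖Q‖ ^ 2 < ‖a‖) (ha1 : ‖a‖ < 1) :
    ContinuousAt (fun v : ℂ × ℂ × ℂ => pairSum Q v.1 v.2.1 v.2.2) (X, w, a) := by
  obtain ⟨C, ρ, h0, h1, h⟩ := exists_pairFrac_bound hQ0 hQ hX0 hX hw hw1 ha ha1
  have hC : 0 ≤ C := by
    simpa using (norm_nonneg _).trans (h.self_of_nhds.2.2 (0, 0) rfl).2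
  obtain ⟨U, hU, hUo, hxU⟩ := eventually_nhds_iff.1 h
  refine ContinuousOn.continuousAt (s := U) ?_ (hUo.mem_nhds hxU)
  refine continuousOn_tsum (fun p => ?_) (summable_pow_natAbs_mul h0 h1 C) fun p v hv =>
    norm_pairWeight_mul_le (by positivity) fun hp => ((hU v hv).2.2 p hp).2
  by_cases hp : sg p.1 = sg p.2
  · intro v hv
    obtain ⟨hw0, ha0, hv⟩ := hU v hv
    have c1 : ContinuousAt (fun v : ℂ × ℂ × ℂ => v.2.1 ^ p.1) v :=
      ContinuousAt.zpow₀ (by fun_prop) _ (Or.inl hw0)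
    have c2 : ContinuousAt (fun v : ℂ × ℂ × ℂ => v.2.2 ^ p.2) v :=
      ContinuousAt.zpow₀ (by fun_prop) _ (Or.inl ha0)
    exact (continuousAt_const.mul (((continuousAt_const.mul c1).mul c2).div (by fun_prop)
      (hv p hp).1)).continuousWithinAt
  · simp only [pairWeight, if_neg hp, zero_mul]
    exact continuousOn_const

theorem analyticAt_pairSum (hQ0 : Q ≠ 0) (hQ : ‖Q‖ < 1) (hX0 : X ≠ 0)
    (hX : ∀ n : ℤ, n ≠ -1 → Q ^ n * X ≠ 1) (hw : ‖Q‖ ^ 2 < ‖w‖) (hw1 : ‖w‖ < 1)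
    (ha : ‖Q‖ ^ 2 < ‖a‖) (ha1 : ‖a‖ < 1) :
    AnalyticAt ℂ (fun X => pairSum Q X w a) X := by
  obtain ⟨C, ρ, h0, h1, h⟩ := exists_pairFrac_bound hQ0 hQ hX0 hX hw hw1 ha ha1
  have hC : 0 ≤ C := by
    simpa using (norm_nonneg _).trans (h.self_of_nhds.2.2 (0, 0) rfl).2
  have hc : Tendsto (fun Y : ℂ => (Y, w, a)) (𝓝 X) (𝓝 (X, w, a)) :=
    Continuous.tendsto (by fun_prop) X
  obtain ⟨U, hU, hUo, hxU⟩ := eventually_nhds_iff.1 (hc.eventually h)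
  refine DifferentiableOn.analyticAt (s := U) ?_ (hUo.mem_nhds hxU)
  refine Complex.differentiableOn_tsum_of_summable_norm (summable_pow_natAbs_mul h0 h1 C)
    (fun p => ?_) hUo fun p v hv =>
      norm_pairWeight_mul_le (by positivity) fun hp => ((hU v hv).2.2 p hp).2
  by_cases hp : sg p.1 = sg p.2
  · refine DifferentiableOn.const_mul (DifferentiableOn.div (by fun_prop) (by fun_prop)
      fun v hv => ((hU v hv).2.2 p hp).1) _
  · simp only [pairWeight, if_neg hp, zero_mul]
    exact differentiableOn_const _

theorem summable_pairSum_zero (hQ0 : Q ≠ 0) (hQ : ‖Q‖ < 1) (hw : ‖Q‖ < ‖w‖) (hw1 : ‖w‖ < 1)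
    (ha : ‖Q‖ < ‖a‖) (ha1 : ‖a‖ < 1) :
    Summable fun p : ℤ × ℤ => pairWeight p * pairFrac Q 0 w a p := by
  have hQn : 0 < ‖Q‖ := norm_pos_iff.2 hQ0
  have hwn : 0 < ‖w‖ := hQn.trans hw
  have han : 0 < ‖a‖ := hQn.trans ha
  set ρ := max (max ‖w‖ ‖a‖) (max (‖Q‖ / ‖w‖) (‖Q‖ / ‖a‖)) with hρ
  have hρ1 : ρ < 1 := by
    simp only [hρ, max_lt_iff, div_lt_one hwn, div_lt_one han]; exact ⟨⟨hw1, ha1⟩, hw, ha⟩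
  have hρ0 : 0 ≤ ρ := by positivity
  refine (summable_pow_natAbs_mul hρ0 hρ1 ‖Q‖⁻¹).of_norm_bounded fun p => ?_
  refine norm_pairWeight_mul_le (by positivity) fun hp => ?_
  have h := zpow_mul_zpow_mul_zpow_le (k := 0) (ρ := ρ) hQn hQ.le hwn han (by simp [hρ])
    (by simp [hρ]) (by simp [hρ]) (by simp [hρ]) hp
  simpa [pairFrac] using h

/-- Kronecker's identity, double series to single series. -/
theorem pairSum_zero_eq (hQ0 : Q ≠ 0) (hQ : ‖Q‖ < 1) (hw : ‖Q‖ < ‖w‖) (hw1 : ‖w‖ < 1)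
    (ha : ‖Q‖ < ‖a‖) (ha1 : ‖a‖ < 1) : pairSum Q 0 w a = fracSum (fun n => w ^ n) Q a := by
  have hQn : 0 < ‖Q‖ := norm_pos_iff.2 hQ0
  rw [pairSum, (summable_pairSum_zero hQ0 hQ hw hw1 ha ha1).tsum_prod, fracSum]
  congr 1; ext s
  have h := (hasSum_geometric_sg (s := s) (u := Q ^ s * a) (fun hs => by
      rw [norm_mul, norm_zpow]
      exact mul_lt_one_of_nonneg_of_lt_one_right (zpow_le_one₀ hQn hQ.le hs) (norm_nonneg _) ha1)
    (fun hs => by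
      rw [norm_mul, norm_zpow]
      have h1 : ‖Q‖ ^ (-1 : ℤ) ≤ ‖Q‖ ^ s := zpow_le_zpow_right_of_le_one₀ hQn hQ.le (by omega)
      rw [zpow_neg_one] at h1
      calc 1 < ‖Q‖⁻¹ * ‖a‖ := by rw [← div_eq_inv_mul]; exact (one_lt_div hQn).2 ha
        _ ≤ _ := by gcongr)).mul_left ((sg s : ℂ) * w ^ s)
  -- Summing over `t` first is geometric with ratio `Q^s a` and produces `sg(s)`, which cancels the
  -- weight `sg(s)`.
  have hsq : (sg s : ℂ) * sg s = 1 := by unfold sg; split_ifs <;> simp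
  convert h.tsum_eq using 1
  · congr 1; ext t
    simp only [pairWeight, pairFrac, mul_zero, sub_zero, div_one]
    split_ifs
    · rw [mul_zpow, ← zpow_mul]; ring
    · simp
  · linear_combination -(w ^ s / (1 - Q ^ s * a)) * hsq

theorem tsum_prod_ite_left {f : ℤ × ℤ → ℂ} :
    ∑' p : ℤ × ℤ, (if p.1 = 0 then 1 else 0) * f p = ∑' t : ℤ, f (0, t) := by
  rw [← (Prod.mk_right_injective (0 : ℤ)).tsum_eq]
  · simp
  · rintro ⟨s, t⟩ h
    by_cases hs : s = 0
    · exact ⟨t, by simp [hs]⟩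
    · simp [hs] at h

theorem tsum_prod_ite_right {f : ℤ × ℤ → ℂ} :
    ∑' p : ℤ × ℤ, (if p.2 = 0 then 1 else 0) * f p = ∑' s : ℤ, f (s, 0) := by
  rw [← (Prod.mk_left_injective (0 : ℤ)).tsum_eq]
  · simp
  · rintro ⟨s, t⟩ h
    by_cases ht : t = 0
    · exact ⟨s, by simp [ht]⟩
    · simp [ht] at h

theorem summable_prod_ite_left {f : ℤ × ℤ → ℂ} (hf : Summable fun t : ℤ => f (0, t)) :
    Summable fun p : ℤ × ℤ => (if p.1 = 0 then 1 else 0) * f p := by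
  rw [← (Prod.mk_right_injective (0 : ℤ)).summable_iff]
  · simpa [Function.comp_def] using hf
  · rintro ⟨s, t⟩ h
    have hs : s ≠ 0 := fun hs => h ⟨t, by simp [hs]⟩
    simp [hs]

theorem summable_prod_ite_right {f : ℤ × ℤ → ℂ} (hf : Summable fun s : ℤ => f (s, 0)) :
    Summable fun p : ℤ × ℤ => (if p.2 = 0 then 1 else 0) * f p := by
  rw [← (Prod.mk_left_injective (0 : ℤ)).summable_iff]
  · simpa [Function.comp_def] using hf
  · rintro ⟨s, t⟩ h
    have ht : t ≠ 0 := fun ht => h ⟨s, by simp [ht]⟩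
    simp [ht]

theorem norm_sq_lt (hQ0 : Q ≠ 0) (hQ : ‖Q‖ < 1) : ‖Q‖ ^ 2 < ‖Q‖ := by
  have := norm_pos_iff.2 hQ0
  nlinarith

/-- Each term at `(QX, w, Qa)` is `w⁻¹` times the term at `(X, w, a)` with `s` raised by one.
Undoing the shift in the weight leaves the line `s = 0`. -/
theorem pairSum_shift_left (hQ0 : Q ≠ 0) (hQ : ‖Q‖ < 1) (hX0 : X ≠ 0)
    (hX : ∀ n : ℤ, Q ^ n * X ≠ 1) (hw : ‖Q‖ < ‖w‖) (hw1 : ‖w‖ < 1)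
    (ha : ‖Q‖ < ‖a‖) (ha1 : ‖a‖ < 1) :
    pairSum Q (Q * X) w (Q * a) = w⁻¹ * (pairSum Q X w a - fracSum (fun n => a ^ n) Q X) := by
  have hw0 : w ≠ 0 := norm_pos_iff.1 ((norm_nonneg _).trans_lt hw)
  have hQ2 := norm_sq_lt hQ0 hQ
  have hs := summable_pairSum hQ0 hQ hX0 (fun n _ => hX n) (hQ2.trans hw) hw1 (hQ2.trans ha) ha1
  have hk := summable_frac hQ0 hQ (summable_kronecker_coeff hQ0 ha ha1) hX0 fun n _ => hX n
  have hk' : Summable fun t : ℤ => pairFrac Q X w a (0, t) := by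
    simpa [pairFrac] using hk
  have hL : pairSum Q (Q * X) w (Q * a) =
      w⁻¹ * ∑' p : ℤ × ℤ, pairWeight (p.1 - 1, p.2) * pairFrac Q X w a p := by
    rw [← (Equiv.addRight ((1, 0) : ℤ × ℤ)).tsum_eq
      (fun p : ℤ × ℤ => pairWeight (p.1 - 1, p.2) * pairFrac Q X w a p), ← tsum_mul_left, pairSum]
    congr 1; ext ⟨s, t⟩
    simp only [Equiv.coe_addRight, Prod.mk_add_mk, add_zero, add_sub_cancel_right, pairFrac]
    rw [zpow_add_one₀ hw0, mul_zpow, show (s + 1) * t = s * t + t by ring, zpow_add₀ hQ0 (s * t) t,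
      show s + 1 + t = s + t + 1 by ring, zpow_add_one₀ hQ0, mul_assoc (Q ^ (s + t))]
    field_simp
  have hR : fracSum (fun n => a ^ n) Q X = ∑' t : ℤ, pairFrac Q X w a (0, t) := by
    simp [fracSum, pairFrac]
  rw [hL, hR, ← tsum_prod_ite_left (f := pairFrac Q X w a), pairSum,
    ← hs.tsum_sub (summable_prod_ite_left hk')]
  congr 2; ext ⟨s, t⟩
  rw [pairWeight_sub_left, sub_mul]

/-- With `u = Q^(s+t+1) X`, write `1/(1-u) = 1 + u/(1-u)`: the first part has no denominator and is
the sum at `X = 0`, the second is the sum at `(X, w, Qa)` with `t` raised by one, so the line `t =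
0` splits off. -/
theorem pairSum_shift_right (hQ0 : Q ≠ 0) (hQ : ‖Q‖ < 1) (hX0 : X ≠ 0)
    (hX : ∀ n : ℤ, Q ^ n * X ≠ 1) (hw : ‖Q‖ < ‖w‖) (hw1 : ‖w‖ < 1)
    (ha : ‖Q‖ < ‖a‖) (ha1 : ‖a‖ < 1) :
    pairSum Q (Q * X) w a =
      pairSum Q 0 w a + X / a * (pairSum Q X w (Q * a) - fracSum (fun n => w ^ n) Q X) := by
  have hw0 : w ≠ 0 := norm_pos_iff.1 ((norm_nonneg _).trans_lt hw)
  have ha0 : a ≠ 0 := norm_pos_iff.1 ((norm_nonneg _).trans_lt ha)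
  have hQn : 0 < ‖Q‖ := norm_pos_iff.2 hQ0
  have hQ2 := norm_sq_lt hQ0 hQ
  have hs := summable_pairSum hQ0 hQ hX0 (fun n _ => hX n) (hQ2.trans hw) hw1
    (a := Q * a) (by rw [norm_mul, pow_two]; gcongr) (by rw [norm_mul]; nlinarith)
  have hk := summable_frac hQ0 hQ (summable_kronecker_coeff hQ0 hw hw1) hX0 fun n _ => hX n
  have hk' : Summable fun s : ℤ => pairFrac Q X w (Q * a) (s, 0) := by
    simpa [pairFrac] using hk
  have hR : fracSum (fun n => w ^ n) Q X = ∑' s : ℤ, pairFrac Q X w (Q * a) (s, 0) := by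
    simp [fracSum, pairFrac]
  have hdiff : pairSum Q X w (Q * a) - fracSum (fun n => w ^ n) Q X =
      ∑' p : ℤ × ℤ, pairWeight (p.1, p.2 - 1) * pairFrac Q X w (Q * a) p := by
    rw [hR, ← tsum_prod_ite_right (f := pairFrac Q X w (Q * a)), pairSum,
      ← hs.tsum_sub (summable_prod_ite_right hk')]
    congr 1; ext ⟨s, t⟩
    rw [pairWeight_sub_right, sub_mul]
  have hsd : Summable fun p : ℤ × ℤ => pairWeight (p.1, p.2 - 1) * pairFrac Q X w (Q * a) p := by
    refine (hs.sub (summable_prod_ite_right hk')).congr fun p => ?_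
    rw [pairWeight_sub_right, sub_mul]
  have hsd' : Summable fun p : ℤ × ℤ => X / a * (pairWeight (p.1, p.2) *
      pairFrac Q X w (Q * a) (p + (0, 1))) := by
    refine (((Equiv.addRight ((0, 1) : ℤ × ℤ)).summable_iff.2 hsd).mul_left (X / a)).congr
      fun p => ?_
    simp
  rw [hdiff, ← (Equiv.addRight ((0, 1) : ℤ × ℤ)).tsum_eq
    (fun p : ℤ × ℤ => pairWeight (p.1, p.2 - 1) * pairFrac Q X w (Q * a) p), ← tsum_mul_left,
    pairSum, pairSum]
  simp only [Equiv.coe_addRight, Prod.fst_add, Prod.snd_add, add_zero, add_sub_cancel_right]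
  rw [← (summable_pairSum_zero hQ0 hQ hw hw1 ha ha1).tsum_add hsd']
  congr 1; ext ⟨s, t⟩
  have hne := hX (s + t + 1)
  rw [zpow_add_one₀ hQ0] at hne
  have hne' : 1 - Q ^ (s + t) * Q * X ≠ 0 := sub_ne_zero.2 hne.symm
  simp only [pairFrac, Prod.mk_add_mk, add_zero]
  rw [zpow_add_one₀ (mul_ne_zero hQ0 ha0), mul_zpow, show s * (t + 1) = s * t + s by ring,
    zpow_add₀ hQ0 (s * t) s, ← add_assoc s t 1, zpow_add_one₀ hQ0, ← mul_assoc (Q ^ (s + t)),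
    mul_zero, sub_zero]
  field_simp
  rw [zpow_add₀ hQ0]
  ring

end PairSum

/-- The standing assumptions `0 < |q| < 1`, `|q| < |y| < 1` and `|q| < |z| < 1`. -/
structure InAnnulus (q y z : ℂ) : Prop where
  q_ne : q ≠ 0
  q_lt : ‖q‖ < 1
  lt_y : ‖q‖ < ‖y‖
  y_lt : ‖y‖ < 1
  lt_z : ‖q‖ < ‖z‖
  z_lt : ‖z‖ < 1

/-- The points `x` at which no denominator depending on `x` alone vanishes. -/
def Generic (q x : ℂ) : Prop :=
  x ≠ 0 ∧ (∀ n : ℤ, (q ^ 2) ^ n * x ≠ 1) ∧ ∀ n : ℤ, (q ^ 4) ^ n * (x ^ 2 * q ^ 2) ≠ 1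

/-! ### Nonvanishing of the denominators, and the exceptional points `x`. -/

section NonVanishing

variable {q y z x : ℂ}

theorem InAnnulus.y_ne (h : InAnnulus q y z) : y ≠ 0 :=
  norm_pos_iff.1 ((norm_nonneg _).trans_lt h.lt_y)

theorem InAnnulus.z_ne (h : InAnnulus q y z) : z ≠ 0 :=
  norm_pos_iff.1 ((norm_nonneg _).trans_lt h.lt_z)

theorem InAnnulus.q2_ne (h : InAnnulus q y z) : q ^ 2 ≠ 0 := pow_ne_zero _ h.q_ne

theorem InAnnulus.q4_ne (h : InAnnulus q y z) : q ^ 4 ≠ 0 := pow_ne_zero _ h.q_ne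

theorem InAnnulus.q2_lt (h : InAnnulus q y z) : ‖q ^ 2‖ < 1 := norm_sq_lt_one h.q_lt

theorem InAnnulus.q4_lt (h : InAnnulus q y z) : ‖q ^ 4‖ < 1 := by
  rw [norm_pow]; exact pow_lt_one₀ (norm_nonneg _) h.q_lt (by norm_num)

theorem InAnnulus.y_avoid (h : InAnnulus q y z) (n : ℤ) : (q ^ 2) ^ n * y ≠ 1 := by
  refine zpow_mul_ne_one_of_norm h.q2_ne h.q2_lt ?_ h.y_lt n
  rw [norm_pow]; exact (norm_sq_lt h.q_ne h.q_lt).trans h.lt_y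

theorem InAnnulus.qz_avoid (h : InAnnulus q y z) (n : ℤ) : (q ^ 2) ^ n * (q * z) ≠ 1 := by
  have hq := norm_pos_iff.2 h.q_ne
  refine zpow_mul_ne_one_of_norm h.q2_ne h.q2_lt ?_ ?_ n
  · rw [norm_pow, norm_mul, pow_two]; exact mul_lt_mul_of_pos_left h.lt_z hq
  · rw [norm_mul]; nlinarith [h.q_lt, h.z_lt, norm_nonneg z]

theorem InAnnulus.z_div_avoid (h : InAnnulus q y z) (n : ℤ) : (q ^ 2) ^ n * (z / q) ≠ 1 := by
  have hq := h.q_ne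
  have := h.qz_avoid (n - 1)
  rw [zpow_sub_one₀ h.q2_ne] at this
  convert! this using 1
  field_simp

theorem InAnnulus.lt_wy (h : InAnnulus q y z) : ‖q ^ 4‖ < ‖q ^ 2 * y ^ 2‖ := by
  have hq := norm_pos_iff.2 h.q_ne
  rw [norm_pow, norm_mul, norm_pow, norm_pow, show ‖q‖ ^ 4 = ‖q‖ ^ 2 * ‖q‖ ^ 2 by ring]
  have := h.lt_y
  gcongr

theorem InAnnulus.wy_lt (h : InAnnulus q y z) : ‖q ^ 2 * y ^ 2‖ < 1 := by
  rw [← mul_pow, norm_pow, norm_mul]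
  refine pow_lt_one₀ (by positivity) ?_ two_ne_zero
  nlinarith [h.q_lt, h.y_lt, norm_nonneg y, norm_nonneg q]

theorem InAnnulus.lt_wz (h : InAnnulus q y z) : ‖q ^ 4‖ < ‖z ^ 2‖ := by
  have hq := norm_pos_iff.2 h.q_ne
  rw [norm_pow, norm_pow]
  calc ‖q‖ ^ 4 ≤ ‖q‖ ^ 2 := pow_le_pow_of_le_one hq.le h.q_lt.le (by norm_num)
    _ < _ := by have := h.lt_z; gcongr

theorem InAnnulus.wz_lt (h : InAnnulus q y z) : ‖z ^ 2‖ < 1 := by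
  rw [norm_pow]; exact pow_lt_one₀ (norm_nonneg _) h.z_lt two_ne_zero

theorem InAnnulus.wy_avoid (h : InAnnulus q y z) (n : ℤ) : (q ^ 4) ^ n * (q ^ 2 * y ^ 2) ≠ 1 :=
  zpow_mul_ne_one_of_norm h.q4_ne h.q4_lt h.lt_wy h.wy_lt n

theorem InAnnulus.wz_avoid (h : InAnnulus q y z) (n : ℤ) : (q ^ 4) ^ n * z ^ 2 ≠ 1 :=
  zpow_mul_ne_one_of_norm h.q4_ne h.q4_lt h.lt_wz h.wz_lt n

theorem InAnnulus.theta_y_ne (h : InAnnulus q y z) : theta y (q ^ 2) ≠ 0 :=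
  theta_ne_zero h.q2_ne h.q2_lt h.y_ne h.y_avoid

theorem InAnnulus.theta_qz_ne (h : InAnnulus q y z) : theta (q * z) (q ^ 2) ≠ 0 :=
  theta_ne_zero h.q2_ne h.q2_lt (mul_ne_zero h.q_ne h.z_ne) h.qz_avoid

theorem InAnnulus.theta_wy_ne (h : InAnnulus q y z) : theta (q ^ 2 * y ^ 2) (q ^ 4) ≠ 0 :=
  theta_ne_zero h.q4_ne h.q4_lt (mul_ne_zero h.q2_ne (pow_ne_zero _ h.y_ne)) h.wy_avoid

theorem InAnnulus.theta_wz_ne (h : InAnnulus q y z) : theta (z ^ 2) (q ^ 4) ≠ 0 :=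
  theta_ne_zero h.q4_ne h.q4_lt (pow_ne_zero _ h.z_ne) h.wz_avoid

theorem InAnnulus.J2_ne (h : InAnnulus q y z) : J q 2 ≠ 0 := qPoch_self_ne_zero h.q2_lt

theorem InAnnulus.J4_ne (h : InAnnulus q y z) : J q 4 ≠ 0 := qPoch_self_ne_zero h.q4_lt

theorem Generic.theta_ne (hx : Generic q x) (h : InAnnulus q y z) : theta x (q ^ 2) ≠ 0 :=
  theta_ne_zero h.q2_ne h.q2_lt hx.1 hx.2.1

theorem Generic.theta_wx_ne (hx : Generic q x) (h : InAnnulus q y z) :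
    theta (x ^ 2 * q ^ 2) (q ^ 4) ≠ 0 :=
  theta_ne_zero h.q4_ne h.q4_lt (mul_ne_zero (pow_ne_zero _ hx.1) h.q2_ne) hx.2.2

theorem eventually_generic (hq0 : q ≠ 0) (hq : ‖q‖ < 1) {p : ℂ} (hp : p ≠ 0) :
    ∀ᶠ x in 𝓝[≠] p, Generic q x := by
  have hq4 : ‖q ^ 4‖ < 1 := by
    rw [norm_pow]; exact pow_lt_one₀ (norm_nonneg _) hq (by norm_num)
  have ht : Tendsto (fun x : ℂ => x ^ 2 * q ^ 2) (𝓝[≠] p) (𝓝[≠] (p ^ 2 * q ^ 2)) := by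
    refine tendsto_nhdsWithin_iff.2 ⟨?_, ?_⟩
    · exact (Continuous.tendsto (by fun_prop) p).mono_left nhdsWithin_le_nhds
    · have hpp : p ≠ -p := fun h => hp (by linear_combination h / 2)
      filter_upwards [self_mem_nhdsWithin, mem_nhdsWithin_of_mem_nhds (isOpen_ne.mem_nhds hpp)]
        with x hx hx2 h
      have h1 : (x - p) * (x + p) = 0 := by
        have h2 : q ^ 2 * ((x - p) * (x + p)) = 0 := by
          rw [Set.mem_singleton_iff] at h; linear_combination h
        exact (mul_eq_zero.1 h2).resolve_left (pow_ne_zero _ hq0)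
      rcases mul_eq_zero.1 h1 with h3 | h3
      · exact hx (sub_eq_zero.1 h3)
      · exact hx2 (eq_neg_of_add_eq_zero_left h3)
  filter_upwards [eventually_ne_zero hp, eventually_zpow_mul_ne_one (pow_ne_zero 2 hq0)
    (norm_sq_lt_one hq) hp, ht.eventually (eventually_zpow_mul_ne_one (pow_ne_zero 4 hq0) hq4
    (mul_ne_zero (pow_ne_zero 2 hp) (pow_ne_zero 2 hq0)))] with x h1 h2 h3
  exact ⟨h1, h2, h3⟩

/-- The square root `e` stands for both `q` and `-q`, so the two orbits of odd exceptional points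
are treated together. -/
theorem generic_cases (hq0 : q ≠ 0) {p : ℂ} (hp : p ≠ 0) :
    (∃ n : ℤ, p = (q ^ 2) ^ n * 1) ∨ (∃ e : ℂ, e ^ 2 = q ^ 2 ∧ ∃ n : ℤ, p = (q ^ 2) ^ n * e) ∨
      Generic q p := by
  rcases zpow_mul_eq_one_or_forall (q ^ 2) p with h | h
  · exact Or.inl h
  · by_cases h2 : ∃ n : ℤ, (q ^ 4) ^ n * (p ^ 2 * q ^ 2) = 1
    · obtain ⟨n, hn⟩ := h2
      refine Or.inr (Or.inl ⟨(q ^ 2) ^ (n + 1) * p, ?_, -(n + 1), ?_⟩)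
      · have e1 : (q ^ 4) ^ n = ((q ^ 2) ^ n) ^ 2 := by
          rw [show q ^ 4 = q ^ 2 * q ^ 2 by ring, mul_zpow]; ring
        rw [e1] at hn
        rw [zpow_add_one₀ (pow_ne_zero 2 hq0)]
        linear_combination q ^ 2 * hn
      · rw [zpow_neg, inv_mul_cancel_left₀ (zpow_ne_zero _ (pow_ne_zero 2 hq0))]
    · exact Or.inr (Or.inr ⟨hp, h, fun n hn => h2 ⟨n, hn⟩⟩)

end NonVanishing

/-! ### Theta identities between the bases `q`, `q²` and `q⁴`. -/

section ThetaRelations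

variable {q y z x : ℂ}

theorem theta_sq_q4 (h : InAnnulus q y z) (x : ℂ) :
    theta (x ^ 2) (q ^ 4) = J q 4 / J q 2 ^ 2 * (theta x (q ^ 2) * theta (-x) (q ^ 2)) := by
  have h1 := theta_sq_mul h.q2_lt x
  rw [show (q ^ 2) ^ 2 = q ^ 4 by ring] at h1
  have h2 := h.J2_ne
  simp only [J] at *
  field_simp
  linear_combination h1

theorem theta_q2_q4 (h : InAnnulus q y z) : theta (q ^ 2) (q ^ 4) = J q 2 ^ 2 / J q 4 := by
  have h1 := theta_self_sq_mul h.q2_lt h.q2_ne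
  rw [show (q ^ 2) ^ 2 = q ^ 4 by ring] at h1
  have h2 := h.J4_ne
  simp only [J] at *
  field_simp
  exact h1

theorem theta_mul_q2 (h : InAnnulus q y z) (hx : x ≠ 0) :
    theta (q ^ 2 * x) (q ^ 2) = -x⁻¹ * theta x (q ^ 2) := theta_mul_left h.q2_ne h.q2_lt hx

theorem theta_mul_q4 (h : InAnnulus q y z) (hx : x ≠ 0) :
    theta (q ^ 4 * x) (q ^ 4) = -x⁻¹ * theta x (q ^ 4) := theta_mul_left h.q4_ne h.q4_lt hx

/-- The denominators of the theta quotient in `G`, in terms of theta functions to the bases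
`q²` and `q⁴`. -/
theorem theta_mul_theta_neg (h : InAnnulus q y z) (hx : x ≠ 0) :
    theta x q * theta (-(x * q)) (q ^ 2) =
      J q 1 / J q 4 * (theta x (q ^ 2) * theta (x ^ 2 * q ^ 2) (q ^ 4)) := by
  have h1 := theta_split_mul h.q_lt h.q_ne hx
  have h2 := theta_sq_q4 h (x * q)
  rw [mul_pow] at h2
  have h3 := h.J2_ne
  have h4 := h.J4_ne
  rw [h2]
  simp only [J, pow_one] at *
  field_simp
  rw [mul_comm q x] at h1
  linear_combination theta (-(x * q)) (q ^ 2) * h1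

theorem theta_mul_theta_neg' (h : InAnnulus q y z) (hx : x ≠ 0) :
    theta x q * theta (-x) (q ^ 2) =
      J q 1 / J q 4 * (theta (q * x) (q ^ 2) * theta (x ^ 2) (q ^ 4)) := by
  have h1 := theta_split_mul h.q_lt h.q_ne hx
  have h2 := theta_sq_q4 h x
  have h3 := h.J2_ne
  have h4 := h.J4_ne
  rw [mul_comm q x] at h1 ⊢
  rw [h2]
  simp only [J, pow_one] at *
  field_simp
  linear_combination theta (-x) (q ^ 2) * h1

end ThetaRelations

/-! ### Both sides rewritten over the bases `q²` and `q⁴`. -/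

section Parts

/-- The first Appell–Lerch term of `G`, with the theta function `j(-qyz; q²)` cancelled. -/
def partA (q y z x : ℂ) : ℂ :=
  J q 4 ^ 4 / J q 2 ^ 2 * z * theta (q * y * z) (q ^ 2) /
    (theta (q ^ 2 * y ^ 2) (q ^ 4) * theta (z ^ 2) (q ^ 4)) * lerch (q * y * z) x (q ^ 2)

/-- The second Appell–Lerch term of `G`, without the denominator `j(q²x²; q⁴)`. -/
def numB (q y z x : ℂ) : ℂ :=
  J q 4 ^ 4 / J q 2 ^ 2 * z * theta (q * z * x) (q ^ 2) / theta (z ^ 2) (q ^ 4) *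
    lerch (q * z * x) y (q ^ 2)

/-- The theta quotient of `G`, without the denominators `j(x; q²)` and `j(q²x²; q⁴)`. -/
def numC (q y z x : ℂ) : ℂ :=
  J q 2 ^ 3 * J q 4 ^ 3 * z * theta (q * y * z) (q ^ 2) /
    (theta (q ^ 2 * y ^ 2) (q ^ 4) * theta (z ^ 2) (q ^ 4) * theta y (q ^ 2) *
      theta (q * z) (q ^ 2)) * (theta (y * x) (q ^ 2) * theta (q * z * x) (q ^ 2))

/-- The third Appell–Lerch term of `G`, without the denominator `j(q²x²; q⁴)`. -/
def numD (q y z x : ℂ) : ℂ :=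
  J q 4 ^ 4 / J q 2 ^ 2 * q / (y * theta (q ^ 2 * y ^ 2) (q ^ 4)) / x * theta (y * x) (q ^ 2) *
    lerch (y * x) (z / q) (q ^ 2)

/-- The expression `G` with its removable factors cancelled. -/
def reducedG (q y z x : ℂ) : ℂ :=
  partA q y z x + (numB q y z x - numC q y z x / theta x (q ^ 2) - numD q y z x) /
    theta (x ^ 2 * q ^ 2) (q ^ 4)

/-- The function `F` in terms of `pairSum`. -/
def reducedF (q y z x : ℂ) : ℂ :=
  z * pairSum (q ^ 4) (x ^ 2 * q ^ 2) (q ^ 2 * y ^ 2) (z ^ 2) +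
    x * y * q * pairSum (q ^ 4) (x ^ 2 * q ^ 2) (q ^ 2 * y ^ 2) (q ^ 4 * z ^ 2)

variable {q y z x : ℂ}

theorem zpow_sq_mul_neg_ne_one {u : ℂ} (hq0 : q ≠ 0) (hu : ∀ n : ℤ, u ≠ -q ^ (2 * n)) (n : ℤ) :
    (q ^ 2) ^ n * -u ≠ 1 := by
  intro h
  apply hu (-n)
  have e : (q ^ 2) ^ n = q ^ (2 * n) := by rw [zpow_mul]; norm_cast
  rw [e] at h
  have hne : q ^ (2 * n) ≠ 0 := zpow_ne_zero _ hq0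
  rw [mul_neg, zpow_neg, eq_neg_iff_add_eq_zero]
  field_simp
  linear_combination -h

theorem zpow_sq_mul_neg_mul_ne_one {u : ℂ} (hq0 : q ≠ 0) (hu : ∀ n : ℤ, u ≠ -q ^ (2 * n + 1))
    (n : ℤ) : (q ^ 2) ^ n * -(q * u) ≠ 1 := by
  refine zpow_sq_mul_neg_ne_one hq0 (fun m hm => hu (m - 1) ?_) n
  apply mul_left_cancel₀ hq0
  rw [hm, mul_neg, ← zpow_one_add₀ hq0]
  congr 2; ring

/-- The factorisation `j(u²; q⁴) = (J₄/J₂²) j(u; q²) j(-u; q²)` lets each Appell–Lerch denominator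
cancel against the theta in front of it; regularity says exactly that the cancelled thetas are
nonzero. In the theta quotient the denominators pair up as `j(u; q) j(-uq; q²)` for `x`, `y` and
`j(z; q) j(-z; q²)` for `z`. -/
theorem G_eq_reducedG (h : InAnnulus q y z) (hx : Generic q x) (hr : (x, y, z) ∈ regularSet q) :
    G q x y z = reducedG q y z x := by
  have hq0 := h.q_ne
  have hy0 := h.y_ne
  have hz0 := h.z_ne
  have hx0 := hx.1
  have n1 : theta (-(q * y * z)) (q ^ 2) ≠ 0 :=
    theta_ne_zero h.q2_ne h.q2_lt (neg_ne_zero.2 (by positivity)) (by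
      simpa only [mul_assoc] using zpow_sq_mul_neg_mul_ne_one hq0 fun n => (hr n).2.1)
  have n2 : theta (-(q * x * z)) (q ^ 2) ≠ 0 :=
    theta_ne_zero h.q2_ne h.q2_lt (neg_ne_zero.2 (by positivity)) (by
      simpa only [mul_assoc] using zpow_sq_mul_neg_mul_ne_one hq0 fun n => (hr n).2.2.1)
  have n3 : theta (-(x * y)) (q ^ 2) ≠ 0 :=
    theta_ne_zero h.q2_ne h.q2_lt (neg_ne_zero.2 (by positivity))
      (zpow_sq_mul_neg_ne_one hq0 fun n => (hr n).2.2.2)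
  have a1 : -(q * x / (y * z)) * -(q * y * z) / q ^ 2 = x := by field_simp
  have a2 : -(q * y / (x * z)) * -(q * x * z) / q ^ 2 = y := by field_simp
  have a3 : -(q * z / (x * y)) * -(x * y) / q ^ 2 = z / q := by field_simp
  have t1 := theta_sq_q4 h (q * y * z)
  have t2 := theta_sq_q4 h (q * x * z)
  have t3 := theta_sq_q4 h (x * y)
  have d1 := theta_mul_theta_neg h hx0
  have d2 := theta_mul_theta_neg h hy0
  have d3 := theta_mul_theta_neg' h hz0
  have j1 : J q 1 ≠ 0 := by
    rw [J, pow_one]; exact qPoch_self_ne_zero h.q_lt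
  have j2 := h.J2_ne
  have j4 := h.J4_ne
  rw [mul_pow, mul_pow] at t1 t2
  rw [mul_pow] at t3
  rw [G, appellLerch_eq h.q2_ne, appellLerch_eq h.q2_ne, appellLerch_eq h.q2_ne, a1, a2, a3,
    neg_neg, neg_neg, neg_neg, t1, t2, t3, mul_assoc z (J q 1 ^ 3 * J q 2 ^ 3 / _),
    div_mul_div_comm (J q 1 ^ 3 * J q 2 ^ 3) _
    (theta (x * y) (q ^ 2) * theta (q * x * z) (q ^ 2) * theta (q * y * z) (q ^ 2)),
    show theta x q * theta y q * theta z q * (theta (-(x * q)) (q ^ 2) * theta (-(y * q)) (q ^ 2) *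
      theta (-z) (q ^ 2)) = theta x q * theta (-(x * q)) (q ^ 2) * (theta y q *
      theta (-(y * q)) (q ^ 2)) * (theta z q * theta (-z) (q ^ 2)) by ring, d1, d2, d3,
    reducedG, partA, numB, numC, numD, mul_comm (q ^ 2) (x ^ 2), mul_comm (y ^ 2) (q ^ 2),
    show q * z * x = q * x * z by ring, mul_comm y x]
  have u1 := hx.theta_ne h
  have u2 := hx.theta_wx_ne h
  have u3 := h.theta_y_ne
  have u4 := h.theta_wy_ne
  have u5 := h.theta_wz_ne
  have u6 := h.theta_qz_ne
  generalize theta (-(q * y * z)) (q ^ 2) = A1 at *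
  generalize theta (-(q * x * z)) (q ^ 2) = A2 at *
  generalize theta (-(x * y)) (q ^ 2) = A3 at *
  generalize theta (q * y * z) (q ^ 2) = B1 at *
  generalize theta (q * x * z) (q ^ 2) = B2 at *
  generalize theta (x * y) (q ^ 2) = B3 at *
  generalize theta (x ^ 2 * q ^ 2) (q ^ 4) = C1 at *
  generalize theta (q ^ 2 * y ^ 2) (q ^ 4) = C2 at *
  generalize theta (z ^ 2) (q ^ 4) = C3 at *
  generalize theta x (q ^ 2) = D1 at *
  generalize theta y (q ^ 2) = D2 at *
  generalize theta (q * z) (q ^ 2) = D3 at *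
  generalize J q 1 = j1' at *
  generalize J q 2 = j2' at *
  generalize J q 4 = j4' at *
  generalize lerch (q * y * z) x (q ^ 2) = l1 at *
  generalize lerch (q * x * z) y (q ^ 2) = l2 at *
  generalize lerch (x * y) (z / q) (q ^ 2) = l3 at *
  clear hr t1 t2 t3 d1 d2 d3 a1 a2 a3
  field_simp
  ring

theorem indicator_pairTerm₁ (hq0 : q ≠ 0) (x y z : ℂ) :
    pairIndex.indicator (pairTerm₁ q x y z) = fun p =>
      pairWeight p * pairFrac (q ^ 4) (x ^ 2 * q ^ 2) (q ^ 2 * y ^ 2) (z ^ 2) p := by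
  ext ⟨s, t⟩
  by_cases hp : sg s = sg t
  · have hmem : (s, t) ∈ pairIndex := hp
    rw [Set.indicator_of_mem hmem, pairTerm₁, pairWeight, if_pos hp, pairFrac]
    simp only [mul_zpow, ← zpow_natCast, ← zpow_mul]
    rw [show 4 * s * t + 2 * s = 4 * (s * t) + 2 * s by ring, zpow_add₀ hq0 (4 * (s * t)),
      show 4 * s + 4 * t + 2 = 4 * (s + t) + 2 by ring, zpow_add₀ hq0 _ 2]
    push_cast
    ring_nf
  · have hmem : (s, t) ∉ pairIndex := hp
    rw [Set.indicator_of_notMem hmem, pairWeight, if_neg hp, zero_mul]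

theorem indicator_pairTerm₂ (hq0 : q ≠ 0) (x y z : ℂ) :
    pairIndex.indicator (pairTerm₂ q x y z) = fun p =>
      pairWeight p * pairFrac (q ^ 4) (x ^ 2 * q ^ 2) (q ^ 2 * y ^ 2) (q ^ 4 * z ^ 2) p := by
  ext ⟨s, t⟩
  by_cases hp : sg s = sg t
  · have hmem : (s, t) ∈ pairIndex := hp
    rw [Set.indicator_of_mem hmem, pairTerm₂, pairWeight, if_pos hp, pairFrac]
    simp only [mul_zpow, ← zpow_natCast, ← zpow_mul]
    rw [show 4 * s * t + 2 * s + 4 * t = 4 * (s * t) + (2 * s + 4 * t) by ring,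
      zpow_add₀ hq0 (4 * (s * t)), zpow_add₀ hq0 (2 * s),
      show 4 * s + 4 * t + 2 = 4 * (s + t) + 2 by ring, zpow_add₀ hq0 _ 2]
    push_cast
    ring_nf
  · have hmem : (s, t) ∉ pairIndex := hp
    rw [Set.indicator_of_notMem hmem, pairWeight, if_neg hp, zero_mul]

theorem F_eq_reducedF (hq0 : q ≠ 0) (x y z : ℂ) : F q x y z = reducedF q y z x := by
  rw [F, tsum_subtype pairIndex (pairTerm₁ q x y z), tsum_subtype pairIndex (pairTerm₂ q x y z),
    indicator_pairTerm₁ hq0, indicator_pairTerm₂ hq0, reducedF, pairSum, pairSum]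

end Parts

/-! ### The common `q²`-difference equation in `x`. -/

variable {q y z x : ℂ}

theorem partA_mul (h : InAnnulus q y z) (hx : Generic q x) :
    partA q y z (q ^ 2 * x) = q * x / (y * z) * partA q y z x +
      J q 4 ^ 4 / J q 2 ^ 2 * z * theta (q * y * z) (q ^ 2) * theta (-(q * y * z)) (q ^ 2) /
        (theta (q ^ 2 * y ^ 2) (q ^ 4) * theta (z ^ 2) (q ^ 4)) := by
  have hq0 := h.q_ne
  have hy0 := h.y_ne
  have hz0 := h.z_ne
  rw [partA, partA, lerch_mul_right h.q2_ne h.q2_lt (by positivity) hx.1 hx.2.1]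
  generalize lerch (q * y * z) x (q ^ 2) = l1
  generalize theta (q * y * z) (q ^ 2) = B1
  generalize theta (-(q * y * z)) (q ^ 2) = B2
  generalize theta (q ^ 2 * y ^ 2) (q ^ 4) = C1
  generalize theta (z ^ 2) (q ^ 4) = C2
  have e : q ^ 2 * x / (q * y * z) = q * x / (y * z) := by field_simp
  rw [e]
  ring

theorem numB_mul (h : InAnnulus q y z) (hx0 : x ≠ 0) :
    numB q y z (q ^ 2 * x) = -(q * z * x)⁻¹ * y⁻¹ * (numB q y z x -
      J q 4 ^ 4 / J q 2 ^ 2 * z * theta (q * z * x) (q ^ 2) * theta (-(q * z * x)) (q ^ 2) /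
        theta (z ^ 2) (q ^ 4)) := by
  have hq0 := h.q_ne
  have hz0 := h.z_ne
  have e : q * z * (q ^ 2 * x) = q ^ 2 * (q * z * x) := by ring
  rw [numB, numB, e, theta_mul_q2 h (by positivity),
    lerch_mul_left h.q2_ne h.q2_lt (by positivity) h.y_ne h.y_avoid]
  ring

theorem numC_mul (h : InAnnulus q y z) (hx0 : x ≠ 0) :
    numC q y z (q ^ 2 * x) = (q * z * x)⁻¹ * (y * x)⁻¹ * numC q y z x := by
  have hq0 := h.q_ne
  have hy0 := h.y_ne
  have hz0 := h.z_ne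
  have e : q * z * (q ^ 2 * x) = q ^ 2 * (q * z * x) := by ring
  have e' : y * (q ^ 2 * x) = q ^ 2 * (y * x) := by ring
  rw [numC, numC, e, e', theta_mul_q2 h (by positivity), theta_mul_q2 h (by positivity)]
  ring

theorem numD_mul (h : InAnnulus q y z) (hx0 : x ≠ 0) :
    numD q y z (q ^ 2 * x) = -(y * x)⁻¹ * (q * z)⁻¹ * (numD q y z x -
      J q 4 ^ 4 / J q 2 ^ 2 * q / (y * theta (q ^ 2 * y ^ 2) (q ^ 4)) / x *
        theta (y * x) (q ^ 2) * theta (-(y * x)) (q ^ 2)) := by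
  have hq0 := h.q_ne
  have hy0 := h.y_ne
  have hz0 := h.z_ne
  have e' : y * (q ^ 2 * x) = q ^ 2 * (y * x) := by ring
  rw [numD, numD, e', theta_mul_q2 h (by positivity),
    lerch_mul_left h.q2_ne h.q2_lt (by positivity) (by positivity) h.z_div_avoid]
  generalize theta (q ^ 2 * y ^ 2) (q ^ 4) = C1
  generalize theta (y * x) (q ^ 2) = B1
  generalize theta (-(y * x)) (q ^ 2) = B2
  generalize lerch (y * x) (z / q) (q ^ 2) = l
  generalize J q 4 ^ 4 / J q 2 ^ 2 = κ
  rw [← div_div (κ * q) y C1]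
  field_simp

/-- When `wX` is a square, the numerator of Kronecker's quotient factors over base `q²`. This
matches the products of two thetas in the equations for the Appell–Lerch terms. -/
theorem fracSum_eq_q4 (h : InAnnulus q y z) {w X : ℂ} (hw : ‖q ^ 4‖ < ‖w‖) (hw1 : ‖w‖ < 1)
    (hX0 : X ≠ 0) (hX : ∀ n : ℤ, (q ^ 4) ^ n * X ≠ 1) {v : ℂ} (hv : v ^ 2 = w * X) :
    fracSum (fun n => w ^ n) (q ^ 4) X = J q 4 ^ 4 / J q 2 ^ 2 * theta v (q ^ 2) *
      theta (-v) (q ^ 2) / (theta X (q ^ 4) * theta w (q ^ 4)) := by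
  rw [fracSum_zpow_eq h.q4_ne h.q4_lt hw hw1 hX0 hX, ← hv, theta_sq_q4 h, J, J]
  ring

/-- The shifts interchange the two double sums up to factors, so their combination reproduces
itself. The three inhomogeneous terms are the `X = 0` sum and the two boundary lines. -/
theorem reducedF_mul (h : InAnnulus q y z) (hx : Generic q x) :
    reducedF q y z (q ^ 2 * x) = q * x / (y * z) * reducedF q y z x +
      J q 4 ^ 4 / J q 2 ^ 2 * z * theta (q * y * z) (q ^ 2) * theta (-(q * y * z)) (q ^ 2) /
        (theta (q ^ 2 * y ^ 2) (q ^ 4) * theta (z ^ 2) (q ^ 4)) +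
      (J q 4 ^ 4 / J q 2 ^ 2 * q ^ 2 / (y ^ 2 * z) *
        theta (y * x) (q ^ 2) * theta (-(y * x)) (q ^ 2) / theta (q ^ 2 * y ^ 2) (q ^ 4) -
      J q 4 ^ 4 / J q 2 ^ 2 * (q * x / y) * theta (q * z * x) (q ^ 2) *
        theta (-(q * z * x)) (q ^ 2) / theta (z ^ 2) (q ^ 4)) / theta (x ^ 2 * q ^ 2) (q ^ 4) := by
  have hq0 := h.q_ne
  have hy0 := h.y_ne
  have hz0 := h.z_ne
  have hx0 := hx.1
  have hX0 : x ^ 2 * q ^ 2 ≠ 0 := by positivity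
  have e : (q ^ 2 * x) ^ 2 * q ^ 2 = q ^ 4 * (x ^ 2 * q ^ 2) := by ring
  have k1 := fracSum_eq_q4 h h.lt_wy h.wy_lt (pow_ne_zero 2 hz0) h.wz_avoid (v := q * y * z)
    (by ring)
  have k2 := fracSum_eq_q4 h h.lt_wz h.wz_lt hX0 hx.2.2 (v := q * z * x) (by ring)
  have k3 := fracSum_zpow_eq h.q4_ne h.q4_lt h.lt_wy h.wy_lt hX0 hx.2.2
  have e3 : q ^ 2 * y ^ 2 * (x ^ 2 * q ^ 2) = q ^ 4 * (y * x) ^ 2 := by ring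
  rw [e3, theta_mul_q4 h (by positivity), theta_sq_q4 h] at k3
  rw [reducedF, reducedF, e,
    pairSum_shift_left h.q4_ne h.q4_lt hX0 hx.2.2 h.lt_wy h.wy_lt h.lt_wz h.wz_lt,
    pairSum_shift_right h.q4_ne h.q4_lt hX0 hx.2.2 h.lt_wy h.wy_lt h.lt_wz h.wz_lt,
    pairSum_zero_eq h.q4_ne h.q4_lt h.lt_wy h.wy_lt h.lt_wz h.wz_lt, k1, k2, k3]
  have u2 := hx.theta_wx_ne h
  have u4 := h.theta_wy_ne
  have u5 := h.theta_wz_ne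
  have j2 := h.J2_ne
  simp only [← show J q 4 = qPoch (q ^ 4) (q ^ 4) from rfl]
  generalize theta (x ^ 2 * q ^ 2) (q ^ 4) = C1 at *
  generalize theta (q ^ 2 * y ^ 2) (q ^ 4) = C2 at *
  generalize theta (z ^ 2) (q ^ 4) = C3 at *
  generalize pairSum (q ^ 4) (x ^ 2 * q ^ 2) (q ^ 2 * y ^ 2) (z ^ 2) = P1
  generalize pairSum (q ^ 4) (x ^ 2 * q ^ 2) (q ^ 2 * y ^ 2) (q ^ 4 * z ^ 2) = P2
  generalize theta (q * y * z) (q ^ 2) = B1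
  generalize theta (-(q * y * z)) (q ^ 2) = B1'
  generalize theta (q * z * x) (q ^ 2) = B2
  generalize theta (-(q * z * x)) (q ^ 2) = B2'
  generalize theta (y * x) (q ^ 2) = B3
  generalize theta (-(y * x)) (q ^ 2) = B3'
  generalize J q 4 = j4 at *
  generalize J q 2 = j2 at *
  clear k1 k2 k3
  field_simp
  ring

/-- The theta quotient satisfies the homogeneous equation; the inhomogeneous terms come one from
each Appell–Lerch term and coincide with those of `reducedF`. -/
theorem reducedG_mul (h : InAnnulus q y z) (hx : Generic q x) :
    reducedG q y z (q ^ 2 * x) = q * x / (y * z) * reducedG q y z x +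
      J q 4 ^ 4 / J q 2 ^ 2 * z * theta (q * y * z) (q ^ 2) * theta (-(q * y * z)) (q ^ 2) /
        (theta (q ^ 2 * y ^ 2) (q ^ 4) * theta (z ^ 2) (q ^ 4)) +
      (J q 4 ^ 4 / J q 2 ^ 2 * q ^ 2 / (y ^ 2 * z) *
        theta (y * x) (q ^ 2) * theta (-(y * x)) (q ^ 2) / theta (q ^ 2 * y ^ 2) (q ^ 4) -
      J q 4 ^ 4 / J q 2 ^ 2 * (q * x / y) * theta (q * z * x) (q ^ 2) *
        theta (-(q * z * x)) (q ^ 2) / theta (z ^ 2) (q ^ 4)) / theta (x ^ 2 * q ^ 2) (q ^ 4) := by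
  have hq0 := h.q_ne
  have hy0 := h.y_ne
  have hz0 := h.z_ne
  have hx0 := hx.1
  have e : (q ^ 2 * x) ^ 2 * q ^ 2 = q ^ 4 * (x ^ 2 * q ^ 2) := by ring
  rw [reducedG, reducedG, partA_mul h hx, numB_mul h hx0, numC_mul h hx0, numD_mul h hx0,
    theta_mul_q2 h hx0, e, theta_mul_q4 h (by positivity)]
  have u1 := hx.theta_ne h
  have u2 := hx.theta_wx_ne h
  have u4 := h.theta_wy_ne
  have u5 := h.theta_wz_ne
  generalize theta x (q ^ 2) = D1 at *
  generalize theta (x ^ 2 * q ^ 2) (q ^ 4) = C1 at *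
  generalize theta (q ^ 2 * y ^ 2) (q ^ 4) = C2 at *
  generalize theta (z ^ 2) (q ^ 4) = C3 at *
  generalize theta (q * y * z) (q ^ 2) = B1
  generalize theta (-(q * y * z)) (q ^ 2) = B1'
  generalize theta (q * z * x) (q ^ 2) = B2
  generalize theta (-(q * z * x)) (q ^ 2) = B2'
  generalize theta (y * x) (q ^ 2) = B3
  generalize theta (-(y * x)) (q ^ 2) = B3'
  generalize J q 4 ^ 4 / J q 2 ^ 2 = κ
  generalize partA q y z x = a
  generalize numB q y z x = b
  generalize numC q y z x = c
  generalize numD q y z x = d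
  field_simp
  ring

variable {q y z : ℂ}

/-- This is `lerch_add_lerch` for base `q²` with `b = z/q`: at `e = ±q` the two remaining
Appell–Lerch series have their parameters interchanged. The common denominator `j(q²x²; q⁴)`
vanishes there, so this removes the poles of `G`. -/
theorem numB_sub_numC_sub_numD_eq_zero (h : InAnnulus q y z) {e : ℂ} (he : e ^ 2 = q ^ 2) :
    numB q y z e - numC q y z e / theta e (q ^ 2) - numD q y z e = 0 := by
  have hq0 := h.q_ne
  have hy0 := h.y_ne
  have he0 : e ≠ 0 := fun h0 => h.q2_ne (by simp [← he, h0])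
  obtain ⟨b, rfl⟩ : ∃ b, z = q * b := ⟨z / q, by field_simp⟩
  have hb0 : b ≠ 0 := fun h0 => h.z_ne (by simp [h0])
  have hdiv : q * b / q = b := by field_simp
  have hb := h.z_div_avoid
  rw [hdiv] at hb
  have hV := lerch_add_lerch h.q2_ne h.q2_lt he hb0 hb hy0 h.y_avoid
  rw [← show J q 2 = qPoch (q ^ 2) (q ^ 2) from rfl] at hV
  have hE := theta_sq_q4 h e
  rw [he, theta_q2_q4 h] at hE
  have e1 : q * (q * b) * e = q ^ 2 * (e * b) := by ring
  have e2 : q * y * (q * b) = q ^ 2 * (b * y) := by ring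
  have e3 : q * (q * b) = q ^ 2 * b := by ring
  have e4 : (q * b) ^ 2 = (e * b) ^ 2 := by rw [mul_pow, mul_pow, he]
  have e5 : q ^ 2 * y ^ 2 = (e * y) ^ 2 := by rw [mul_pow, he]
  have u4 := h.theta_wy_ne
  have u5 := h.theta_wz_ne
  have j2 := h.J2_ne
  have j4 := h.J4_ne
  have u3 := h.theta_y_ne
  have u6 := theta_ne_zero h.q2_ne h.q2_lt hb0 hb
  rw [e5, theta_sq_q4 h] at u4
  rw [e4, theta_sq_q4 h] at u5
  rw [numB, numC, numD, e1, e2, e3, e4, e5, hdiv, mul_comm y e, theta_mul_q2 h (by positivity),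
    theta_mul_q2 h (by positivity), theta_mul_q2 h (by positivity),
    lerch_mul_left h.q2_ne h.q2_lt (by positivity) h.y_ne h.y_avoid, theta_sq_q4 h, theta_sq_q4 h]
  have hEne : theta e (q ^ 2) * theta (-e) (q ^ 2) ≠ 0 := by
    intro h0
    rw [h0, mul_zero] at hE
    exact div_ne_zero (pow_ne_zero 2 j2) j4 hE
  generalize theta (e * y) (q ^ 2) = Tey at *
  generalize theta (-(e * y)) (q ^ 2) = Tney at *
  generalize theta (e * b) (q ^ 2) = Teb at *
  generalize theta (-(e * b)) (q ^ 2) = Tneb at *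
  generalize theta (b * y) (q ^ 2) = Tby at *
  generalize theta e (q ^ 2) = Te at *
  generalize theta (-e) (q ^ 2) = Tne at *
  generalize theta y (q ^ 2) = Ty at *
  generalize theta b (q ^ 2) = Tb at *
  generalize lerch (e * b) y (q ^ 2) = l1 at *
  generalize lerch (e * y) b (q ^ 2) = l2 at *
  generalize J q 2 = j at *
  generalize J q 4 = k at *
  have v1 : Tey ≠ 0 := fun h0 => u4 (by simp [h0])
  have v2 : Tney ≠ 0 := fun h0 => u4 (by simp [h0])
  have v3 : Teb ≠ 0 := fun h0 => u5 (by simp [h0])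
  have v4 : Tneb ≠ 0 := fun h0 => u5 (by simp [h0])
  have v5 : Te ≠ 0 := fun h0 => hEne (by simp [h0])
  have v6 : Tne ≠ 0 := fun h0 => hEne (by simp [h0])
  -- From `e² = q²`: `j(e; q²) j(-e; q²)` is a multiple of `j(q²; q⁴) = J₂²/J₄`. Together with the
  -- symmetric relation for `l1`, this leaves a rational identity.
  have hTe : Te = j ^ 4 / (k ^ 2 * Tne) := by
    field_simp at hE ⊢
    linear_combination -hE
  have hl1 : l1 = Tneb + (j ^ 3 * Tne * Tby / (Ty * Tb) - Tneb * l2) / Tney := by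
    field_simp at hV ⊢
    linear_combination hV
  rw [hTe, hl1]
  clear hV hE hTe hl1 u4 u5 hEne v5 e1 e2 e3 e4 e5 hb hdiv h
  field_simp
  ring

/-! ### Analyticity of both sides in `x`. -/

section Analyticity

variable {p : ℂ}

theorem analyticAt_numB (h : InAnnulus q y z) (hp : p ≠ 0) :
    AnalyticAt ℂ (numB q y z) p := by
  have hqz := mul_ne_zero h.q_ne h.z_ne
  exact ((analyticAt_const.mul (analyticAt_theta_const_mul h.q2_lt hqz hp)).div analyticAt_const
    h.theta_wz_ne).mul
    (analyticAt_lerch_const_mul_left h.q2_ne h.q2_lt hqz hp h.y_ne h.y_avoid)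

theorem analyticAt_numC (h : InAnnulus q y z) (hp : p ≠ 0) :
    AnalyticAt ℂ (numC q y z) p :=
  analyticAt_const.mul ((analyticAt_theta_const_mul h.q2_lt h.y_ne hp).mul
    (analyticAt_theta_const_mul h.q2_lt (mul_ne_zero h.q_ne h.z_ne) hp))

theorem analyticAt_numD (h : InAnnulus q y z) (hp : p ≠ 0) :
    AnalyticAt ℂ (numD q y z) p :=
  ((analyticAt_const.div analyticAt_id hp).mul (analyticAt_theta_const_mul h.q2_lt h.y_ne hp)).mul
    (analyticAt_lerch_const_mul_left h.q2_ne h.q2_lt h.y_ne hp (div_ne_zero h.z_ne h.q_ne)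
      h.z_div_avoid)

theorem analyticAt_partA (h : InAnnulus q y z) (hp : p ≠ 0)
    (hp1 : ∀ n : ℤ, (q ^ 2) ^ n * p ≠ 1) : AnalyticAt ℂ (partA q y z) p :=
  analyticAt_const.mul (analyticAt_lerch_right h.q2_ne h.q2_lt
    (mul_ne_zero (mul_ne_zero h.q_ne h.y_ne) h.z_ne) hp hp1)

theorem analyticAt_sq_mul (c : ℂ) : AnalyticAt ℂ (fun x : ℂ => x ^ 2 * c) p :=
  (analyticAt_id.pow 2).mul analyticAt_const

theorem analyticAt_theta_sq_mul (h : InAnnulus q y z) (hp : p ≠ 0) :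
    AnalyticAt ℂ (fun x => theta (x ^ 2 * q ^ 2) (q ^ 4)) p :=
  AnalyticAt.fun_comp (g := fun x => theta x (q ^ 4)) (f := fun x => x ^ 2 * q ^ 2)
    (analyticAt_theta h.q4_lt (mul_ne_zero (pow_ne_zero 2 hp) h.q2_ne)) (analyticAt_sq_mul _)

theorem InAnnulus.lt_wz' (h : InAnnulus q y z) : ‖q ^ 4‖ ^ 2 < ‖q ^ 4 * z ^ 2‖ := by
  have := norm_pos_iff.2 h.q4_ne
  rw [norm_mul, pow_two]; exact mul_lt_mul_of_pos_left h.lt_wz this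

theorem InAnnulus.wz_lt' (h : InAnnulus q y z) : ‖q ^ 4 * z ^ 2‖ < 1 := by
  rw [norm_mul]
  exact mul_lt_one_of_nonneg_of_lt_one_left (norm_nonneg _) h.q4_lt h.wz_lt.le

theorem InAnnulus.sq_lt (h : InAnnulus q y z) : ‖q ^ 4‖ ^ 2 < ‖q ^ 4‖ := norm_sq_lt h.q4_ne h.q4_lt

/-- Allowing the exponent `-1` to meet the pole condition covers `p = ±q`, where `p²q² = q⁴`. -/
theorem analyticAt_reducedF (h : InAnnulus q y z) (hp : p ≠ 0)
    (hp1 : ∀ n : ℤ, n ≠ -1 → (q ^ 4) ^ n * (p ^ 2 * q ^ 2) ≠ 1) :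
    AnalyticAt ℂ (reducedF q y z) p := by
  have hX0 : p ^ 2 * q ^ 2 ≠ 0 := mul_ne_zero (pow_ne_zero 2 hp) h.q2_ne
  have hw := h.sq_lt.trans h.lt_wy
  have h1 := analyticAt_pairSum h.q4_ne h.q4_lt hX0 hp1 hw h.wy_lt (h.sq_lt.trans h.lt_wz) h.wz_lt
  have h2 := analyticAt_pairSum h.q4_ne h.q4_lt hX0 hp1 hw h.wy_lt h.lt_wz' h.wz_lt'
  have c1 : AnalyticAt ℂ (fun x => pairSum (q ^ 4) (x ^ 2 * q ^ 2) (q ^ 2 * y ^ 2) (z ^ 2)) p :=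
    AnalyticAt.fun_comp (g := fun X => pairSum (q ^ 4) X (q ^ 2 * y ^ 2) (z ^ 2))
      (f := fun x => x ^ 2 * q ^ 2) h1 (analyticAt_sq_mul _)
  have c2 : AnalyticAt ℂ (fun x => pairSum (q ^ 4) (x ^ 2 * q ^ 2) (q ^ 2 * y ^ 2)
      (q ^ 4 * z ^ 2)) p :=
    AnalyticAt.fun_comp (g := fun X => pairSum (q ^ 4) X (q ^ 2 * y ^ 2) (q ^ 4 * z ^ 2))
      (f := fun x => x ^ 2 * q ^ 2) h2 (analyticAt_sq_mul _)
  have c3 : AnalyticAt ℂ (fun x : ℂ => x * y * q) p :=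
    (analyticAt_id.mul analyticAt_const).mul analyticAt_const
  have c4 : AnalyticAt ℂ (fun _ : ℂ => z) p := analyticAt_const
  have c5 := (c4.mul c1).add (c3.mul c2)
  exact c5

end Analyticity

/-! ### Removal of the poles and the identity `F = G`. -/

section MainIdentity

theorem analyticAt_difference (h : InAnnulus q y z) {p : ℂ} (hp : Generic q p) :
    AnalyticAt ℂ (fun x => reducedF q y z x - reducedG q y z x) p := by
  refine (analyticAt_reducedF h hp.1 fun n _ => hp.2.2 n).sub
    ((analyticAt_partA h hp.1 hp.2.1).add ?_)
  exact (((analyticAt_numB h hp.1).sub ((analyticAt_numC h hp.1).div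
    (analyticAt_theta h.q2_lt hp.1) (hp.theta_ne h))).sub (analyticAt_numD h hp.1)).div
    (analyticAt_theta_sq_mul h hp.1) (hp.theta_wx_ne h)

theorem eventually_difference_mul (h : InAnnulus q y z) {p : ℂ} (hp : p ≠ 0) :
    ∀ᶠ x in 𝓝[≠] p, reducedF q y z (q ^ 2 * x) - reducedG q y z (q ^ 2 * x) =
      q / (y * z) * x * (reducedF q y z x - reducedG q y z x) := by
  filter_upwards [eventually_generic h.q_ne h.q_lt hp] with x hx
  rw [reducedF_mul h hx, reducedG_mul h hx]
  ring

theorem zpow_q4_mul_q2_ne_one (h : InAnnulus q y z) (n : ℤ) : (q ^ 4) ^ n * q ^ 2 ≠ 1 := by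
  have hq := norm_pos_iff.2 h.q_ne
  refine zpow_mul_ne_one_of_norm h.q4_ne h.q4_lt ?_ h.q2_lt n
  rw [norm_pow, norm_pow]
  exact pow_lt_pow_right_of_lt_one₀ hq h.q_lt (by norm_num)

/-- At `x = 1` only the first Appell–Lerch term and the theta quotient are singular, both with a
simple pole; `hk` is the combined coefficient of `1/(1-x)` in the difference, and it vanishes at
`1`. -/
theorem removable_difference_one (h : InAnnulus q y z) :
    Removable (fun x => reducedF q y z x - reducedG q y z x) 1 := by
  have hX : ∀ n : ℤ, (q ^ 4) ^ n * ((1 : ℂ) ^ 2 * q ^ 2) ≠ 1 := fun n => by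
    rw [one_pow, one_mul]; exact zpow_q4_mul_q2_ne_one h n
  have hF := analyticAt_reducedF h one_ne_zero fun n _ => hX n
  have hT := analyticAt_theta_sq_mul h one_ne_zero
  have hT1 : theta ((1 : ℂ) ^ 2 * q ^ 2) (q ^ 4) = J q 2 ^ 2 / J q 4 := by
    rw [one_pow, one_mul, theta_q2_q4 h]
  have hT0 : theta ((1 : ℂ) ^ 2 * q ^ 2) (q ^ 4) ≠ 0 := by
    rw [hT1]; exact div_ne_zero (pow_ne_zero 2 h.J2_ne) h.J4_ne
  have hBD : AnalyticAt ℂ (fun x => (numB q y z x - numD q y z x) /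
      theta (x ^ 2 * q ^ 2) (q ^ 4)) 1 :=
    ((analyticAt_numB h one_ne_zero).sub (analyticAt_numD h one_ne_zero)).div hT hT0
  obtain ⟨g, hg, hl⟩ := lerch_near_one h.q2_ne h.q2_lt (X := q * y * z)
    (mul_ne_zero (mul_ne_zero h.q_ne h.y_ne) h.z_ne)
  set κ : ℂ := J q 4 ^ 4 / J q 2 ^ 2 * z * theta (q * y * z) (q ^ 2) /
    (theta (q ^ 2 * y ^ 2) (q ^ 4) * theta (z ^ 2) (q ^ 4)) with hκ
  have hk : AnalyticAt ℂ (fun x => numC q y z x / (thetaReg x (q ^ 2) *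
      theta (x ^ 2 * q ^ 2) (q ^ 4)) - κ) 1 :=
    ((analyticAt_numC h one_ne_zero).div ((analyticAt_thetaReg h.q2_lt one_ne_zero).mul hT)
      (mul_ne_zero (thetaReg_one_ne_zero h.q2_lt) hT0)).sub analyticAt_const
  refine (((hF.sub hBD).sub (analyticAt_const.mul hg) (g := fun x => κ * g x)).removable.add
    (removable_div_one_sub hk ?_)).congr ?_
  · rw [hT1, thetaReg_one, ← show J q 2 = qPoch (q ^ 2) (q ^ 2) from rfl, hκ, numC, mul_one, mul_one]
    have j2 := h.J2_ne
    have j4 := h.J4_ne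
    have u3 := h.theta_y_ne
    have u4 := h.theta_wy_ne
    have u5 := h.theta_wz_ne
    have u6 := h.theta_qz_ne
    generalize theta (q ^ 2 * y ^ 2) (q ^ 4) = C2 at *
    generalize theta (z ^ 2) (q ^ 4) = C3 at *
    generalize theta y (q ^ 2) = D2 at *
    generalize theta (q * z) (q ^ 2) = D3 at *
    field_simp
    ring
  · filter_upwards [hl] with x hx
    simp only [Pi.sub_apply]
    rw [reducedG, partA, hx, theta_eq_one_sub_mul h.q2_lt x, ← hκ, sub_div (numC q y z x / _),
      div_div (numC q y z x), show thetaReg x (q ^ 2) * theta (x ^ 2 * q ^ 2) (q ^ 4) * (1 - x) =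
      (1 - x) * thetaReg x (q ^ 2) * theta (x ^ 2 * q ^ 2) (q ^ 4) by ring, sub_div _ (numD q y z x),
      sub_div (numB q y z x), sub_div (numB q y z x), div_div (numC q y z x)]
    ring

/-- Here `F` and the first Appell–Lerch term are regular, and the simple zero of `j(q²x²; q⁴)` is
met by a zero of the numerator. -/
theorem removable_difference_sqrt (h : InAnnulus q y z) {e : ℂ} (he : e ^ 2 = q ^ 2) :
    Removable (fun x => reducedF q y z x - reducedG q y z x) e := by
  have hq0 := h.q_ne
  have hqn := norm_pos_iff.2 hq0
  have he0 : e ≠ 0 := fun h0 => h.q2_ne (by simp [← he, h0])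
  have hen : ‖e‖ = ‖q‖ := by
    have : ‖e‖ ^ 2 = ‖q‖ ^ 2 := by rw [← norm_pow, he, norm_pow]
    exact (pow_left_inj₀ (norm_nonneg _) (norm_nonneg _) two_ne_zero).1 this
  have heQ : ∀ n : ℤ, (q ^ 2) ^ n * e ≠ 1 := by
    refine zpow_mul_ne_one_of_norm h.q2_ne h.q2_lt ?_ (by rw [hen]; exact h.q_lt)
    rw [hen, norm_pow]; exact norm_sq_lt h.q_ne h.q_lt
  have hX : ∀ n : ℤ, n ≠ -1 → (q ^ 4) ^ n * (e ^ 2 * q ^ 2) ≠ 1 := by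
    intro n hn h1
    rw [he, ← pow_add, ← zpow_add_one₀ h.q4_ne] at h1
    have h2 : ‖q ^ 4‖ ^ (n + 1) = 1 := by rw [← norm_zpow, h1, norm_one]
    rw [zpow_eq_one_iff_right₀ (norm_nonneg _) h.q4_lt.ne] at h2
    omega
  have hθe := theta_ne_zero h.q2_ne h.q2_lt he0 heQ
  have hN : AnalyticAt ℂ (fun x => numB q y z x - numC q y z x / theta x (q ^ 2) - numD q y z x) e :=
    ((analyticAt_numB h he0).sub ((analyticAt_numC h he0).div
      (analyticAt_theta h.q2_lt he0) hθe)).sub (analyticAt_numD h he0)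
  have hR : AnalyticAt ℂ (fun x => (x + e) / x ^ 2 * thetaReg (x ^ 2 * (q ^ 2)⁻¹) (q ^ 4)) e := by
    refine ((analyticAt_id.add analyticAt_const).div (analyticAt_id.pow 2) (pow_ne_zero 2 he0)).mul
      (AnalyticAt.fun_comp (g := fun x => thetaReg x (q ^ 4)) (f := fun x => x ^ 2 * (q ^ 2)⁻¹)
        (analyticAt_thetaReg h.q4_lt ?_) (analyticAt_sq_mul _))
    exact mul_ne_zero (pow_ne_zero 2 he0) (inv_ne_zero h.q2_ne)
  have hR0 : (e + e) / e ^ 2 * thetaReg (e ^ 2 * (q ^ 2)⁻¹) (q ^ 4) ≠ 0 := by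
    rw [he, mul_inv_cancel₀ h.q2_ne]
    refine mul_ne_zero (div_ne_zero ?_ h.q2_ne) (thetaReg_one_ne_zero h.q4_lt)
    rw [← two_mul]; exact mul_ne_zero two_ne_zero he0
  refine ((((analyticAt_reducedF h he0 hX).sub (analyticAt_partA h he0 heQ)).removable).sub
    ((removable_div_sub hN (numB_sub_numC_sub_numD_eq_zero h he)).mul
      (hR.inv hR0).removable)).congr ?_
  filter_upwards [eventually_ne_zero he0] with x hx0
  -- One quasi-period moves the argument to `x²/q²`, near `1`; then `1 - x²/q²` yields the linear
  -- factor `x - e`, with a cofactor nonzero at `e`.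
  have hθ : theta (x ^ 2 * q ^ 2) (q ^ 4) =
      (x - e) * ((x + e) / x ^ 2 * thetaReg (x ^ 2 * (q ^ 2)⁻¹) (q ^ 4)) := by
    have e1 : x ^ 2 * q ^ 2 = q ^ 4 * (x ^ 2 * (q ^ 2)⁻¹) := by field_simp
    rw [e1, theta_mul_q4 h (by positivity), theta_eq_one_sub_mul h.q4_lt]
    generalize thetaReg (x ^ 2 * (q ^ 2)⁻¹) (q ^ 4) = R
    field_simp
    linear_combination R * he
  simp only [Pi.sub_apply, Pi.inv_apply]
  rw [reducedG, hθ, ← div_div, div_eq_mul_inv (_ / (x - e))]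
  ring

theorem removable_difference (h : InAnnulus q y z) {p : ℂ} (hp : p ≠ 0) :
    Removable (fun x => reducedF q y z x - reducedG q y z x) p := by
  have hc : q / (y * z) ≠ 0 := div_ne_zero h.q_ne (mul_ne_zero h.y_ne h.z_ne)
  have hiff : ∀ {p : ℂ}, p ≠ 0 → ∀ n : ℤ,
      (Removable (fun x => reducedF q y z x - reducedG q y z x) ((q ^ 2) ^ n * p) ↔
        Removable (fun x => reducedF q y z x - reducedG q y z x) p) := fun {p} hp n =>
    removable_zpow_mul_iff (μ := fun x => q / (y * z) * x) h.q2_ne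
      (fun _ _ => analyticAt_const.mul analyticAt_id) (fun _ h0 => mul_ne_zero hc h0)
      (fun _ h0 => eventually_difference_mul h h0) hp n
  rcases generic_cases h.q_ne hp with ⟨n, rfl⟩ | ⟨e, he, n, rfl⟩ | hg
  · exact (hiff one_ne_zero n).2 (removable_difference_one h)
  · have he0 : e ≠ 0 := fun h0 => h.q2_ne (by simp [← he, h0])
    exact (hiff he0 n).2 (removable_difference_sqrt h he)
  · exact (analyticAt_difference h hg).removable

/-- The multiplier `(q/(yz)) x` vanishes at `0`, hence is no power of `q²` there, and the rigidity
principle applies to the difference. -/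
theorem reducedF_eq_reducedG (h : InAnnulus q y z) {x : ℂ} (hx : Generic q x) :
    reducedF q y z x = reducedG q y z x := by
  have h0 := eventually_eq_zero_of_quasiperiodic (μ := fun x => q / (y * z) * x) h.q2_ne h.q2_lt
    (fun p hp => removable_difference h hp) (by fun_prop) (by simp)
    (fun k => by rw [mul_zero]; exact (pow_ne_zero _ h.q2_ne).symm)
    (fun p hp => eventually_difference_mul h hp)
  exact sub_eq_zero.1 (eq_zero_of_eventually_eq_zero
    (f := fun x => reducedF q y z x - reducedG q y z x)
    (analyticAt_difference h hx).continuousAt (h0 x hx.1))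

/-- The identity `F = G` at regular points. -/
theorem F_eq_G (h : InAnnulus q y z) {x : ℂ} (hx0 : x ≠ 0)
    (hx : ∀ n : ℤ, x ≠ q ^ (2 * n + 1) ∧ x ≠ -q ^ (2 * n + 1)) (hr : (x, y, z) ∈ regularSet q) :
    F q x y z = G q x y z := by
  have hg : Generic q x := by
    rcases generic_cases h.q_ne hx0 with ⟨n, hn⟩ | ⟨e, he, n, hn⟩ | hg
    · refine absurd ?_ (hr n).1
      rw [zpow_mul]; simpa using hn
    · exfalso
      have e1 : q ^ (2 * n + 1) = (q ^ 2) ^ n * q := by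
        rw [zpow_add_one₀ h.q_ne, zpow_mul]; norm_cast
      rcases sq_eq_sq_iff_eq_or_eq_neg.1 he with rfl | rfl
      · exact (hx n).1 (by rw [e1, hn])
      · exact (hx n).2 (by rw [e1, hn, mul_neg])
    · exact hg
  rw [F_eq_reducedF h.q_ne, G_eq_reducedG h hg hr, reducedF_eq_reducedG h hg]

end MainIdentity

/-! ### The double series: convergence, continuity and limits through regular triples. -/

section DoubleSum

variable {q y z x : ℂ}

theorem forall_zpow_mul_ne_one_iff (hq0 : q ≠ 0) :
    (∀ n : ℤ, (q ^ 4) ^ n * (x ^ 2 * q ^ 2) ≠ 1) ↔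
      ∀ n : ℤ, x ≠ q ^ (2 * n + 1) ∧ x ≠ -q ^ (2 * n + 1) := by
  have key : ∀ n : ℤ, (q ^ 4) ^ n * (x ^ 2 * q ^ 2) = 1 ↔
      (x = q ^ (2 * (-n - 1) + 1) ∨ x = -q ^ (2 * (-n - 1) + 1)) := by
    intro n
    have e1 : (q ^ 4) ^ n * (x ^ 2 * q ^ 2) = (q ^ (2 * n + 1) * x) ^ 2 := by
      rw [mul_pow, ← zpow_natCast (q ^ (2 * n + 1)), ← zpow_mul, ← zpow_natCast q 4, ← zpow_mul,
        show (2 * n + 1) * ((2 : ℕ) : ℤ) = ((4 : ℕ) : ℤ) * n + 2 by push_cast; ring,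
        zpow_add₀ hq0 _ 2]
      norm_cast
      ring
    have e2 : (q ^ (2 * n + 1) * x) ^ 2 = 1 ↔ q ^ (2 * n + 1) * x = 1 ∨ q ^ (2 * n + 1) * x = -1 := by
      simp
    have hk : q ^ (2 * n + 1) ≠ 0 := zpow_ne_zero _ hq0
    rw [e1, e2, show 2 * (-n - 1) + 1 = -(2 * n + 1) by ring, zpow_neg,
      mul_comm, mul_eq_one_iff_eq_inv₀ hk, ← neg_eq_iff_eq_neg, ← neg_mul,
      mul_eq_one_iff_eq_inv₀ hk, neg_eq_iff_eq_neg]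
  constructor
  · intro h n
    have := (not_congr (key (-n - 1))).1 (h _)
    rw [show -(-n - 1) - 1 = n by ring] at this
    exact not_or.1 this
  · intro h n hn
    rcases (key n).1 hn with h1 | h1
    · exact (h _).1 h1
    · exact (h _).2 h1

theorem summable_pairTerm₁ (h : InAnnulus q y z) (hx0 : x ≠ 0)
    (hx : ∀ n : ℤ, x ≠ q ^ (2 * n + 1) ∧ x ≠ -q ^ (2 * n + 1)) :
    Summable fun p : pairIndex => pairTerm₁ q x y z p := by
  refine (summable_subtype_iff_indicator (f := pairTerm₁ q x y z)).2 ?_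
  rw [indicator_pairTerm₁ h.q_ne]
  exact summable_pairSum h.q4_ne h.q4_lt (mul_ne_zero (pow_ne_zero 2 hx0) h.q2_ne)
    (fun n _ => (forall_zpow_mul_ne_one_iff h.q_ne).2 hx n) (h.sq_lt.trans h.lt_wy) h.wy_lt
    (h.sq_lt.trans h.lt_wz) h.wz_lt

theorem summable_pairTerm₂ (h : InAnnulus q y z) (hx0 : x ≠ 0)
    (hx : ∀ n : ℤ, x ≠ q ^ (2 * n + 1) ∧ x ≠ -q ^ (2 * n + 1)) :
    Summable fun p : pairIndex => pairTerm₂ q x y z p := by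
  refine (summable_subtype_iff_indicator (f := pairTerm₂ q x y z)).2 ?_
  rw [indicator_pairTerm₂ h.q_ne]
  exact summable_pairSum h.q4_ne h.q4_lt (mul_ne_zero (pow_ne_zero 2 hx0) h.q2_ne)
    (fun n _ => (forall_zpow_mul_ne_one_iff h.q_ne).2 hx n) (h.sq_lt.trans h.lt_wy) h.wy_lt
    h.lt_wz' h.wz_lt'

theorem continuousAt_F (h : InAnnulus q y z) (hx0 : x ≠ 0)
    (hx : ∀ n : ℤ, x ≠ q ^ (2 * n + 1) ∧ x ≠ -q ^ (2 * n + 1)) :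
    ContinuousAt (fun p : ℂ × ℂ × ℂ => F q p.1 p.2.1 p.2.2) (x, y, z) := by
  have hX0 : x ^ 2 * q ^ 2 ≠ 0 := mul_ne_zero (pow_ne_zero 2 hx0) h.q2_ne
  have hX := fun (n : ℤ) (_ : n ≠ -1) => (forall_zpow_mul_ne_one_iff h.q_ne).2 hx n
  have hw := h.sq_lt.trans h.lt_wy
  have h1 := continuousAt_pairSum h.q4_ne h.q4_lt hX0 hX hw h.wy_lt (h.sq_lt.trans h.lt_wz) h.wz_lt
  have h2 := continuousAt_pairSum h.q4_ne h.q4_lt hX0 hX hw h.wy_lt h.lt_wz' h.wz_lt'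
  have c1 : ContinuousAt (fun p : ℂ × ℂ × ℂ =>
      pairSum (q ^ 4) (p.1 ^ 2 * q ^ 2) (q ^ 2 * p.2.1 ^ 2) (p.2.2 ^ 2)) (x, y, z) :=
    ContinuousAt.comp (g := fun v : ℂ × ℂ × ℂ => pairSum (q ^ 4) v.1 v.2.1 v.2.2)
      (f := fun p : ℂ × ℂ × ℂ => (p.1 ^ 2 * q ^ 2, q ^ 2 * p.2.1 ^ 2, p.2.2 ^ 2)) h1 (by fun_prop)
  have c2 : ContinuousAt (fun p : ℂ × ℂ × ℂ =>
      pairSum (q ^ 4) (p.1 ^ 2 * q ^ 2) (q ^ 2 * p.2.1 ^ 2) (q ^ 4 * p.2.2 ^ 2)) (x, y, z) :=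
    ContinuousAt.comp (g := fun v : ℂ × ℂ × ℂ => pairSum (q ^ 4) v.1 v.2.1 v.2.2)
      (f := fun p : ℂ × ℂ × ℂ => (p.1 ^ 2 * q ^ 2, q ^ 2 * p.2.1 ^ 2, q ^ 4 * p.2.2 ^ 2)) h2
      (by fun_prop)
  have c3 : ContinuousAt (fun p : ℂ × ℂ × ℂ => p.2.2) (x, y, z) := by fun_prop
  have c4 : ContinuousAt (fun p : ℂ × ℂ × ℂ => p.1 * p.2.1 * q) (x, y, z) := by fun_prop
  have c5 := (c3.mul c1).add (c4.mul c2)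
  refine c5.congr (Eventually.of_forall fun p => ?_)
  exact (F_eq_reducedF h.q_ne p.1 p.2.1 p.2.2).symm

theorem InAnnulus.eventually (h : InAnnulus q y z) :
    ∀ᶠ p : ℂ × ℂ × ℂ in 𝓝 (x, y, z), InAnnulus q p.2.1 p.2.2 := by
  have cy : ContinuousAt (fun p : ℂ × ℂ × ℂ => ‖p.2.1‖) (x, y, z) := by fun_prop
  have cz : ContinuousAt (fun p : ℂ × ℂ × ℂ => ‖p.2.2‖) (x, y, z) := by fun_prop
  filter_upwards [cy.eventually_const_lt h.lt_y, cy.eventually_lt_const h.y_lt,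
    cz.eventually_const_lt h.lt_z, cz.eventually_lt_const h.z_lt] with p h1 h2 h3 h4
  exact ⟨h.q_ne, h.q_lt, h1, h2, h3, h4⟩

/-- The annulus conditions and the pole conditions on `x` are open, so `G` equals the continuous
function `F` at all regular triples near the given one. -/
theorem tendsto_G (h : InAnnulus q y z) (hx0 : x ≠ 0)
    (hx : ∀ n : ℤ, x ≠ q ^ (2 * n + 1) ∧ x ≠ -q ^ (2 * n + 1)) :
    Tendsto (fun p : ℂ × ℂ × ℂ => G q p.1 p.2.1 p.2.2) (𝓝[regularSet q] (x, y, z))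
      (𝓝 (F q x y z)) := by
  refine Tendsto.congr' ?_ ((continuousAt_F h hx0 hx).mono_left nhdsWithin_le_nhds)
  have cx : ContinuousAt (fun p : ℂ × ℂ × ℂ => p.1) (x, y, z) := continuousAt_fst
  have cX : Tendsto (fun p : ℂ × ℂ × ℂ => p.1 ^ 2 * q ^ 2) (𝓝 (x, y, z)) (𝓝 (x ^ 2 * q ^ 2)) :=
    Continuous.tendsto (by fun_prop) (x, y, z)
  have hX := cX.eventually (eventually_zpow_mul_ne_one_of_ne h.q4_ne h.q4_lt
    (mul_ne_zero (pow_ne_zero 2 hx0) h.q2_ne) ((forall_zpow_mul_ne_one_iff h.q_ne).2 hx))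
  filter_upwards [nhdsWithin_le_nhds (h.eventually (x := x)),
    nhdsWithin_le_nhds (cx.eventually_ne hx0), nhdsWithin_le_nhds hX,
    self_mem_nhdsWithin] with p h1 h2 h3 h4
  exact F_eq_G h1 h2 ((forall_zpow_mul_ne_one_iff h.q_ne).1 h3) h4

end DoubleSum

/-! ### The triple sum: convergence and reduction to `F`. -/

section TripleSum

variable {q y z x : ℂ}

theorem signed_zpow_le_pow_natAbs {κ u ρ : ℝ} (hκ0 : 0 < κ) (hu : 0 < u) (hρ : u ≤ ρ)
    (hρ' : κ / u ≤ ρ) (r : ℤ) : (if 0 ≤ r then 1 else κ ^ r.natAbs) * u ^ r ≤ ρ ^ r.natAbs := by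
  split_ifs with hr
  · lift r to ℕ using hr
    rw [one_mul, zpow_natCast, Int.natAbs_natCast]
    gcongr
  · have e : u ^ r = (u ^ r.natAbs)⁻¹ := by
      rw [← zpow_natCast, ← zpow_neg]; congr 1; omega
    rw [e, ← div_eq_mul_inv, ← div_pow]
    gcongr

/-- For negative indices the quadratic exponent is at least `-r - s - t`, which provides a factor
`‖q‖` for every inverse power of `x`, `y`, `z`; the lower bounds `‖q‖ < ‖x‖, ‖y‖, ‖z‖` then allow a
choice of `ρ < 1`. -/
theorem norm_tripleTerm_le (hq0 : q ≠ 0) (hq1 : ‖q‖ < 1) {ρ : ℝ} (hx0 : x ≠ 0) (hy0 : y ≠ 0)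
    (hz0 : z ≠ 0) (hx : ‖x‖ ≤ ρ) (hy : ‖y‖ ≤ ρ) (hz : ‖z‖ ≤ ρ) (hx' : ‖q‖ / ‖x‖ ≤ ρ)
    (hy' : ‖q‖ / ‖y‖ ≤ ρ) (hz' : ‖q‖ / ‖z‖ ≤ ρ) {r s t : ℤ} (hrs : sg r = sg s)
    (hst : sg s = sg t) :
    ‖tripleTerm q x y z (r, s, t)‖ ≤ ρ ^ r.natAbs * (ρ ^ s.natAbs * ρ ^ t.natAbs) := by
  have hq := norm_pos_iff.2 hq0
  have hxn := norm_pos_iff.2 hx0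
  have hyn := norm_pos_iff.2 hy0
  have hzn := norm_pos_iff.2 hz0
  have hρ : 0 < ρ := hxn.trans_le hx
  have hr := signed_zpow_le_pow_natAbs hq hxn hx hx' r
  have hs := signed_zpow_le_pow_natAbs hq hyn hy hy' s
  have ht := signed_zpow_le_pow_natAbs hq hzn hz hz' t
  rw [sg_eq_sg_iff] at hrs hst
  have hexp : ‖q‖ ^ (r * s + r * t + s * t) ≤ (if 0 ≤ r then 1 else ‖q‖ ^ r.natAbs) *
      ((if 0 ≤ s then 1 else ‖q‖ ^ s.natAbs) * (if 0 ≤ t then 1 else ‖q‖ ^ t.natAbs)) := by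
    by_cases h0 : 0 ≤ r
    · have h1 := hrs.1 h0
      have h2 := hst.1 h1
      simp only [h0, h1, h2, if_true, mul_one]
      exact zpow_le_one₀ hq hq1.le (by positivity)
    · have h1 : ¬ 0 ≤ s := fun hh => h0 (hrs.2 hh)
      have h2 : ¬ 0 ≤ t := fun hh => h1 (hst.2 hh)
      simp only [h0, h1, h2, if_false]
      rw [← pow_add, ← pow_add, ← zpow_natCast]
      refine zpow_le_zpow_right_of_le_one₀ hq hq1.le ?_
      have e : ((r.natAbs + (s.natAbs + t.natAbs) : ℕ) : ℤ) = -r - s - t := by omega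
      rw [e]
      -- Adding these three products gives `rs + st + tr + r + s + t ≥ 0`.
      have : 0 ≤ (-r) * (-s - 1) := mul_nonneg (by omega) (by omega)
      have : 0 ≤ (-s) * (-t - 1) := mul_nonneg (by omega) (by omega)
      have : 0 ≤ (-t) * (-r - 1) := mul_nonneg (by omega) (by omega)
      linarith
  simp only [tripleTerm, norm_mul, norm_zpow]
  calc _ ≤ ((if 0 ≤ r then 1 else ‖q‖ ^ r.natAbs) *
      ((if 0 ≤ s then 1 else ‖q‖ ^ s.natAbs) * (if 0 ≤ t then 1 else ‖q‖ ^ t.natAbs))) *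
        ‖x‖ ^ r * ‖y‖ ^ s * ‖z‖ ^ t := by gcongr
    _ = ((if 0 ≤ r then 1 else ‖q‖ ^ r.natAbs) * ‖x‖ ^ r) *
        (((if 0 ≤ s then 1 else ‖q‖ ^ s.natAbs) * ‖y‖ ^ s) *
          ((if 0 ≤ t then 1 else ‖q‖ ^ t.natAbs) * ‖z‖ ^ t)) := by ring
    _ ≤ _ := by gcongr

theorem summable_indicator_tripleTerm (h : InAnnulus q y z) (hx : ‖q‖ < ‖x‖) (hx1 : ‖x‖ < 1) :
    Summable (tripleIndex.indicator (tripleTerm q x y z)) := by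
  have hx0 : x ≠ 0 := norm_pos_iff.1 ((norm_nonneg _).trans_lt hx)
  have hxn := norm_pos_iff.2 hx0
  have hyn := norm_pos_iff.2 h.y_ne
  have hzn := norm_pos_iff.2 h.z_ne
  obtain ⟨ρ, hρ, hρ1⟩ : ∃ ρ, max (max ‖x‖ (‖q‖ / ‖x‖)) (max (max ‖y‖ (‖q‖ / ‖y‖))
      (max ‖z‖ (‖q‖ / ‖z‖))) ≤ ρ ∧ ρ < 1 := by
    refine ⟨_, le_rfl, ?_⟩
    simp only [max_lt_iff, div_lt_one hxn, div_lt_one hyn, div_lt_one hzn]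
    exact ⟨⟨hx1, hx⟩, ⟨h.y_lt, h.lt_y⟩, h.z_lt, h.lt_z⟩
  simp only [max_le_iff] at hρ
  obtain ⟨⟨h1, h2⟩, ⟨h3, h4⟩, h5, h6⟩ := hρ
  have hρ0 : 0 ≤ ρ := (norm_nonneg _).trans h1
  have hs1 := summable_pow_natAbs hρ0 hρ1
  have hs := hs1.mul_of_nonneg (hs1.mul_of_nonneg hs1 (fun _ => by positivity)
    (fun _ => by positivity)) (fun _ => by positivity) (fun _ => by positivity)
  refine hs.of_norm_bounded fun p => ?_
  by_cases hp : p ∈ tripleIndex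
  · rw [Set.indicator_of_mem hp]
    exact norm_tripleTerm_le h.q_ne h.q_lt hx0 h.y_ne h.z_ne h1 h3 h5 h2 h4 h6 hp.1 hp.2.1
  · rw [Set.indicator_of_notMem hp, norm_zero]
    positivity

/-- The triples with first two entries even and last one odd. -/
def evenEvenOdd (p : (ℤ × ℤ) × ℤ) : ℤ × ℤ × ℤ := (2 * p.2, 2 * p.1.1, 2 * p.1.2 + 1)

/-- The triples with first two entries odd and last one even. -/
def oddOddEven (p : (ℤ × ℤ) × ℤ) : ℤ × ℤ × ℤ := (2 * p.2 + 1, 2 * p.1.1 + 1, 2 * p.1.2)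

theorem evenEvenOdd_injective : Function.Injective evenEvenOdd := by
  rintro ⟨⟨s, t⟩, r⟩ ⟨⟨s', t'⟩, r'⟩ h
  simp only [evenEvenOdd, Prod.mk.injEq] at h ⊢
  omega

theorem oddOddEven_injective : Function.Injective oddOddEven := by
  rintro ⟨⟨s, t⟩, r⟩ ⟨⟨s', t'⟩, r'⟩ h
  simp only [oddOddEven, Prod.mk.injEq] at h ⊢
  omega

theorem disjoint_range_evenEvenOdd_oddOddEven :
    Disjoint (Set.range evenEvenOdd) (Set.range oddOddEven) := by
  rw [Set.disjoint_left]
  rintro _ ⟨⟨⟨s, t⟩, r⟩, rfl⟩ ⟨⟨⟨s', t'⟩, r'⟩, h⟩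
  simp only [evenEvenOdd, oddOddEven, Prod.mk.injEq] at h
  omega

theorem tripleIndex_subset :
    tripleIndex ⊆ Set.range evenEvenOdd ∪ Set.range oddOddEven := by
  rintro ⟨r, s, t⟩ ⟨-, -, h1, h2⟩
  simp only [Int.ModEq] at h1 h2
  rcases Int.emod_two_eq_zero_or_one s with hs | hs
  · refine Or.inl ⟨((s / 2, t / 2), r / 2), ?_⟩
    simp only [evenEvenOdd, Prod.mk.injEq]; omega
  · refine Or.inr ⟨((s / 2, t / 2), r / 2), ?_⟩
    simp only [oddOddEven, Prod.mk.injEq]; omega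

theorem evenEvenOdd_mem_iff {r s t : ℤ} :
    evenEvenOdd ((s, t), r) ∈ tripleIndex ↔ sg s = sg t ∧ sg s = sg r := by
  simp only [evenEvenOdd, tripleIndex, Set.mem_ofPred_eq, Int.ModEq, sg_eq_sg_iff]
  omega

theorem oddOddEven_mem_iff {r s t : ℤ} :
    oddOddEven ((s, t), r) ∈ tripleIndex ↔ sg s = sg t ∧ sg s = sg r := by
  simp only [oddOddEven, tripleIndex, Set.mem_ofPred_eq, Int.ModEq, sg_eq_sg_iff]
  omega

theorem tripleTerm_evenEvenOdd (hq0 : q ≠ 0) (hz0 : z ≠ 0) (r s t : ℤ) :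
    tripleTerm q x y z (evenEvenOdd ((s, t), r)) =
      z * (q ^ (4 * s * t + 2 * s) * y ^ (2 * s) * z ^ (2 * t)) *
        (x ^ 2 * q ^ (4 * s + 4 * t + 2)) ^ r := by
  simp only [tripleTerm, evenEvenOdd]
  rw [zpow_add_one₀ hz0, mul_zpow, ← zpow_mul, ← zpow_natCast x, ← zpow_mul,
    show 2 * r * (2 * s) + 2 * r * (2 * t + 1) + 2 * s * (2 * t + 1) =
      (4 * s * t + 2 * s) + (4 * s + 4 * t + 2) * r by ring, zpow_add₀ hq0]
  push_cast
  ring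

theorem tripleTerm_oddOddEven (hq0 : q ≠ 0) (hx0 : x ≠ 0) (hy0 : y ≠ 0) (r s t : ℤ) :
    tripleTerm q x y z (oddOddEven ((s, t), r)) =
      x * y * q * (q ^ (4 * s * t + 2 * s + 4 * t) * y ^ (2 * s) * z ^ (2 * t)) *
        (x ^ 2 * q ^ (4 * s + 4 * t + 2)) ^ r := by
  simp only [tripleTerm, oddOddEven]
  rw [zpow_add_one₀ hx0, zpow_add_one₀ hy0, mul_zpow, ← zpow_mul, ← zpow_natCast x, ← zpow_mul,
    show (2 * r + 1) * (2 * s + 1) + (2 * r + 1) * (2 * t) + (2 * s + 1) * (2 * t) =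
      (4 * s * t + 2 * s + 4 * t) + (4 * s + 4 * t + 2) * r + 1 by ring, zpow_add_one₀ hq0,
    zpow_add₀ hq0]
  push_cast
  ring

/-- For negative `s`, `t` the exponent `4s + 4t + 2` is at most `-2`, so `‖x‖ > ‖q‖` makes the ratio
larger than `1` in norm, as the series over negative `r` requires. -/
theorem hasSum_geometric_pair (hq0 : q ≠ 0) (hq1 : ‖q‖ < 1) (hx : ‖q‖ < ‖x‖) (hx1 : ‖x‖ < 1)
    {s t : ℤ} (hst : sg s = sg t) :
    HasSum (fun r : ℤ => if sg s = sg r then (x ^ 2 * q ^ (4 * s + 4 * t + 2)) ^ r else 0)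
      ((sg s : ℂ) / (1 - x ^ 2 * q ^ (4 * s + 4 * t + 2))) := by
  have hq := norm_pos_iff.2 hq0
  have hxn : 0 < ‖x‖ := hq.trans hx
  rw [sg_eq_sg_iff] at hst
  refine hasSum_geometric_sg (fun hs => ?_) fun hs => ?_
  · rw [norm_mul, norm_pow, norm_zpow]
    exact mul_lt_one_of_nonneg_of_lt_one_left (by positivity) (pow_lt_one₀ hxn.le hx1 two_ne_zero)
      (zpow_le_one₀ hq hq1.le (by have := hst.1 hs; omega))
  · rw [norm_mul, norm_pow, norm_zpow]
    have h1 : ‖q‖ ^ (-2 : ℤ) ≤ ‖q‖ ^ (4 * s + 4 * t + 2) :=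
      zpow_le_zpow_right_of_le_one₀ hq hq1.le (by omega)
    calc 1 = ‖q‖ ^ 2 * ‖q‖ ^ (-2 : ℤ) := by
          rw [zpow_neg, zpow_ofNat, mul_inv_cancel₀ (by positivity)]
      _ < ‖x‖ ^ 2 * ‖q‖ ^ (-2 : ℤ) := by gcongr
      _ ≤ _ := by gcongr

/-- Absolute convergence allows `r` to be summed first for fixed `(s, t)`; the geometric series in
`r` creates both the sign and the denominator of `pairTerm₁`. -/
theorem hasSum_evenEvenOdd (h : InAnnulus q y z) (hx : ‖q‖ < ‖x‖) (hx1 : ‖x‖ < 1) :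
    HasSum (tripleIndex.indicator (tripleTerm q x y z) ∘ evenEvenOdd)
      (z * ∑' p : pairIndex, pairTerm₁ q x y z p) := by
  have hs := (summable_indicator_tripleTerm h hx hx1).comp_injective evenEvenOdd_injective
  have e := hs.tsum_prod
  refine hs.hasSum_iff.2 ?_
  rw [e, tsum_subtype pairIndex (pairTerm₁ q x y z), ← tsum_mul_left]
  congr 1; ext ⟨s, t⟩
  by_cases hst : sg s = sg t
  · have hmem : (s, t) ∈ pairIndex := hst
    rw [Set.indicator_of_mem hmem]
    have hg := (hasSum_geometric_pair h.q_ne h.q_lt hx hx1 hst).mul_left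
      (z * (q ^ (4 * s * t + 2 * s) * y ^ (2 * s) * z ^ (2 * t)))
    convert! hg.tsum_eq using 1
    · congr 1; ext r
      by_cases hr : sg s = sg r
      · rw [Function.comp_apply, Set.indicator_of_mem (evenEvenOdd_mem_iff.2 ⟨hst, hr⟩),
          tripleTerm_evenEvenOdd h.q_ne h.z_ne, if_pos hr]
      · rw [Function.comp_apply, Set.indicator_of_notMem fun hm => hr (evenEvenOdd_mem_iff.1 hm).2,
          if_neg hr, mul_zero]
    · simp only [pairTerm₁]; ring
  · have hmem : (s, t) ∉ pairIndex := hst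
    rw [Set.indicator_of_notMem hmem]
    simp [evenEvenOdd_mem_iff, hst]

theorem hasSum_oddOddEven (h : InAnnulus q y z) (hx : ‖q‖ < ‖x‖) (hx1 : ‖x‖ < 1) :
    HasSum (tripleIndex.indicator (tripleTerm q x y z) ∘ oddOddEven)
      (x * y * q * ∑' p : pairIndex, pairTerm₂ q x y z p) := by
  have hx0 : x ≠ 0 := norm_pos_iff.1 ((norm_nonneg _).trans_lt hx)
  have hs := (summable_indicator_tripleTerm h hx hx1).comp_injective oddOddEven_injective
  have e := hs.tsum_prod
  refine hs.hasSum_iff.2 ?_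
  rw [e, tsum_subtype pairIndex (pairTerm₂ q x y z), ← tsum_mul_left]
  congr 1; ext ⟨s, t⟩
  by_cases hst : sg s = sg t
  · have hmem : (s, t) ∈ pairIndex := hst
    rw [Set.indicator_of_mem hmem]
    have hg := (hasSum_geometric_pair h.q_ne h.q_lt hx hx1 hst).mul_left
      (x * y * q * (q ^ (4 * s * t + 2 * s + 4 * t) * y ^ (2 * s) * z ^ (2 * t)))
    convert! hg.tsum_eq using 1
    · congr 1; ext r
      by_cases hr : sg s = sg r
      · rw [Function.comp_apply, Set.indicator_of_mem (oddOddEven_mem_iff.2 ⟨hst, hr⟩),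
          tripleTerm_oddOddEven h.q_ne hx0 h.y_ne, if_pos hr]
      · rw [Function.comp_apply, Set.indicator_of_notMem fun hm => hr (oddOddEven_mem_iff.1 hm).2,
          if_neg hr, mul_zero]
    · simp only [pairTerm₂]; ring
  · have hmem : (s, t) ∉ pairIndex := hst
    rw [Set.indicator_of_notMem hmem]
    simp [oddOddEven_mem_iff, hst]

theorem tripleSum_eq_F (h : InAnnulus q y z) (hx : ‖q‖ < ‖x‖) (hx1 : ‖x‖ < 1) :
    tripleSum q x y z = F q x y z := by
  have h1 := (evenEvenOdd_injective.hasSum_range_iff).2 (hasSum_evenEvenOdd h hx hx1)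
  have h2 := (oddOddEven_injective.hasSum_range_iff).2 (hasSum_oddOddEven h hx hx1)
  have h3 := HasSum.add_disjoint (f := tripleIndex.indicator (tripleTerm q x y z))
    disjoint_range_evenEvenOdd_oddOddEven h1 h2
  have h4 := (hasSum_subtype_iff_of_support_subset
    (Set.support_indicator_subset.trans tripleIndex_subset)).1 h3
  rw [tripleSum, tsum_subtype tripleIndex (tripleTerm q x y z), h4.tsum_eq, F]

theorem zpow_exponent_bounds {u : ℂ} (hq0 : q ≠ 0) (hq1 : ‖q‖ < 1) {k m : ℤ}
    (hu : ‖q‖ ^ m < ‖u‖) (hu1 : ‖u‖ < 1) (h : ‖u‖ = ‖q‖ ^ k) : 0 < k ∧ k < m := by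
  have hq := norm_pos_iff.2 hq0
  rw [h] at hu hu1
  rw [← zpow_zero ‖q‖] at hu1
  exact ⟨(zpow_lt_zpow_iff_right_of_lt_one₀ hq hq1).1 hu1,
    (zpow_lt_zpow_iff_right_of_lt_one₀ hq hq1).1 hu⟩

theorem ne_zpow_of_norm {u : ℂ} (hq0 : q ≠ 0) (hq1 : ‖q‖ < 1) (hu : ‖q‖ < ‖u‖) (hu1 : ‖u‖ < 1)
    (k : ℤ) : u ≠ q ^ k ∧ u ≠ -q ^ k := by
  constructor
  · rintro h
    have := zpow_exponent_bounds (m := 1) (k := k) hq0 hq1 (by simpa using hu) hu1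
      (by rw [h, norm_zpow])
    omega
  · rintro h
    have := zpow_exponent_bounds (m := 1) (k := k) hq0 hq1 (by simpa using hu) hu1
      (by rw [h, norm_neg, norm_zpow])
    omega

/-- The product has norm strictly between `‖q‖²` and `1`, which leaves only the exponent `1`. -/
theorem eq_one_of_mul_eq_neg_zpow {u v : ℂ} (hq0 : q ≠ 0) (hq1 : ‖q‖ < 1) (hu : ‖q‖ < ‖u‖)
    (hu1 : ‖u‖ < 1) (hv : ‖q‖ < ‖v‖) (hv1 : ‖v‖ < 1) {k : ℤ} (h : u * v = -q ^ k) : k = 1 := by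
  have hq := norm_pos_iff.2 hq0
  have := zpow_exponent_bounds (u := u * v) (m := 2) (k := k) hq0 hq1
    (by rw [norm_mul, zpow_ofNat, pow_two]; gcongr)
    (by rw [norm_mul]; exact mul_lt_one_of_nonneg_of_lt_one_left (norm_nonneg _) hu1 hv1.le)
    (by rw [h, norm_neg, norm_zpow])
  omega

/-- Inside the annulus no power of `q` occurs as `x`, and the only admissible exponent for a product
is `1`. This excludes `xy = -q^{2n}` by parity and leaves `yz = -q` and `xz = -q` as the only
exceptions. -/
theorem mem_regularSet (h : InAnnulus q y z) (hx : ‖q‖ < ‖x‖) (hx1 : ‖x‖ < 1)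
    (hyz : y * z ≠ -q) (hxz : x * z ≠ -q) : (x, y, z) ∈ regularSet q := by
  refine fun n => ⟨(ne_zpow_of_norm h.q_ne h.q_lt hx hx1 _).1, fun e => hyz ?_, fun e => hxz ?_,
    fun e => ?_⟩
  · have := eq_one_of_mul_eq_neg_zpow h.q_ne h.q_lt h.lt_y h.y_lt h.lt_z h.z_lt e
    rw [e, this, zpow_one]
  · have := eq_one_of_mul_eq_neg_zpow h.q_ne h.q_lt hx hx1 h.lt_z h.z_lt e
    rw [e, this, zpow_one]
  · have := eq_one_of_mul_eq_neg_zpow h.q_ne h.q_lt hx hx1 h.lt_y h.y_lt e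
    omega

end TripleSum

end KroneckerTriple

end

open KroneckerTriple in
theorem theorem3 (q y z : ℂ) (hq0 : q ≠ 0) (hq1 : ‖q‖ < 1)
    (hqy : ‖q‖ < ‖y‖) (hy1 : ‖y‖ < 1) (hqz : ‖q‖ < ‖z‖) (hz1 : ‖z‖ < 1) :
    (∀ x : ℂ, ‖q‖ < ‖x‖ → ‖x‖ < 1 →
      Summable (fun p : tripleIndex => tripleTerm q x y z p) ∧
      (y * z ≠ -q → x * z ≠ -q → tripleSum q x y z = G q x y z) ∧
      Tendsto (fun p : ℂ × ℂ × ℂ => G q p.1 p.2.1 p.2.2)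
        (𝓝[regularSet q] (x, y, z)) (𝓝 (tripleSum q x y z))) ∧
    (∀ x : ℂ, x ≠ 0 → (∀ n : ℤ, x ≠ q ^ (2 * n + 1) ∧ x ≠ -q ^ (2 * n + 1)) →
      Summable (fun p : pairIndex => pairTerm₁ q x y z p) ∧
      Summable (fun p : pairIndex => pairTerm₂ q x y z p) ∧
      ((x, y, z) ∈ regularSet q → F q x y z = G q x y z) ∧
      Tendsto (fun p : ℂ × ℂ × ℂ => G q p.1 p.2.1 p.2.2)
        (𝓝[regularSet q] (x, y, z)) (𝓝 (F q x y z))) := by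
  have h : InAnnulus q y z := ⟨hq0, hq1, hqy, hy1, hqz, hz1⟩
  refine ⟨fun x hx hx1 => ?_, fun x hx0 hx => ⟨summable_pairTerm₁ h hx0 hx,
    summable_pairTerm₂ h hx0 hx, F_eq_G h hx0 hx, tendsto_G h hx0 hx⟩⟩
  have hx0 : x ≠ 0 := norm_pos_iff.1 ((norm_nonneg _).trans_lt hx)
  have hxn := fun n : ℤ => ne_zpow_of_norm hq0 hq1 hx hx1 (2 * n + 1)
  refine ⟨(summable_subtype_iff_indicator (f := tripleTerm q x y z)).2
    (summable_indicator_tripleTerm h hx hx1), fun hyz hxz => ?_, ?_⟩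
  · rw [tripleSum_eq_F h hx hx1]
    exact F_eq_G h hx0 hxn (mem_regularSet h hx hx1 hyz hxz)
  · rw [tripleSum_eq_F h hx hx1]
    exact tendsto_G h hx0 hxn
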